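/- Let $K$ be a finite extension of $\mathbb{Q}_p$ with valuation ring $R$ and prime element $\pi$, and let $V$ be an $n$-dimensional $K$-vector space. Let $X$ be the Bruhat-Tits building of $PGL(V)$, with the metric $d$ coming from a fixed scalar product, invariant under the Weyl group, on the vector space $\mathbb{R}^n/\mathbb{R}(1,\ldots,1)$ underlying its apartments. Identify the vertices of $X$ with the homothety classes $\{L\}$ of $R$-lattices $L$ of full rank in $V$; two distinct classes are joined by a $1$-simplex iff they have representatives $M,N$ with $\pi N\subset M\subset N$. Let $X\cup X_\infty$ be the compactification of $X$ by classes of half-geodesics, and for a subspace $0\neq W\neq V$ let $y_W\in X_\infty$ be the point whose stabilizer is the stabilizer of $W$. A geodesic is a map $\gamma:\mathbb{R}\to X$ with $d(\gamma(s),\gamma(t))=|s-t|$ for all $s,t$. It is called combinatorial if its image is a union of closed $1$-simplices, and it is said to connect $W$ and $W'$ if $\gamma(t)\to y_W$ for $t\to\infty$ and $\gamma(t)\to y_{W'}$ for $t\to-\infty$. Two geodesics agree up to reparametrization if they differ by an isometry of $\mathbb{R}$. Let $W,W'$ be non-zero subspaces of $V$ with $W\oplus W'=V$. If $M$ and $M'$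 are $R$-lattices of full rank in $W$ and $W'$ respectively, then there is a combinatorial geodesic connecting $W$ and $W'$ whose vertices are exactly the classes $\{M+\pi^kM'\}$, $k\in\mathbb{Z}$, and up to reparametrization it is the only geodesic in $X$ that contains all of these vertices. Assigning this geodesic to $(M,M')$ induces a well-defined bijection between the set of pairs $(\{M\},\{M'\})$ of homothety classes of $R$-lattices of full rank in $W$ and in $W'$, and the set of combinatorial geodesics connecting $W$ and $W'$ up to reparametrization. -/

import Mathlib

open Module Filter Topology
open scoped NormedField Pointwise

noncomputable section

namespace BruhatTits

/-! ## Lattices -/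

section Lattice

variable {K : Type*} [NontriviallyNormedField K] [IsUltrametricDist K]
  {V : Type*} [AddCommGroup V] [Module K V]

/-- `M` is a lattice of full rank in the subspace `W`: a finitely generated module over the
valuation ring of `K` whose `K`-span is `W`. -/
def IsLatticeIn (W : Submodule K V) (M : Submodule (Valued.integer K) V) : Prop :=
  M.FG ∧ Submodule.span K (M : Set V) = W

/-- Homothety of lattices: `N = c M` for some `c ∈ Kˣ`. -/
def Homothetic (M N : Submodule (Valued.integer K) V) : Prop :=
  ∃ c : K, c ≠ 0 ∧ N = c • M

theorem Homothetic.refl (M : Submodule (Valued.integer K) V) : Homothetic M M :=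
  ⟨1, one_ne_zero, (one_smul K M).symm⟩

theorem Homothetic.symm {M N : Submodule (Valued.integer K) V} (h : Homothetic M N) :
    Homothetic N M := by
  obtain ⟨c, hc, rfl⟩ := h
  exact ⟨c⁻¹, inv_ne_zero hc, by rw [smul_smul, inv_mul_cancel₀ hc, one_smul]⟩

theorem Homothetic.trans {M N P : Submodule (Valued.integer K) V} (h : Homothetic M N)
    (h' : Homothetic N P) : Homothetic M P := by
  obtain ⟨c, hc, rfl⟩ := h
  obtain ⟨d, hd, rfl⟩ := h'
  exact ⟨d * c, mul_ne_zero hd hc, by rw [smul_smul]⟩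

/-- Homothety as an equivalence relation on the lattices of full rank in `W`. -/
def latticeSetoid (W : Submodule K V) :
    Setoid {M : Submodule (Valued.integer K) V // IsLatticeIn W M} where
  r M N := Homothetic M.1 N.1
  iseqv := ⟨fun M => Homothetic.refl M.1, fun h => h.symm, fun h h' => h.trans h'⟩

/-- Homothety classes `{M}` of lattices of full rank in `W`. -/
def LatticeClass (W : Submodule K V) : Type _ := Quotient (latticeSetoid W)

/-- The class `{M}`. -/
def LatticeClass.mk {W : Submodule K V} (M : Submodule (Valued.integer K) V)
    (hM : IsLatticeIn W M) : LatticeClass W :=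
  Quotient.mk (latticeSetoid W) ⟨M, hM⟩

/-- The classes of `M` and `N` are adjacent: they are different, and for suitable representatives
`M₁`, `N₁` one has `π N₁ ⊆ M₁ ⊆ N₁`, where `π` is a prime element of the valuation ring. -/
def Adjacent (M N : Submodule (Valued.integer K) V) : Prop :=
  ¬ Homothetic M N ∧
    ∃ (ϖ : Valued.integer K) (M₁ N₁ : Submodule (Valued.integer K) V),
      Irreducible ϖ ∧ Homothetic M M₁ ∧ Homothetic N N₁ ∧ (ϖ : K) • N₁ ≤ M₁ ∧ M₁ ≤ N₁

end Lattice

/-! ## The building of `PGL(V)` -/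

section Building

variable (K : Type*) [NontriviallyNormedField K]
  (V : Type*) [AddCommGroup V] [Module K V]

variable {K V} in
/-- The norm on `V` with orthogonal basis `b` and `‖b i‖ = exp (u i)`. -/
def basisNorm (b : Basis (Fin (finrank K V)) K V) (u : Fin (finrank K V) → ℝ) : V → ℝ :=
  fun x => ⨆ i, ‖b.repr x i‖ * Real.exp (u i)

/-- The norms on `V` which have an orthogonal basis.  Over a local field these are all the
non-archimedean norms on `V`. -/
def SplitNorm : Type _ :=
  {f : V → ℝ // ∃ (b : Basis (Fin (finrank K V)) K V) (u : Fin (finrank K V) → ℝ),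
    f = basisNorm b u}

/-- Homothety of norms. -/
def normSetoid : Setoid (SplitNorm K V) where
  r f g := ∃ r : ℝ, 0 < r ∧ ∀ x, g.1 x = r * f.1 x
  iseqv :=
    { refl := fun f => ⟨1, one_pos, fun x => (one_mul _).symm⟩
      symm := by
        rintro f g ⟨r, hr, h⟩
        exact ⟨r⁻¹, inv_pos.2 hr, fun x => by rw [h x, inv_mul_cancel_left₀ hr.ne']⟩
      trans := by
        rintro f g h ⟨r, hr, h₁⟩ ⟨s, hs, h₂⟩
        exact ⟨s * r, mul_pos hs hr, fun x => by rw [h₂ x, h₁ x, mul_assoc]⟩ }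

/-- The (geometric realization of the) Bruhat-Tits building of `PGL(V)` in the model of Goldman
and Iwahori: the space of homothety classes of norms on `V`. -/
def Building : Type _ := Quotient (normSetoid K V)

variable {K V}

/-- The point with coordinates `u` in the apartment of the basis `b`.  The apartment of `b` is
the set of all these points; it is an affine space under `ℝⁿ / ℝ (1, …, 1)`, since the point
depends on `u` only up to adding a constant. -/
def Building.mk (b : Basis (Fin (finrank K V)) K V) (u : Fin (finrank K V) → ℝ) :
    Building K V :=
  Quotient.mk (normSetoid K V) ⟨basisNorm b u, b, u, rfl⟩

theorem basisNorm_map (b : Basis (Fin (finrank K V)) K V) (u : Fin (finrank K V) → ℝ)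
    (g : V ≃ₗ[K] V) (x : V) : basisNorm (b.map g) u x = basisNorm b u (g.symm x) := by
  simp [basisNorm]

/-- The action of `GL(V)` on norms, `(g f)(x) = f (g⁻¹ x)`. -/
def SplitNorm.act (g : V ≃ₗ[K] V) (f : SplitNorm K V) : SplitNorm K V :=
  ⟨fun x => f.1 (g.symm x), by
    obtain ⟨f, b, u, rfl⟩ := f
    exact ⟨b.map g, u, funext fun x => (basisNorm_map b u g x).symm⟩⟩

/-- The action of `GL(V)` on the building (it factors through `PGL(V)`). -/
instance : SMul (V ≃ₗ[K] V) (Building K V) where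
  smul g := Quotient.map (SplitNorm.act g) fun _ _ ⟨r, hr, h⟩ => ⟨r, hr, fun _ => h _⟩

theorem smul_mk (g : V ≃ₗ[K] V) (b : Basis (Fin (finrank K V)) K V)
    (u : Fin (finrank K V) → ℝ) :
    g • Building.mk b u = Building.mk (b.map g) u :=
  congrArg (Quotient.mk (normSetoid K V))
    (Subtype.ext (funext fun x => (basisNorm_map b u g x).symm))

theorem Building.exists_mk (x : Building K V) : ∃ b u, x = Building.mk b u := by
  induction x using Quotient.inductionOn with
  | h f =>
    obtain ⟨f, b, u, rfl⟩ := f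
    exact ⟨b, u, rfl⟩

theorem symm_smul_smul (g : V ≃ₗ[K] V) (x : Building K V) : g.symm • g • x = x := by
  obtain ⟨b, u, rfl⟩ := x.exists_mk
  rw [smul_mk, smul_mk]
  congr 1
  ext i
  simp

/-- The vertex of the building given by the lattice `M` of full rank in `V`:  if `M` is the span
of the basis `b` over the valuation ring, it is the class of the norm with orthonormal basis `b`,
i.e. of the norm with unit ball `M` and with the same values as the absolute value of `K`. -/
def IsVertexOf [IsUltrametricDist K] (M : Submodule (Valued.integer K) V) (x : Building K V) :
    Prop :=
  ∃ b : Basis (Fin (finrank K V)) K V,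
    M = Submodule.span (Valued.integer K) (Set.range b) ∧ x = Building.mk b 0

/-- The closed affine segment between two points, taken inside an apartment containing both. -/
def segmentBetween (x y : Building K V) : Set (Building K V) :=
  {z | ∃ (b : Basis (Fin (finrank K V)) K V) (u v : Fin (finrank K V) → ℝ) (s : ℝ),
    x = Building.mk b u ∧ y = Building.mk b v ∧ 0 ≤ s ∧ s ≤ 1 ∧
      z = Building.mk b ((1 - s) • u + s • v)}

/-- The closed `1`-simplices of the building: the segments joining two vertices given by adjacent
lattice classes. -/
def IsEdge [IsUltrametricDist K] (e : Set (Building K V)) : Prop :=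
  ∃ (M N : Submodule (Valued.integer K) V) (x y : Building K V),
    IsVertexOf M x ∧ IsVertexOf N y ∧ Adjacent M N ∧ e = segmentBetween x y

end Building

/-! ## The metric -/

/-- A scalar product on the vector space `Λ = ℝⁿ / ℝ (1, …, 1)` which is invariant under the Weyl
group `Sₙ`, written as a bilinear form on `ℝⁿ`. -/
structure WeylScalarProduct (n : ℕ) where
  form : LinearMap.BilinForm ℝ (Fin n → ℝ)
  symm' : ∀ x y, form x y = form y x
  nonneg' : ∀ x, 0 ≤ form x x
  eq_zero_iff' : ∀ x, form x x = 0 ↔ ∃ c : ℝ, x = fun _ => c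
  invariant' : ∀ (σ : Equiv.Perm (Fin n)) (x y), form (x ∘ σ) (y ∘ σ) = form x y

section Metric

variable {K : Type*} [NontriviallyNormedField K] {V : Type*} [AddCommGroup V] [Module K V]
  (B : WeylScalarProduct (finrank K V))

/-- The metric of the building: the distance of two points in the Euclidean space given by any
apartment containing both (the set below has exactly one element). -/
def bdist (x y : Building K V) : ℝ :=
  sInf {r | ∃ (b : Basis (Fin (finrank K V)) K V) (u v : Fin (finrank K V) → ℝ),
    x = Building.mk b u ∧ y = Building.mk b v ∧ r = √(B.form (u - v) (u - v))}

theorem bdist_smul_smul (g : V ≃ₗ[K] V) (x y : Building K V) :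
    bdist B (g • x) (g • y) = bdist B x y := by
  unfold bdist
  congr 1
  ext r
  constructor
  · rintro ⟨b, u, v, hx, hy, hr⟩
    refine ⟨b.map g.symm, u, v, ?_, ?_, hr⟩
    · rw [← smul_mk, ← hx, symm_smul_smul]
    · rw [← smul_mk, ← hy, symm_smul_smul]
  · rintro ⟨b, u, v, rfl, rfl, hr⟩
    exact ⟨b.map g, u, v, smul_mk _ _ _, smul_mk _ _ _, hr⟩

/-- Geodesics: isometric maps `ℝ → X`. -/
def IsGeodesic (γ : ℝ → Building K V) : Prop :=
  ∀ s t, bdist B (γ s) (γ t) = |s - t|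

/-- Half-geodesics: isometric maps `ℝ≥0 → X`. -/
def HalfGeodesic : Type _ :=
  {c : NNReal → Building K V // ∀ s t : NNReal, bdist B (c s) (c t) = |(s : ℝ) - t|}

/-- Two half-geodesics are asymptotic (parallel) if they stay at bounded distance. -/
def Asymptotic (c c' : HalfGeodesic B) : Prop :=
  ∃ C : ℝ, ∀ t, bdist B (c.1 t) (c'.1 t) ≤ C

/-- The boundary `X_∞`: half-geodesics up to being asymptotic. -/
def Boundary : Type _ := Quot (Asymptotic B)

variable {B} in
/-- The boundary point of a half-geodesic. -/
def HalfGeodesic.endpoint (c : HalfGeodesic B) : Boundary B := Quot.mk _ c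

variable {B} in
/-- The action of `GL(V)` on half-geodesics. -/
def HalfGeodesic.act (g : V ≃ₗ[K] V) (c : HalfGeodesic B) : HalfGeodesic B :=
  ⟨fun t => g • c.1 t, fun s t => by rw [bdist_smul_smul]; exact c.2 s t⟩

/-- The action of `GL(V)` on the boundary. -/
instance : SMul (V ≃ₗ[K] V) (Boundary B) where
  smul g := Quot.map (HalfGeodesic.act g) fun _ _ ⟨C, hC⟩ =>
    ⟨C, fun t => (bdist_smul_smul B g _ _).trans_le (hC t)⟩

variable {B} in
/-- `ξ` is the boundary point `y_W` given by the subspace `W`, for `0 ≠ W ≠ V`: the (unique)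
point of the boundary whose stabilizer is the maximal parabolic subgroup stabilizing `W`. -/
def IsBoundaryVertexOf (W : Submodule K V) (ξ : Boundary B) : Prop :=
  ∀ g : V ≃ₗ[K] V, g • ξ = ξ ↔ W.map (g : V →ₗ[K] V) = W

/-- The compactification `X ∪ X_∞` of the building. -/
inductive Compactification : Type _
  | point (x : Building K V) : Compactification
  | bdry (ξ : Boundary B) : Compactification

/-- The open ball with centre `x` and radius `ε` in the building. -/
def openBall (x : Building K V) (ε : ℝ) : Set (Compactification B) :=
  {z | ∃ y, z = .point y ∧ bdist B x y < ε}

/-- The cone around the half-geodesic `c`: it contains those points of `X` and `X_∞` for which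
the geodesic from `c 0` to the point passes, at distance `r` from `c 0`, within `ε` of `c r`. -/
def cone (c : HalfGeodesic B) (r : NNReal) (ε : ℝ) : Set (Compactification B) :=
  {z | ∃ y p, z = .point y ∧ r < bdist B (c.1 0) y ∧ bdist B (c.1 0) p = r ∧
        bdist B p y = bdist B (c.1 0) y - r ∧ bdist B p (c.1 r) < ε} ∪
  {z | ∃ c' : HalfGeodesic B, z = .bdry c'.endpoint ∧ c'.1 0 = c.1 0 ∧
        bdist B (c'.1 r) (c.1 r) < ε}

/-- The topology of the compactification is generated by open balls and cones. -/
instance : TopologicalSpace (Compactification B) :=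
  TopologicalSpace.generateFrom
    ({U | ∃ x ε, 0 < ε ∧ U = openBall B x ε} ∪
      {U | ∃ c r ε, 0 < r ∧ 0 < ε ∧ U = cone B c r ε})

/-- The map `γ` from `ℝ` to the building connects `W` and `W'`: `γ t` tends to `y_W` for `t → ∞`
and to `y_{W'}` for `t → -∞`. -/
def Connects (γ : ℝ → Building K V) (W W' : Submodule K V) : Prop :=
  (∃ ξ : Boundary B, IsBoundaryVertexOf W ξ ∧
    Tendsto (fun t => Compactification.point (B := B) (γ t)) atTop
      (𝓝 (Compactification.bdry ξ))) ∧
  (∃ ξ' : Boundary B, IsBoundaryVertexOf W' ξ' ∧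
    Tendsto (fun t => Compactification.point (B := B) (γ t)) atBot
      (𝓝 (Compactification.bdry ξ')))

/-- Combinatorial geodesics: geodesics which consist of `1`-simplices and their vertices. -/
def IsCombinatorialGeodesic [IsUltrametricDist K] (γ : ℝ → Building K V) : Prop :=
  IsGeodesic B γ ∧ ∃ E : Set (Set (Building K V)), (∀ e ∈ E, IsEdge e) ∧ Set.range γ = ⋃₀ E

/-- `γ` and `δ` agree up to reparametrization. -/
def Reparam (γ δ : ℝ → Building K V) : Prop := ∃ φ : ℝ ≃ᵢ ℝ, δ = γ ∘ φ

/-- Reparametrization as an equivalence relation on the combinatorial geodesics connecting `W`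
and `W'`. -/
def geodesicSetoid [IsUltrametricDist K] (W W' : Submodule K V) :
    Setoid {γ : ℝ → Building K V // IsCombinatorialGeodesic B γ ∧ Connects B γ W W'} where
  r γ δ := Reparam γ.1 δ.1
  iseqv :=
    { refl := fun _ => ⟨IsometryEquiv.refl ℝ, rfl⟩
      symm := by
        rintro γ δ ⟨φ, h⟩
        exact ⟨φ.symm, by rw [h]; funext t; simp⟩
      trans := by
        rintro γ δ ε ⟨φ, h⟩ ⟨ψ, h'⟩
        exact ⟨ψ.trans φ, by rw [h', h]; rfl⟩ }

/-- Combinatorial geodesics connecting `W` and `W'`, up to reparametrization. -/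
def CombinatorialGeodesicClass [IsUltrametricDist K] (W W' : Submodule K V) : Type _ :=
  Quotient (geodesicSetoid B W W')

/-- The class of a combinatorial geodesic up to reparametrization. -/
def CombinatorialGeodesicClass.mk [IsUltrametricDist K] {W W' : Submodule K V}
    (γ : ℝ → Building K V) (hγ : IsCombinatorialGeodesic B γ ∧ Connects B γ W W') :
    CombinatorialGeodesicClass B W W' :=
  Quotient.mk (geodesicSetoid B W W') ⟨γ, hγ⟩

/-- `γ` passes through all vertices `{M + π ^ k M'}`, `k ∈ ℤ`. -/
def PassesThrough [IsUltrametricDist K] (ϖ : Valued.integer K) (γ : ℝ → Building K V)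
    (M M' : Submodule (Valued.integer K) V) : Prop :=
  ∀ k : ℤ, ∃ t, IsVertexOf (M ⊔ (ϖ : K) ^ k • M') (γ t)

/-- The vertices of the building on `γ` are exactly the `{M + π ^ k M'}`, `k ∈ ℤ`. -/
def HasVertices [IsUltrametricDist K] (ϖ : Valued.integer K) (γ : ℝ → Building K V)
    (M M' : Submodule (Valued.integer K) V) : Prop :=
  PassesThrough ϖ γ M M' ∧
    ∀ (t : ℝ) (L : Submodule (Valued.integer K) V), IsVertexOf L (γ t) →
      ∃ k : ℤ, Homothetic (M ⊔ (ϖ : K) ^ k • M') L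

end Metric

end BruhatTits

end

set_option linter.unusedSectionVars false

noncomputable section

namespace BruhatTits

/-! ### Ultrametric norms, duality and common orthogonal bases -/

section Norms

variable {K : Type*} [NontriviallyNormedField K] {V : Type*} [AddCommGroup V] [Module K V]

/-! Points of the building are homothety classes of norms, and a basis orthogonal for a norm turns
the logarithms of its values into coordinates in ℝⁿ/ℝ(1,…,1). A pair (M, M') has a basis `e` adapted
to W ⊕ W', with I indexing M and its complement indexing M'. In the apartment of `e` the classes {M
+ π^k M'} are the points k·l on the line spanned by `cochar I`, where l = -log ‖π‖, and this line at
unit speed is the required geodesic. The work lies in showing that nothing else occurs.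

Metric. Two norms always have a common orthogonal basis (`IsOrth.exists_common`), and an ordered
basis defines a retraction onto its apartment by Gram-Schmidt values. The product of these values is
a volume. Comparing the volumes of max(f, e^c g) and e^c g for all c shows that the difference of
two retracted points is majorized by their relative position (`sum_sq_log_gs_sub_le`). A
Weyl-invariant scalar product is a multiple of the variance (`WeylScalarProduct.exists_form_eq`), so
retractions are 1-Lipschitz. Hence the distance does not depend on the apartment (`bdist_eq`), and
the triangle inequality and the CAT(0) inequality (`bdist_sq_le`) hold. Geodesic segments are
therefore unique, which gives uniqueness of the geodesic through all the vertices
(`IsGeodesic.reparam`).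

Classification. By local compactness every geodesic lies in one apartment
(`IsGeodesic.exists_isOrth`) and is a straight line u + t z there. Its limits in the
compactification are the endpoints of its two halves. A linear automorphism fixes the endpoint of
the ray in direction z iff its matrix entries from e i to e j vanish whenever z i < z j. Comparison
with the stabilizer of W forces W to be spanned by the e i with i in some I, and z to take one value
on I and a larger one off I. So a geodesic connecting W and W' is parallel to `cochar I`
(`IsGeodesic.exists_eq_mk_cochar`). If it is combinatorial it contains a vertex, and rescaling the
basis moves this vertex to the origin; the two halves of the new basis span M and M', which gives
surjectivity. Injectivity holds because M and M' are recovered, up to homothety, by intersecting a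
lattice M + π^k M' with W and W'. -/

/-- Ultrametric norms on a vector space. -/
structure IsUltraNorm (K : Type*) [NontriviallyNormedField K] {V : Type*} [AddCommGroup V]
    [Module K V] (f : V → ℝ) : Prop where
  add_le : ∀ x y, f (x + y) ≤ max (f x) (f y)
  smul : ∀ (c : K) x, f (c • x) = ‖c‖ * f x
  eq_zero : ∀ x, f x = 0 → x = 0

/-- The family `x` is orthogonal for the norm `f`. -/
def IsOrth (K : Type*) [NontriviallyNormedField K] {V : Type*} [AddCommGroup V]
    [Module K V] {ι : Type*} [Fintype ι] (f : V → ℝ) (x : ι → V) : Prop :=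
  ∀ (c : ι → K) i, ‖c i‖ * f (x i) ≤ f (∑ j, c j • x j)

namespace IsUltraNorm

variable {f g : V → ℝ}

theorem zero (hf : IsUltraNorm K f) : f 0 = 0 := by simpa using hf.smul 0 0

theorem neg (hf : IsUltraNorm K f) (x : V) : f (-x) = f x := by simpa using hf.smul (-1) x

theorem nonneg (hf : IsUltraNorm K f) (x : V) : 0 ≤ f x := by
  have := hf.add_le x (-x)
  rwa [add_neg_cancel, hf.zero, hf.neg, max_self] at this

theorem pos (hf : IsUltraNorm K f) {x : V} (hx : x ≠ 0) : 0 < f x :=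
  lt_of_le_of_ne (hf.nonneg x) fun h => hx (hf.eq_zero x h.symm)

theorem sub_le (hf : IsUltraNorm K f) (x y : V) : f (x - y) ≤ max (f x) (f y) := by
  rw [sub_eq_add_neg, ← hf.neg y]
  exact hf.add_le _ _

theorem sum_le (hf : IsUltraNorm K f) {ι : Type*} (s : Finset ι) (x : ι → V) {C : ℝ} (hC : 0 ≤ C)
    (h : ∀ i ∈ s, f (x i) ≤ C) : f (∑ i ∈ s, x i) ≤ C := by
  classical
  induction s using Finset.induction_on with
  | empty => simpa [hf.zero]
  | insert a s ha ih =>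
    rw [Finset.sum_insert ha]
    exact (hf.add_le _ _).trans (max_le (h _ (Finset.mem_insert_self _ _))
      (ih fun i hi => h _ (Finset.mem_insert_of_mem hi)))

theorem sup (hf : IsUltraNorm K f) (hg : IsUltraNorm K g) :
    IsUltraNorm K fun x => max (f x) (g x) where
  add_le x y := by
    refine max_le ((hf.add_le x y).trans (max_le_max ?_ ?_))
      ((hg.add_le x y).trans (max_le_max ?_ ?_)) <;> simp
  smul c x := by rw [hf.smul, hg.smul, mul_max_of_nonneg _ _ (norm_nonneg c)]
  eq_zero x h := hf.eq_zero x (le_antisymm (h ▸ le_max_left _ _) (hf.nonneg x))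

theorem const_mul (hf : IsUltraNorm K f) {r : ℝ} (hr : 0 < r) :
    IsUltraNorm K fun x => r * f x where
  add_le x y := by
    rw [← mul_max_of_nonneg _ _ hr.le]
    exact mul_le_mul_of_nonneg_left (hf.add_le x y) hr.le
  smul c x := by rw [hf.smul]; ring
  eq_zero x h := hf.eq_zero x (by simpa [hr.ne'] using h)

theorem comp_equiv (hf : IsUltraNorm K f) (g : V ≃ₗ[K] V) : IsUltraNorm K fun x => f (g x) where
  add_le x y := by rw [map_add]; exact hf.add_le _ _
  smul c x := by rw [map_smul, hf.smul]
  eq_zero x h := by simpa using hf.eq_zero _ h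

end IsUltraNorm

variable {f g : V → ℝ} {ι : Type*} [Fintype ι]

theorem IsOrth.le_repr {e : Basis ι K V} (he : IsOrth K f e) (x : V) (i : ι) :
    ‖e.repr x i‖ * f (e i) ≤ f x := by
  simpa [e.sum_repr] using he (e.repr x) i

theorem IsUltraNorm.le_of_repr (hf : IsUltraNorm K f) (e : Basis ι K V) (x : V) {C : ℝ}
    (hC : 0 ≤ C) (h : ∀ i, ‖e.repr x i‖ * f (e i) ≤ C) : f x ≤ C := by
  rw [← e.sum_repr x]
  exact hf.sum_le _ _ hC fun i _ => by rw [hf.smul]; exact h i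

/-- Only `f` has to be orthogonal: the ultrametric inequality already bounds `g` by its values on
the basis. -/
theorem IsOrth.le_mul (hf : IsUltraNorm K f) (hg : IsUltraNorm K g) {e : Basis ι K V}
    (he : IsOrth K f e) {C : ℝ} (hC : 0 ≤ C) (h : ∀ i, g (e i) ≤ C * f (e i)) (x : V) :
    g x ≤ C * f x := by
  refine hg.le_of_repr e x (mul_nonneg hC (hf.nonneg x)) fun i => ?_
  calc ‖e.repr x i‖ * g (e i) ≤ ‖e.repr x i‖ * (C * f (e i)) :=
        mul_le_mul_of_nonneg_left (h i) (norm_nonneg _)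
    _ = C * (‖e.repr x i‖ * f (e i)) := by ring
    _ ≤ C * f x := mul_le_mul_of_nonneg_left (he.le_repr x i) hC

theorem IsOrth.sup {x : ι → V} (hf : IsOrth K f x) (hg : IsOrth K g x) :
    IsOrth K (fun y => max (f y) (g y)) x := fun c i => by
  rw [mul_max_of_nonneg _ _ (norm_nonneg _)]
  exact max_le_max (hf c i) (hg c i)

theorem IsOrth.const_mul {x : ι → V} (hf : IsOrth K f x) {r : ℝ} (hr : 0 ≤ r) :
    IsOrth K (fun y => r * f y) x := fun c i => by
  have := mul_le_mul_of_nonneg_left (hf c i) hr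
  linarith

theorem IsOrth.reindex {κ : Type*} [Fintype κ] {x : ι → V} (hf : IsOrth K f x) (σ : κ ≃ ι) :
    IsOrth K f (x ∘ σ) := fun c i => by
  have := hf (c ∘ σ.symm) (σ i)
  rw [← σ.sum_comp] at this
  simpa using this

theorem IsOrth.linearIndependent (hf : IsUltraNorm K f) {x : ι → V} (h : IsOrth K f x)
    (hx : ∀ i, x i ≠ 0) : LinearIndependent K x := by
  rw [Fintype.linearIndependent_iff]
  intro c hc i
  have := h c i
  rw [hc, hf.zero] at this
  have h1 := hf.pos (hx i)
  have : ‖c i‖ ≤ 0 := by nlinarith [norm_nonneg (c i)]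
  simpa using this

/-- Non-archimedean Hahn-Banach theorem for a line. -/
theorem IsOrth.exists_dual (hg : IsUltraNorm K g) {e : Basis ι K V} (he : IsOrth K g e) (v : V) :
    ∃ φ : V →ₗ[K] K, (∀ y, ‖φ y‖ * g v ≤ g y) ∧ φ v • v = v := by
  by_cases hv : v = 0
  · exact ⟨0, fun y => by simpa using hg.nonneg y, by simp [hv]⟩
  have hne : (Finset.univ : Finset ι).Nonempty := by
    by_contra h
    rw [Finset.not_nonempty_iff_eq_empty] at h
    apply hv
    rw [← e.sum_repr v, h, Finset.sum_empty]
  -- The functional is the coordinate that realizes the norm of `v`, normalized to be 1 at `v`.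
  obtain ⟨i, -, hi⟩ := Finset.exists_max_image _ (fun i => ‖e.repr v i‖ * g (e i)) hne
  have hle : g v ≤ ‖e.repr v i‖ * g (e i) :=
    hg.le_of_repr e v (mul_nonneg (norm_nonneg _) (hg.nonneg _)) fun j => hi j (Finset.mem_univ j)
  have hc : e.repr v i ≠ 0 := by
    intro h
    rw [h, norm_zero, zero_mul] at hle
    exact absurd (hg.pos hv) hle.not_gt
  refine ⟨(e.repr v i)⁻¹ • e.coord i, fun y => ?_, ?_⟩
  · calc ‖((e.repr v i)⁻¹ • e.coord i) y‖ * g v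
        = ‖e.repr y i‖ * (‖e.repr v i‖⁻¹ * g v) := by simp; ring
      _ ≤ ‖e.repr y i‖ * g (e i) := by
        refine mul_le_mul_of_nonneg_left ?_ (norm_nonneg _)
        rwa [inv_mul_le_iff₀ (norm_pos_iff.2 hc)]
      _ ≤ g y := he.le_repr y i
  · simp [hc]

/-- Inductions below split off `x 0` by a projection `P` killing it; such a `P` carries the flag of
`x` to the flag of the projected tail. -/
theorem map_span_image_Iio_succ {n : ℕ} {x : Fin (n + 1) → V} (P : V →ₗ[K] V) (h0 : P (x 0) = 0)
    (k : Fin n) {v : V} (hv : v ∈ Submodule.span K (x '' Set.Iio k.succ)) :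
    P v ∈ Submodule.span K ((fun j : Fin n => P (x j.succ)) '' Set.Iio k) := by
  have h := Submodule.mem_map_of_mem (f := P) hv
  rw [Submodule.map_span, ← Set.image_comp] at h
  refine Submodule.span_le.2 ?_ h
  rintro _ ⟨j, hj, rfl⟩
  induction j using Fin.cases with
  | zero => simp [h0]
  | succ j => exact Submodule.subset_span ⟨j, Fin.succ_lt_succ_iff.1 hj, rfl⟩

/-- The way back: `z j` differs from `x j.succ` by a multiple of `x 0`, so unitriangularity relative
to `z` lifts to `x`. -/
theorem sub_mem_span_image_Iio_succ {n : ℕ} {x : Fin (n + 1) → V} (φ : V →ₗ[K] K)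
    {z : Fin n → V} (hz : ∀ j, z j = x j.succ - φ (x j.succ) • x 0) (k : Fin n) {y : V}
    (hy : y - z k ∈ Submodule.span K (z '' Set.Iio k)) :
    y - x k.succ ∈ Submodule.span K (x '' Set.Iio k.succ) := by
  have h0 : x 0 ∈ Submodule.span K (x '' Set.Iio k.succ) :=
    Submodule.subset_span ⟨0, Fin.succ_pos k, rfl⟩
  have h1 : Submodule.span K (z '' Set.Iio k) ≤ Submodule.span K (x '' Set.Iio k.succ) := by
    rw [Submodule.span_le]
    rintro _ ⟨j, hj, rfl⟩
    rw [hz]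
    exact Submodule.sub_mem _ (Submodule.subset_span ⟨_, Fin.succ_lt_succ_iff.2 hj, rfl⟩)
      (Submodule.smul_mem _ _ h0)
  have : y - x k.succ = (y - z k) - φ (x k.succ) • x 0 := by rw [hz]; abel
  rw [this]
  exact Submodule.sub_mem _ (h1 hy) (Submodule.smul_mem _ _ h0)

/-- The line of `x₀` is orthogonal to the kernel of `φ`: the norm of the kernel part `h` is at most
the larger of g (c • x₀ + h) and g (c • x₀), and `hφ` absorbs the second. -/
theorem IsOrth.cons (hg : IsUltraNorm K g) {n : ℕ} {x₀ : V} {φ : V →ₗ[K] K}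
    (hφ : ∀ c : K, ∀ y, φ y = 0 → ‖c‖ * g x₀ ≤ g (c • x₀ + y)) {y : Fin n → V}
    (hy : IsOrth K g y) (hφy : ∀ k, φ (y k) = 0) :
    IsOrth K g (Fin.cons x₀ y : Fin (n + 1) → V) := by
  intro c i
  rw [Fin.sum_univ_succ]
  simp only [Fin.cons_zero, Fin.cons_succ]
  set h := ∑ j : Fin n, c j.succ • y j with hh
  have hφh : φ h = 0 := by simp [hh, hφy]
  have h0 := hφ (c 0) h hφh
  induction i using Fin.cases with
  | zero => simpa using h0
  | succ i =>
    have h1 : ‖c i.succ‖ * g (y i) ≤ g h := hy (fun j => c j.succ) i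
    have h2 : g h ≤ max (g (c 0 • x₀ + h)) (g (c 0 • x₀)) := by
      have := hg.sub_le (c 0 • x₀ + h) (c 0 • x₀)
      rwa [add_sub_cancel_left] at this
    rw [hg.smul] at h2
    simpa using h1.trans (h2.trans (max_le le_rfl h0))

/-- Orthogonalization of a finite family. -/
theorem IsOrth.exists_orthogonalization (hg : IsUltraNorm K g) {e : Basis ι K V}
    (he : IsOrth K g e) {n : ℕ} (x : Fin n → V) :
    ∃ y : Fin n → V, IsOrth K g y ∧ ∀ k, y k - x k ∈ Submodule.span K (x '' Set.Iio k) ∧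
      ∀ v ∈ Submodule.span K (x '' Set.Iio k), g (y k) ≤ g (x k + v) := by
  -- The induction also needs the `y k` in the span of the family, so that the functional split off
  -- at the next stage vanishes on them.
  suffices H : ∃ y : Fin n → V, IsOrth K g y ∧ (∀ k, y k ∈ Submodule.span K (Set.range x)) ∧
      ∀ k, y k - x k ∈ Submodule.span K (x '' Set.Iio k) ∧
      ∀ v ∈ Submodule.span K (x '' Set.Iio k), g (y k) ≤ g (x k + v) by
    obtain ⟨y, h1, -, h2⟩ := H
    exact ⟨y, h1, h2⟩
  induction n with
  | zero => exact ⟨x, fun c i => i.elim0, fun i => i.elim0, fun i => i.elim0⟩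
  | succ n ih =>
    obtain ⟨φ, hφ, hφ0⟩ := he.exists_dual hg (x 0)
    -- The projection along `x 0`, contracting for `g`. The family may be dependent; if `x 0 = 0`,
    -- then `P` is the identity.
    set P : V →ₗ[K] V := LinearMap.id - φ.smulRight (x 0) with hP
    have hPv : ∀ v, P v = v - φ v • x 0 := fun v => by simp [hP]
    have hP0 : P (x 0) = 0 := by rw [hPv, hφ0, sub_self]
    have hgP : ∀ v, g (P v) ≤ g v := fun v => by
      rw [hPv]
      exact (hg.sub_le _ _).trans (max_le le_rfl (by rw [hg.smul]; exact hφ v))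
    obtain ⟨y, hy, hyspan, hyx⟩ := ih fun j => P (x j.succ)
    have hspan : Submodule.span K (Set.range fun j : Fin n => P (x j.succ)) ≤
        Submodule.span K (Set.range x) := by
      rw [Submodule.span_le]
      rintro _ ⟨j, rfl⟩
      simp only [hPv]
      exact Submodule.sub_mem _ (Submodule.subset_span ⟨_, rfl⟩)
        (Submodule.smul_mem _ _ (Submodule.subset_span ⟨_, rfl⟩))
    have hx0 : ∀ c : K, ∀ y, P y = y → ‖c‖ * g (x 0) ≤ g (c • x 0 + y) := by
      intro c y hy
      have h1 : φ y • x 0 = 0 := by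
        rw [hPv] at hy
        simpa using hy
      by_cases h0 : x 0 = 0
      · rw [h0, hg.zero, mul_zero]
        exact hg.nonneg _
      have h2 : φ y = 0 := by simpa [h0] using h1
      have h3 : φ (x 0) = 1 := by
        have : (φ (x 0) - 1) • x 0 = 0 := by rw [sub_smul, hφ0, one_smul, sub_self]
        simpa [h0, sub_eq_zero] using this
      have := hφ (c • x 0 + y)
      simpa [h2, h3] using this
    refine ⟨Fin.cons (x 0) y, ?_, ?_, ?_⟩
    · by_cases h0 : x 0 = 0
      · refine IsOrth.cons hg (φ := 0) (fun c y _ => ?_) hy fun k => rfl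
        rw [h0, hg.zero, mul_zero]
        exact hg.nonneg _
      have h3 : φ (x 0) = 1 := by
        have : (φ (x 0) - 1) • x 0 = 0 := by rw [sub_smul, hφ0, one_smul, sub_self]
        simpa [h0, sub_eq_zero] using this
      refine IsOrth.cons hg (φ := φ) (fun c y h => ?_) hy fun k => ?_
      · exact hx0 c y (by rw [hPv, h, zero_smul, sub_zero])
      · have hk := hyspan k
        have : Submodule.span K (Set.range fun j : Fin n => P (x j.succ)) ≤ LinearMap.ker φ := by
          rw [Submodule.span_le]
          rintro _ ⟨j, rfl⟩
          simp [hPv, h3]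
        exact this hk
    · intro k
      induction k using Fin.cases with
      | zero => exact Submodule.subset_span ⟨0, rfl⟩
      | succ k => exact hspan (hyspan k)
    · intro k
      induction k using Fin.cases with
      | zero =>
        refine ⟨by simp, fun v hv => ?_⟩
        have : x '' Set.Iio 0 = ∅ := by
          simp
        rw [this, Submodule.span_empty, Submodule.mem_bot] at hv
        simp [hv]
      | succ k =>
        refine ⟨sub_mem_span_image_Iio_succ φ (fun j => hPv _) k (hyx k).1, fun v hv => ?_⟩
        have h1 := map_span_image_Iio_succ P hP0 k hv
        have h2 := (hyx k).2 _ h1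
        rw [← map_add] at h2
        exact h2.trans (hgP _)

/-- Two norms have a common orthogonal basis, which moreover may be found by orthogonalization of a
given orthogonal family for the first norm after a change of the ordering. -/
theorem IsOrth.exists_common (hf : IsUltraNorm K f) (hg : IsUltraNorm K g) {e : Basis ι K V}
    (he : IsOrth K g e) {n : ℕ} (x : Fin n → V) (hx : ∀ i, x i ≠ 0) (hfx : IsOrth K f x) :
    ∃ (σ : Fin n → Fin n) (y : Fin n → V), Function.Injective σ ∧ IsOrth K f y ∧ IsOrth K g y ∧
      (∀ k, y k ∈ Submodule.span K (Set.range x)) ∧ (∀ k, f (y k) = f (x (σ k))) ∧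
      ∀ k, y k - x (σ k) ∈ Submodule.span K ((x ∘ σ) '' Set.Iio k) ∧
      ∀ v ∈ Submodule.span K ((x ∘ σ) '' Set.Iio k), g (y k) ≤ g (x (σ k) + v) := by
  induction n with
  | zero => exact ⟨id, x, Function.injective_id, hfx, fun c i => i.elim0, fun i => i.elim0,
      fun i => i.elim0, fun i => i.elim0⟩
  | succ n ih =>
    -- At an index of maximal ratio g/f, the norm `g` is at most that ratio times `f` on the whole
    -- span. A functional that is optimal for `g` at `x i` is then optimal for `f` too, so `x i`
    -- splits off orthogonally for both norms.
    obtain ⟨i, -, hi⟩ := Finset.exists_max_image (Finset.univ : Finset (Fin (n + 1)))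
      (fun i => g (x i) / f (x i)) Finset.univ_nonempty
    have hi' : ∀ j, g (x j) ≤ g (x i) / f (x i) * f (x j) := fun j => by
      rw [← div_le_iff₀ (hf.pos (hx j))]
      exact hi j (Finset.mem_univ j)
    have hfi := hf.pos (hx i)
    have hgi := hg.pos (hx i)
    obtain ⟨φ, hφ, hφ0⟩ := he.exists_dual hg (x i)
    have hφ1 : φ (x i) = 1 := by
      have : (φ (x i) - 1) • x i = 0 := by rw [sub_smul, hφ0, one_smul, sub_self]
      simpa [hx i, sub_eq_zero] using this
    have hφf : ∀ y ∈ Submodule.span K (Set.range x), ‖φ y‖ * f (x i) ≤ f y := by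
      intro y hy
      obtain ⟨c, rfl⟩ := (Submodule.mem_span_range_iff_exists_fun K).1 hy
      set y := ∑ j, c j • x j with hy
      have h1 : g y ≤ g (x i) / f (x i) * f y := by
        refine hg.sum_le _ _ (mul_nonneg (by positivity) (hf.nonneg _)) fun j _ => ?_
        rw [hg.smul]
        calc ‖c j‖ * g (x j) ≤ ‖c j‖ * (g (x i) / f (x i) * f (x j)) :=
              mul_le_mul_of_nonneg_left (hi' j) (norm_nonneg _)
          _ = g (x i) / f (x i) * (‖c j‖ * f (x j)) := by ring
          _ ≤ _ := mul_le_mul_of_nonneg_left (hfx c j) (by positivity)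
      have h2 := (hφ y).trans h1
      rw [div_mul_eq_mul_div, le_div_iff₀ hfi] at h2
      nlinarith
    set P : V →ₗ[K] V := LinearMap.id - φ.smulRight (x i) with hP
    have hPv : ∀ v, P v = v - φ v • x i := fun v => by simp [hP]
    have hP0 : P (x i) = 0 := by rw [hPv, hφ0, sub_self]
    have hφP : ∀ v, φ (P v) = 0 := fun v => by simp [hPv, hφ1]
    have hgP : ∀ v, g (P v) ≤ g v := fun v => by
      rw [hPv]
      exact (hg.sub_le _ _).trans (max_le le_rfl (by rw [hg.smul]; exact hφ v))
    have hfP : ∀ v ∈ Submodule.span K (Set.range x), f (P v) ≤ f v := fun v hv => by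
      rw [hPv]
      exact (hf.sub_le _ _).trans (max_le le_rfl (by rw [hf.smul]; exact hφf v hv))
    set z : Fin n → V := fun j => P (x (i.succAbove j)) with hz
    have hlow : ∀ (c : Fin n → K) j, ‖c j‖ * f (x (i.succAbove j)) ≤ f (∑ j, c j • z j) := by
      intro c j
      -- Projecting along `x i` only alters the coefficient of `x i`, which the `f`-orthogonality of
      -- `x` lets one ignore.
      have h1 : ∑ j, c j • z j = ∑ j, (i.insertNth (-φ (∑ j, c j • x (i.succAbove j))) c :
          Fin (n + 1) → K) j • x j := by
        rw [Fin.sum_univ_succAbove _ i]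
        simp only [Fin.insertNth_apply_same, Fin.insertNth_apply_succAbove, hz]
        simp only [← map_smul, ← map_sum]
        rw [hPv, neg_smul]
        abel
      rw [h1]
      simpa using hfx (i.insertNth (-φ (∑ j, c j • x (i.succAbove j))) c) (i.succAbove j)
    have hfz : ∀ j, f (z j) = f (x (i.succAbove j)) := by
      intro j
      refine le_antisymm (hfP _ (Submodule.subset_span ⟨_, rfl⟩)) ?_
      have := hlow (Pi.single j 1) j
      simpa [Pi.single_apply, ite_smul] using this
    have hfzo : IsOrth K f z := fun c j => by rw [hfz]; exact hlow c j
    have hz0 : ∀ j, z j ≠ 0 := fun j h => by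
      have := hfz j
      rw [h, hf.zero] at this
      exact (hf.pos (hx _)).ne this
    obtain ⟨σ, y, hσ, hfy, hgy, hyspan, hfyx, hyx⟩ := ih z hz0 hfzo
    have hzx : Submodule.span K (Set.range z) ≤ Submodule.span K (Set.range x) := by
      rw [Submodule.span_le]
      rintro _ ⟨j, rfl⟩
      simp only [hz, hPv]
      exact Submodule.sub_mem _ (Submodule.subset_span ⟨_, rfl⟩)
        (Submodule.smul_mem _ _ (Submodule.subset_span ⟨_, rfl⟩))
    have hφy : ∀ k, φ (y k) = 0 := fun k => by
      have : Submodule.span K (Set.range z) ≤ LinearMap.ker φ := by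
        rw [Submodule.span_le]
        rintro _ ⟨j, rfl⟩
        exact hφP _
      exact this (hyspan k)
    set τ : Fin (n + 1) → Fin (n + 1) := Fin.cons i (i.succAbove ∘ σ) with hτ
    have hτs : ∀ j : Fin n, (x ∘ τ) j.succ = x (i.succAbove (σ j)) := fun j => by simp [hτ]
    have hτ0 : (x ∘ τ) 0 = x i := by simp [hτ]
    have hzσ : ∀ j, (z ∘ σ) j = (x ∘ τ) j.succ - φ ((x ∘ τ) j.succ) • (x ∘ τ) 0 := fun j => by
      rw [hτs, hτ0, ← hPv]
      rfl
    refine ⟨τ, Fin.cons (x i) y, ?_, ?_, ?_, ?_, ?_, ?_⟩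
    · rw [hτ, Fin.cons_injective_iff]
      exact ⟨by simp [Fin.succAbove_ne], Fin.succAbove_right_injective.comp hσ⟩
    · -- orthogonality for `f` only has to be tested on the span of `x`
      intro c k
      rw [Fin.sum_univ_succ]
      simp only [Fin.cons_zero, Fin.cons_succ]
      set h := ∑ j : Fin n, c j.succ • y j with hh
      have hspan : h ∈ Submodule.span K (Set.range x) :=
        Submodule.sum_mem _ fun j _ => Submodule.smul_mem _ _ (hzx (hyspan j))
      have h0 : ‖c 0‖ * f (x i) ≤ f (c 0 • x i + h) := by
        have h1 : φ (c 0 • x i + h) = c 0 := by simp [hh, hφy, hφ1]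
        have := hφf (c 0 • x i + h) (Submodule.add_mem _
          (Submodule.smul_mem _ _ (Submodule.subset_span ⟨_, rfl⟩)) hspan)
        rwa [h1] at this
      induction k using Fin.cases with
      | zero => simpa using h0
      | succ k =>
        have h1 : ‖c k.succ‖ * f (y k) ≤ f h := hfy (fun j => c j.succ) k
        have h2 : f h ≤ max (f (c 0 • x i + h)) (f (c 0 • x i)) := by
          have := hf.sub_le (c 0 • x i + h) (c 0 • x i)
          rwa [add_sub_cancel_left] at this
        rw [hf.smul] at h2
        simpa using h1.trans (h2.trans (max_le le_rfl h0))
    · refine IsOrth.cons hg (φ := φ) (fun c y h => ?_) hgy hφy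
      have := hφ (c • x i + y)
      simpa [h, hφ1] using this
    · intro k
      induction k using Fin.cases with
      | zero => exact Submodule.subset_span ⟨i, rfl⟩
      | succ k => exact hzx (hyspan k)
    · intro k
      induction k using Fin.cases with
      | zero => simp [hτ]
      | succ k => simp [hτ, hfyx, hfz]
    · intro k
      induction k using Fin.cases with
      | zero =>
        refine ⟨by simp [hτ], fun v hv => ?_⟩
        have : (x ∘ τ) '' Set.Iio 0 = ∅ := by
          simp
        rw [this, Submodule.span_empty, Submodule.mem_bot] at hv
        simp [hv, hτ]
      | succ k =>
        refine ⟨sub_mem_span_image_Iio_succ φ hzσ k (hyx k).1, fun v hv => ?_⟩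
        have h1 := map_span_image_Iio_succ P (by rw [hτ0, hP0]) k hv
        have h2 := (hyx k).2 (P v) h1
        have h3 : z (σ k) = P ((x ∘ τ) k.succ) := by rw [hτs]
        rw [h3, ← map_add] at h2
        exact h2.trans (hgP _)

end Norms

/-! ## Gram-Schmidt vectors and majorization -/

theorem integral_max_sub_zero {A x : ℝ} (h₁ : -A ≤ x) (h₂ : x ≤ A) :
    ∫ c in (-A)..A, max (x - c) 0 = (x + A) ^ 2 / 2 := by
  have hcont : Continuous fun c : ℝ => max (x - c) 0 := by fun_prop
  rw [← intervalIntegral.integral_add_adjacent_intervals (b := x)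
    (hcont.intervalIntegrable _ _) (hcont.intervalIntegrable _ _)]
  have e1 : ∫ c in (-A)..x, max (x - c) 0 = ∫ c in (-A)..x, (x - c) := by
    refine intervalIntegral.integral_congr fun c hc => ?_
    rw [Set.uIcc_of_le h₁] at hc
    exact max_eq_left (by linarith [hc.2])
  have e2 : ∫ c in x..A, max (x - c) 0 = ∫ c in x..A, (0 : ℝ) := by
    refine intervalIntegral.integral_congr fun c hc => ?_
    rw [Set.uIcc_of_le h₂] at hc
    exact max_eq_right (by linarith [hc.1])
  rw [e1, e2, intervalIntegral.integral_sub (by simp) (by simp)]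
  simp
  ring

/-- Up to affine terms a square is an integral of the hinge functions t ↦ max (t - c) 0. Integrating
the hypothesis over [-A, A], with `A` bounding all entries, gives the claim, since the linear terms
agree by `hs`. -/
theorem sum_sq_le_of_majorized {ι : Type*} [Fintype ι] {y l : ι → ℝ} (hs : ∑ i, y i = ∑ i, l i)
    (h : ∀ c, ∑ i, max (y i - c) 0 ≤ ∑ i, max (l i - c) 0) :
    ∑ i, y i ^ 2 ≤ ∑ i, l i ^ 2 := by
  set A : ℝ := ∑ i, |y i| + ∑ i, |l i| with hA
  have hA0 : 0 ≤ A := by positivity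
  have hy : ∀ i, |y i| ≤ A := fun i => by
    have := Finset.single_le_sum (f := fun i => |y i|) (fun i _ => abs_nonneg _)
      (Finset.mem_univ i)
    have h2 : 0 ≤ ∑ i, |l i| := by positivity
    linarith
  have hl : ∀ i, |l i| ≤ A := fun i => by
    have := Finset.single_le_sum (f := fun i => |l i|) (fun i _ => abs_nonneg _)
      (Finset.mem_univ i)
    have h2 : 0 ≤ ∑ i, |y i| := by positivity
    linarith
  have key : ∀ z : ι → ℝ, (∀ i, |z i| ≤ A) →
      ∫ c in (-A)..A, ∑ i, max (z i - c) 0 = ∑ i, (z i + A) ^ 2 / 2 := by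
    intro z hz
    rw [intervalIntegral.integral_finsetSum]
    · exact Finset.sum_congr rfl fun i _ =>
        integral_max_sub_zero (abs_le.1 (hz i)).1 (abs_le.1 (hz i)).2
    · intro i _
      exact Continuous.intervalIntegrable (by fun_prop) _ _
  have hmono : ∫ c in (-A)..A, ∑ i, max (y i - c) 0 ≤ ∫ c in (-A)..A, ∑ i, max (l i - c) 0 :=
    intervalIntegral.integral_mono_on (by linarith)
      (Continuous.intervalIntegrable (by fun_prop) _ _)
      (Continuous.intervalIntegrable (by fun_prop) _ _) fun c _ => h c
  rw [key y hy, key l hl] at hmono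
  have expand : ∀ z : ι → ℝ, ∑ i, (z i + A) ^ 2 / 2 =
      (∑ i, z i ^ 2) / 2 + A * ∑ i, z i + Fintype.card ι * (A ^ 2 / 2) := by
    intro z
    rw [Finset.sum_div, Finset.mul_sum, ← nsmul_eq_mul, ← Finset.card_univ, ← Finset.sum_const,
      ← Finset.sum_add_distrib, ← Finset.sum_add_distrib]
    exact Finset.sum_congr rfl fun i _ => by ring
  rw [expand, expand, hs] at hmono
  linarith

section Norms

variable {K : Type*} [NontriviallyNormedField K] {V : Type*} [AddCommGroup V] [Module K V]

/-- The Gram-Schmidt values: `gs K f x k` is the distance of `x k` from the span of the `x j`,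
`j < k`. -/
def gs (K : Type*) [NontriviallyNormedField K] {V : Type*} [AddCommGroup V] [Module K V]
    (f : V → ℝ) {n : ℕ} (x : Fin n → V) (k : Fin n) : ℝ :=
  sInf ((fun v => f (x k + v)) '' (Submodule.span K (x '' Set.Iio k) : Set V))

variable {f g : V → ℝ} {n : ℕ} {ι : Type*} [Fintype ι]

theorem gs_eq_of_forall_le {x y : Fin n → V} {k : Fin n}
    (h₁ : y k - x k ∈ Submodule.span K (x '' Set.Iio k))
    (h₂ : ∀ v ∈ Submodule.span K (x '' Set.Iio k), f (y k) ≤ f (x k + v)) :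
    gs K f x k = f (y k) := by
  refine IsLeast.csInf_eq ⟨⟨y k - x k, h₁, by simp⟩, ?_⟩
  rintro _ ⟨v, hv, rfl⟩
  exact h₂ v hv

theorem gs_le (hf : IsUltraNorm K f) {x : Fin n → V} {k : Fin n} {v : V}
    (hv : v ∈ Submodule.span K (x '' Set.Iio k)) : gs K f x k ≤ f (x k + v) :=
  csInf_le ⟨0, by rintro _ ⟨v, -, rfl⟩; exact hf.nonneg _⟩ ⟨v, hv, rfl⟩

theorem gs_mono (hf : IsUltraNorm K f) (h : ∀ v, f v ≤ g v) (x : Fin n → V) (k : Fin n) :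
    gs K f x k ≤ gs K g x k := by
  refine le_csInf ⟨_, 0, Submodule.zero_mem _, rfl⟩ ?_
  rintro _ ⟨v, hv, rfl⟩
  exact (gs_le hf hv).trans (h _)

theorem gs_const_mul (r : ℝ) (hr : 0 ≤ r) (x : Fin n → V) (k : Fin n) :
    gs K (fun v => r * f v) x k = r * gs K f x k := by
  unfold gs
  rw [← smul_eq_mul r (sInf _), ← Real.sInf_smul_of_nonneg hr]
  congr 1
  ext t
  simp [Set.mem_smul_set]

theorem gs_of_isOrth {x : Fin n → V} (h : IsOrth K f x) (k : Fin n) :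
    gs K f x k = f (x k) := by
  refine gs_eq_of_forall_le (y := x) (by simp) fun v hv => ?_
  obtain ⟨l, hl, rfl⟩ := (Finsupp.mem_span_image_iff_linearCombination K).1 hv
  have hlk : l k = 0 := by
    by_contra hne
    have := hl (Finsupp.mem_support_iff.2 hne)
    simp at this
  have h1 : x k + Finsupp.linearCombination K x l =
      ∑ j, (Pi.single k 1 + ⇑l : Fin n → K) j • x j := by
    rw [Finsupp.linearCombination_apply, Finsupp.sum_fintype _ _ (by simp)]
    simp [add_smul, Finset.sum_add_distrib, Pi.single_apply, ite_smul]
  rw [h1]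
  have h2 := h (Pi.single k 1 + ⇑l : Fin n → K) k
  rwa [Pi.add_apply, Pi.single_eq_same, hlk, add_zero, norm_one, one_mul] at h2

/-- The Gram-Schmidt values are attained by an orthogonal basis that is unitriangular over `b`,
hence of determinant 1. -/
theorem exists_basis_gs (hf : IsUltraNorm K f) {e : Basis ι K V} (he : IsOrth K f e)
    (b : Basis (Fin n) K V) : ∃ y : Basis (Fin n) K V, IsOrth K f y ∧
      (∀ k, gs K f b k = f (y k)) ∧ ∀ k, y k - b k ∈ Submodule.span K (b '' Set.Iio k) := by
  obtain ⟨y, hy, hyb⟩ := he.exists_orthogonalization hf b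
  have hy0 : ∀ k, y k ≠ 0 := by
    intro k h
    have h1 := (hyb k).1
    rw [h, zero_sub, Submodule.neg_mem_iff] at h1
    exact b.linearIndependent.notMem_span_image (by simp) h1
  have hli := hy.linearIndependent hf hy0
  have hcard : Fintype.card (Fin n) = finrank K V := (finrank_eq_card_basis b).symm
  have : FiniteDimensional K V := b.finiteDimensional_of_finite
  rcases Nat.eq_zero_or_pos n with rfl | hn
  · exact ⟨b, fun c i => i.elim0, fun i => i.elim0, fun i => i.elim0⟩
  have : Nonempty (Fin n) := ⟨⟨0, hn⟩⟩
  refine ⟨basisOfLinearIndependentOfCardEqFinrank hli hcard, ?_, ?_, ?_⟩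
  · rwa [coe_basisOfLinearIndependentOfCardEqFinrank]
  · intro k
    rw [coe_basisOfLinearIndependentOfCardEqFinrank]
    exact gs_eq_of_forall_le (hyb k).1 (hyb k).2
  · intro k
    rw [coe_basisOfLinearIndependentOfCardEqFinrank]
    exact (hyb k).1

theorem det_eq_one_of_unitriangular (b y : Basis (Fin n) K V)
    (h : ∀ k, y k - b k ∈ Submodule.span K (b '' Set.Iio k)) : b.det y = 1 := by
  have hrepr : ∀ i k, k ≤ i → b.repr (y k - b k) i = 0 := by
    intro i k hik
    have h1 := (Basis.mem_span_image b).1 (h k)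
    by_contra h2
    have := h1 (Finsupp.mem_support_iff.2 h2)
    exact absurd hik (not_le.2 (by simpa using this))
  rw [Basis.det_apply, Matrix.det_of_isUpperTriangular]
  · refine Finset.prod_eq_one fun i _ => ?_
    have := hrepr i i le_rfl
    rw [map_sub, Finsupp.sub_apply, sub_eq_zero] at this
    simp [Basis.toMatrix_apply, this]
  · intro i k hik
    have := hrepr i k (le_of_lt hik)
    rw [map_sub, Finsupp.sub_apply, sub_eq_zero] at this
    have hik' : k < i := hik
    simp [Basis.toMatrix_apply, this, hik'.ne]

/-- Hadamard's inequality: each term of the Leibniz formula satisfies the bound, hence so does the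
sum by the ultrametric inequality. -/
theorem norm_det_mul_prod_le [IsUltrametricDist K] [DecidableEq ι] (hf : IsUltraNorm K f)
    (e b : Basis ι K V) (he : IsOrth K f e) :
    ‖e.det b‖ * ∏ i, f (e i) ≤ ∏ i, f (b i) := by
  have hpos : 0 < ∏ i, f (e i) := Finset.prod_pos fun i _ => hf.pos (e.ne_zero i)
  rw [← le_div_iff₀ hpos, Basis.det_apply, Matrix.det_apply]
  refine IsUltrametricDist.norm_sum_le_of_forall_le_of_nonneg
    (div_nonneg (Finset.prod_nonneg fun i _ => hf.nonneg _) hpos.le) fun σ _ => ?_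
  have h1 : ‖Equiv.Perm.sign σ • ∏ i, e.toMatrix b (σ i) i‖ = ∏ i, ‖e.repr (b i) (σ i)‖ := by
    rcases Int.units_eq_one_or (Equiv.Perm.sign σ) with h | h <;>
      simp [h, Basis.toMatrix_apply]
  rw [h1, le_div_iff₀ hpos, ← Equiv.prod_comp σ (fun i => f (e i)), ← Finset.prod_mul_distrib]
  exact Finset.prod_le_prod (fun i _ => mul_nonneg (norm_nonneg _) (hf.nonneg _))
    fun i _ => he.le_repr _ _

/-- Hadamard's inequality in both directions becomes an equality when both bases are orthogonal: the
product of the values is a volume. -/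
theorem sum_log_eq [IsUltrametricDist K] [DecidableEq ι] (hf : IsUltraNorm K f)
    (e b : Basis ι K V) (he : IsOrth K f e) (hb : IsOrth K f b) :
    ∑ i, Real.log (f (b i)) = ∑ i, Real.log (f (e i)) + Real.log ‖e.det b‖ := by
  have hpe : 0 < ∏ i, f (e i) := Finset.prod_pos fun i _ => hf.pos (e.ne_zero i)
  have hpb : 0 < ∏ i, f (b i) := Finset.prod_pos fun i _ => hf.pos (b.ne_zero i)
  have hdet : e.det b * b.det e = 1 := by
    rw [Basis.det_apply, Basis.det_apply, ← Matrix.det_mul, Basis.toMatrix_mul_toMatrix,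
      Basis.toMatrix_self, Matrix.det_one]
  have hn : ‖e.det b‖ * ‖b.det e‖ = 1 := by rw [← norm_mul, hdet, norm_one]
  have hd : ‖e.det b‖ ≠ 0 := left_ne_zero_of_mul_eq_one hn
  have h1 := norm_det_mul_prod_le hf e b he
  have h2 := norm_det_mul_prod_le hf b e hb
  have h3 : ‖e.det b‖ * ∏ i, f (e i) = ∏ i, f (b i) := by
    refine le_antisymm h1 ?_
    have := mul_le_mul_of_nonneg_left h2 (norm_nonneg (e.det b))
    rwa [← mul_assoc, hn, one_mul] at this
  rw [← Real.log_prod fun i _ => (hf.pos (b.ne_zero i)).ne',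
    ← Real.log_prod fun i _ => (hf.pos (e.ne_zero i)).ne', ← h3,
    Real.log_mul hd hpe.ne', add_comm]

theorem gs_pos (hf : IsUltraNorm K f) {e : Basis ι K V} (he : IsOrth K f e)
    (b : Basis (Fin n) K V) (k : Fin n) : 0 < gs K f b k := by
  obtain ⟨y, -, h, -⟩ := exists_basis_gs hf he b
  rw [h]
  exact hf.pos (y.ne_zero k)

theorem sum_log_gs [IsUltrametricDist K] (hf : IsUltraNorm K f) (e b : Basis (Fin n) K V)
    (he : IsOrth K f e) :
    ∑ k, Real.log (gs K f b k) = ∑ i, Real.log (f (e i)) + Real.log ‖e.det b‖ := by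
  obtain ⟨y, hy, hgs, hyb⟩ := exists_basis_gs hf he b
  have hdet : e.det y = e.det b := by
    have : e.det y = e.det b * b.det y := by
      rw [Basis.det_apply, Basis.det_apply, Basis.det_apply, ← Matrix.det_mul,
        Basis.toMatrix_mul_toMatrix]
    rw [this, det_eq_one_of_unitriangular b y hyb, mul_one]
  simp_rw [hgs]
  rw [sum_log_eq hf e y he hy, hdet]

/-- A relative volume of two norms: the determinant terms cancel, so the basis used to compute it is
irrelevant. -/
theorem sum_log_gs_sub [IsUltrametricDist K] (hf : IsUltraNorm K f) (hg : IsUltraNorm K g)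
    (e b : Basis (Fin n) K V) (hfe : IsOrth K f e) (hge : IsOrth K g e) :
    ∑ k, (Real.log (gs K f b k) - Real.log (gs K g b k)) =
      ∑ k, (Real.log (f (e k)) - Real.log (g (e k))) := by
  rw [Finset.sum_sub_distrib, Finset.sum_sub_distrib, sum_log_gs hf e b hfe,
    sum_log_gs hg e b hge]
  ring

/-- The Gram-Schmidt vector is majorized by the relative position. -/
theorem sum_sq_log_gs_sub_le [IsUltrametricDist K] (hf : IsUltraNorm K f) (hg : IsUltraNorm K g)
    (e b : Basis (Fin n) K V) (hfe : IsOrth K f e) (hge : IsOrth K g e) :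
    ∑ k, (Real.log (gs K f b k) - Real.log (gs K g b k)) ^ 2 ≤
      ∑ k, (Real.log (f (e k)) - Real.log (g (e k))) ^ 2 := by
  refine sum_sq_le_of_majorized (sum_log_gs_sub hf hg e b hfe hge) fun c => ?_
  have hr : (0 : ℝ) < Real.exp c := Real.exp_pos c
  have hg' := hg.const_mul hr
  have hge' := hge.const_mul hr.le
  have hq := hf.sup hg'
  have hqe := hfe.sup hge'
  -- A hinge function of a log-ratio is the log-ratio of max(s, e^c t) to e^c t, so sums of hinges
  -- over `e` become relative volumes of norms.
  have key : ∀ s t : ℝ, 0 < s → 0 < t → max (Real.log s - Real.log t - c) 0 =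
      Real.log (max s (Real.exp c * t)) - Real.log (Real.exp c * t) := by
    intro s t hs ht
    have h1 : Real.log (Real.exp c * t) = c + Real.log t := by
      rw [Real.log_mul hr.ne' ht.ne', Real.log_exp]
    rcases le_total s (Real.exp c * t) with h | h
    · have h2 : Real.log s ≤ c + Real.log t := h1 ▸ Real.log_le_log hs h
      rw [max_eq_right h, sub_self, max_eq_right (by linarith)]
    · have h2 : c + Real.log t ≤ Real.log s := h1 ▸ Real.log_le_log (by positivity) h
      rw [max_eq_left h, h1, max_eq_left (by linarith)]
      ring
  -- Gram-Schmidt values of the norm max(f, e^c g) dominate the maximum of those of the two norms.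
  -- On the common orthogonal basis `e` there is equality, and the total is the same relative
  -- volume.
  have h1 : ∀ k, max (Real.log (gs K f b k) - Real.log (gs K g b k) - c) 0 ≤
      Real.log (gs K (fun x => max (f x) (Real.exp c * g x)) b k) -
        Real.log (gs K (fun x => Real.exp c * g x) b k) := by
    intro k
    have hp1 := gs_pos hf hfe b k
    have hp2 := gs_pos hg hge b k
    rw [key _ _ hp1 hp2, ← gs_const_mul _ hr.le]
    refine sub_le_sub_right (Real.log_le_log (lt_max_of_lt_left hp1) (max_le ?_ ?_)) _
    · exact gs_mono hf (fun v => le_max_left _ _) b k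
    · exact gs_mono hg' (fun v => le_max_right _ _) b k
  refine (Finset.sum_le_sum fun k _ => h1 k).trans (le_of_eq ?_)
  rw [sum_log_gs_sub hq hg' e b hqe hge']
  exact Finset.sum_congr rfl fun k _ =>
    (key _ _ (hf.pos (e.ne_zero k)) (hg.pos (e.ne_zero k))).symm

end Norms

/-! ## The Weyl-invariant seminorm -/

namespace WeylScalarProduct

variable {n : ℕ} (B : WeylScalarProduct n)

/-- The length of a vector for the scalar product `B`. -/
def len (w : Fin n → ℝ) : ℝ := √(B.form w w)

theorem len_sq (w : Fin n → ℝ) : B.len w ^ 2 = B.form w w := Real.sq_sqrt (B.nonneg' w)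

theorem len_nonneg (w : Fin n → ℝ) : 0 ≤ B.len w := Real.sqrt_nonneg _

theorem len_eq_zero_iff (w : Fin n → ℝ) : B.len w = 0 ↔ ∃ c : ℝ, w = fun _ => c := by
  rw [len, Real.sqrt_eq_zero (B.nonneg' w), B.eq_zero_iff']

theorem len_const (c : ℝ) : B.len (fun _ => c) = 0 := (B.len_eq_zero_iff _).2 ⟨c, rfl⟩

theorem len_neg (w : Fin n → ℝ) : B.len (-w) = B.len w := by simp [len]

theorem len_sub_comm (u v : Fin n → ℝ) : B.len (u - v) = B.len (v - u) := by
  rw [← len_neg, neg_sub]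

theorem len_smul (c : ℝ) (w : Fin n → ℝ) : B.len (c • w) = |c| * B.len w := by
  have : B.form (c • w) (c • w) = c ^ 2 * B.form w w := by simp; ring
  rw [len, this, Real.sqrt_mul (sq_nonneg c), Real.sqrt_sq_eq_abs, len]

theorem form_single_single (i j k l : Fin n) (hij : i ≠ j) (hkl : k ≠ l) :
    B.form (Pi.single i 1) (Pi.single j 1) = B.form (Pi.single k 1) (Pi.single l 1) := by
  have hs : ∀ (i k : Fin n) (j : Fin n), j ≠ i → j ≠ k →
      B.form (Pi.single i 1) (Pi.single j 1) = B.form (Pi.single k 1) (Pi.single j 1) := by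
    intro i k j hi hk
    have h := B.invariant' (Equiv.swap i k) (Pi.single i 1) (Pi.single j 1)
    have h1 : (Pi.single i (1 : ℝ) : Fin n → ℝ) ∘ Equiv.swap i k = Pi.single k 1 := by
      ext t
      simp [Pi.single_apply, Equiv.swap_apply_eq_iff]
    have h2 : (Pi.single j (1 : ℝ) : Fin n → ℝ) ∘ Equiv.swap i k = Pi.single j 1 := by
      ext t
      simp [Pi.single_apply, Equiv.swap_apply_eq_iff, Equiv.swap_apply_of_ne_of_ne hi hk]
    rw [h1, h2] at h
    exact h.symm
  by_cases hkj : k = j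
  · subst hkj
    rw [hs i l k hij.symm hkl, B.symm']
  · rw [hs i k j hij.symm (Ne.symm hkj), B.symm', hs j l k hkj hkl, B.symm']

theorem form_single_self (i k : Fin n) :
    B.form (Pi.single i 1) (Pi.single i 1) = B.form (Pi.single k 1) (Pi.single k 1) := by
  have h := B.invariant' (Equiv.swap i k) (Pi.single i 1) (Pi.single i 1)
  have h1 : (Pi.single i (1 : ℝ) : Fin n → ℝ) ∘ Equiv.swap i k = Pi.single k 1 := by
    ext t
    simp [Pi.single_apply, Equiv.swap_apply_eq_iff]
  rw [h1] at h
  exact h.symm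

/-- Invariance leaves one diagonal entry `a` and one off-diagonal entry `b` in the Gram matrix, and
vanishing on constants determines `b` by `a`. The form is a multiple of the variance. -/
theorem exists_form_eq (hn : 2 ≤ n) :
    ∃ α > 0, ∀ w : Fin n → ℝ, B.form w w = α * (∑ i, w i ^ 2 - (∑ i, w i) ^ 2 / n) := by
  set i₀ : Fin n := ⟨0, by omega⟩
  set i₁ : Fin n := ⟨1, by omega⟩
  have h01 : i₀ ≠ i₁ := by simp [i₀, i₁, Fin.ext_iff]
  set a := B.form (Pi.single i₀ 1) (Pi.single i₀ 1) with ha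
  set b := B.form (Pi.single i₀ 1) (Pi.single i₁ 1) with hb
  have hent : ∀ i j, B.form (Pi.single i 1) (Pi.single j 1) = b + if i = j then a - b else 0 := by
    intro i j
    split_ifs with h
    · rw [h, B.form_single_self j i₀]
      ring
    · rw [B.form_single_single i j i₀ i₁ h h01, add_zero]
  have hform : ∀ w : Fin n → ℝ, B.form w w = b * (∑ i, w i) ^ 2 + (a - b) * ∑ i, w i ^ 2 := by
    intro w
    have hw : w = ∑ i, w i • (Pi.single i 1 : Fin n → ℝ) := by
      ext t
      simp [Finset.sum_apply, Pi.single_apply]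
    conv_lhs => rw [hw]
    simp only [map_sum, map_smul, LinearMap.sum_apply, LinearMap.smul_apply, hent, smul_eq_mul]
    simp only [mul_add, Finset.sum_add_distrib, mul_ite, mul_zero]
    rw [sq, Finset.sum_mul_sum, Finset.mul_sum, Finset.mul_sum]
    congr 1
    · refine Finset.sum_congr rfl fun i _ => ?_
      rw [Finset.mul_sum, Finset.mul_sum]
      refine Finset.sum_congr rfl fun j _ => ?_
      ring
    · simp only [Finset.sum_ite_eq', Finset.mem_univ, if_true]
      refine Finset.sum_congr rfl fun i _ => ?_
      ring
  have hn0 : (0 : ℝ) < n := by exact_mod_cast (by omega : 0 < n)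
  have h1 : B.form (fun _ => 1) (fun _ => 1) = 0 := (B.eq_zero_iff' _).2 ⟨1, rfl⟩
  rw [hform] at h1
  simp only [Finset.sum_const, Finset.card_univ, Fintype.card_fin, nsmul_eq_mul, mul_one,
    one_pow] at h1
  have h2 : b = -(a - b) / n := by
    field_simp
    have : (n : ℝ) * (b * n + (a - b)) = 0 := by rw [← h1]; ring
    rcases mul_eq_zero.1 this with h | h
    · exact absurd h hn0.ne'
    · linarith
  have ha0 : 0 < a := by
    refine lt_of_le_of_ne (B.nonneg' _) fun h => ?_
    obtain ⟨c, hc⟩ := (B.eq_zero_iff' _).1 h.symm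
    have e0 := congrFun hc i₀
    have e1 := congrFun hc i₁
    rw [Pi.single_eq_same] at e0
    rw [Pi.single_eq_of_ne h01.symm] at e1
    linarith
  have hn1 : (2 : ℝ) ≤ n := by exact_mod_cast hn
  refine ⟨a - b, ?_, fun w => ?_⟩
  · by_contra hneg
    have hb0 : 0 ≤ b := by
      rw [h2]
      exact div_nonneg (by linarith) hn0.le
    have : b * n ^ 2 + (a - b) * n = n * (b * (n - 1) + a) := by ring
    rw [this] at h1
    have : 0 < n * (b * (n - 1) + a) :=
      mul_pos hn0 (add_pos_of_nonneg_of_pos (mul_nonneg hb0 (by linarith)) ha0)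
    exact this.ne' h1
  · have h3 : B.form w w = b * (∑ i, w i) ^ 2 + (a - b) * ∑ i, w i ^ 2 := hform w
    generalize a - b = d at h2 h3
    rw [h3, h2]
    ring

theorem len_le_len (hn : 2 ≤ n) {u v : Fin n → ℝ} (h : ∑ i, u i = ∑ i, v i)
    (h' : ∑ i, u i ^ 2 ≤ ∑ i, v i ^ 2) : B.len u ≤ B.len v := by
  obtain ⟨α, hα, hB⟩ := B.exists_form_eq hn
  refine Real.sqrt_le_sqrt ?_
  rw [hB, hB, h]
  exact mul_le_mul_of_nonneg_left (by linarith) hα.le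

/-- The length is induced from a Euclidean norm. -/
theorem exists_linearMap (hn : 2 ≤ n) :
    ∃ T : (Fin n → ℝ) →ₗ[ℝ] EuclideanSpace ℝ (Fin n), ∀ w, B.len w = ‖T w‖ := by
  obtain ⟨α, hα, hB⟩ := B.exists_form_eq hn
  have hn0 : (0 : ℝ) < n := by exact_mod_cast (by omega : 0 < n)
  let m : (Fin n → ℝ) →ₗ[ℝ] ℝ := (n : ℝ)⁻¹ • ∑ i, LinearMap.proj i
  have hm : ∀ w, m w = (∑ i, w i) / n := fun w => by simp [m, div_eq_inv_mul]
  let T₀ : (Fin n → ℝ) →ₗ[ℝ] (Fin n → ℝ) :=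
    √α • (LinearMap.id - LinearMap.pi fun _ => m)
  have hT₀ : ∀ w i, T₀ w i = √α * (w i - (∑ i, w i) / n) := fun w i => by simp [T₀, hm]
  refine ⟨(WithLp.linearEquiv 2 ℝ (Fin n → ℝ)).symm.toLinearMap ∘ₗ T₀, fun w => ?_⟩
  have hT : ∀ i, ((WithLp.linearEquiv 2 ℝ (Fin n → ℝ)).symm.toLinearMap ∘ₗ T₀) w i =
    √α * (w i - (∑ i, w i) / n) := hT₀ w
  rw [len, EuclideanSpace.norm_eq, hB]
  congr 1
  simp only [hT, Real.norm_eq_abs, sq_abs, mul_pow, Real.sq_sqrt hα.le]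
  rw [← Finset.mul_sum]
  congr 1
  set S := ∑ i, w i with hS
  have : ∑ i, (w i - S / n) ^ 2 = ∑ i, w i ^ 2 - 2 * (S / n) * S + n * (S / n) ^ 2 := by
    conv_rhs => rw [hS, Finset.mul_sum, ← hS]
    rw [← Finset.sum_sub_distrib]
    have h3 : (n : ℝ) * (S / n) ^ 2 = ∑ _i : Fin n, (S / n) ^ 2 := by simp
    rw [h3, ← Finset.sum_add_distrib]
    exact Finset.sum_congr rfl fun i _ => by ring
  rw [this]
  field_simp
  ring

theorem len_add_le (hn : 2 ≤ n) (u v : Fin n → ℝ) : B.len (u + v) ≤ B.len u + B.len v := by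
  obtain ⟨T, hT⟩ := B.exists_linearMap hn
  rw [hT, hT, hT, map_add]
  exact norm_add_le _ _

theorem len_add_const (w : Fin n → ℝ) (c : ℝ) : B.len (w + fun _ => c) = B.len w := by
  -- Isotropic vectors of a semidefinite form lie in its radical: otherwise the `t` chosen below
  -- makes the quadratic form equal to -1.
  have h0 : ∀ x y, B.form x x = 0 → B.form x y = 0 := by
    intro x y hx
    have key : ∀ t : ℝ, 0 ≤ B.form y y + 2 * t * B.form x y := fun t => by
      have h := B.nonneg' (y + t • x)
      simp only [map_add, map_smul, LinearMap.add_apply, LinearMap.smul_apply, smul_eq_mul, hx,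
        B.symm' y x] at h
      linarith
    by_contra hne
    have h1 := key (-(B.form y y + 1) / (2 * B.form x y))
    have : 2 * (-(B.form y y + 1) / (2 * B.form x y)) * B.form x y = -(B.form y y + 1) := by
      field_simp
    rw [this] at h1
    linarith
  have h1 : B.form (fun _ => c) (fun _ => c) = 0 := (B.eq_zero_iff' _).2 ⟨c, rfl⟩
  have h2 := h0 _ w h1
  simp [len, h1, h2, B.symm' w]

theorem len_congr {u v : Fin n → ℝ} {c : ℝ} (h : ∀ i, u i = v i + c) : B.len u = B.len v := by
  rw [← B.len_add_const v c]
  congr 1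
  exact funext h

theorem len_comp (σ : Equiv.Perm (Fin n)) (w : Fin n → ℝ) : B.len (w ∘ σ) = B.len w := by
  rw [len, len, B.invariant']

/-- Stewart's theorem. -/
theorem len_stewart (x u v : Fin n → ℝ) (s : ℝ) :
    B.len (x - ((1 - s) • u + s • v)) ^ 2 =
      (1 - s) * B.len (x - u) ^ 2 + s * B.len (x - v) ^ 2 - s * (1 - s) * B.len (u - v) ^ 2 := by
  simp only [len_sq, map_sub, map_add, map_smul, LinearMap.sub_apply, LinearMap.add_apply,
    LinearMap.smul_apply, smul_eq_mul, B.symm' u x, B.symm' v x, B.symm' v u]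
  ring

/-- Length is equivalent to oscillation because Σ (w i - w j)² is 2n/α times the squared length.
Adding the constants of the two estimates gives a single `C`. -/
theorem exists_spread_bounds (hn : 2 ≤ n) : ∃ C > 0, ∀ w : Fin n → ℝ,
    (∀ i j, w i - w j ≤ C * B.len w) ∧
      ∀ D, (∀ i j, w i - w j ≤ D) → B.len w ≤ C * D := by
  obtain ⟨α, hα, hB⟩ := B.exists_form_eq hn
  have hn0 : (0 : ℝ) < n := by exact_mod_cast (by omega : 0 < n)
  have hid : ∀ w : Fin n → ℝ, ∑ i, ∑ j, (w i - w j) ^ 2 = 2 * n / α * B.len w ^ 2 := by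
    intro w
    have h1 : ∀ i, ∑ j, (w i - w j) ^ 2 =
        n * w i ^ 2 - 2 * w i * ∑ j, w j + ∑ j, w j ^ 2 := fun i => by
      have : (n : ℝ) * w i ^ 2 = ∑ _j : Fin n, w i ^ 2 := by simp
      rw [this, Finset.mul_sum, ← Finset.sum_sub_distrib, ← Finset.sum_add_distrib]
      exact Finset.sum_congr rfl fun j _ => by ring
    simp_rw [h1]
    rw [Finset.sum_add_distrib, Finset.sum_sub_distrib, ← Finset.mul_sum, ← Finset.sum_mul,
      ← Finset.mul_sum, B.len_sq, hB]
    simp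
    field_simp
    ring
  refine ⟨√(2 * n / α) + √(α * n / 2), by positivity, fun w => ⟨fun i j => ?_, fun D hD => ?_⟩⟩
  · have h1 : (w i - w j) ^ 2 ≤ 2 * n / α * B.len w ^ 2 := by
      rw [← hid]
      exact (Finset.single_le_sum (f := fun j => (w i - w j) ^ 2) (fun _ _ => sq_nonneg _)
        (Finset.mem_univ j)).trans (Finset.single_le_sum (f := fun i => ∑ j, (w i - w j) ^ 2)
          (fun _ _ => Finset.sum_nonneg fun _ _ => sq_nonneg _) (Finset.mem_univ i))
    have h2 := Real.le_sqrt_of_sq_le h1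
    rw [Real.sqrt_mul (by positivity), Real.sqrt_sq (B.len_nonneg w)] at h2
    refine h2.trans (mul_le_mul_of_nonneg_right ?_ (B.len_nonneg w))
    linarith [Real.sqrt_nonneg (α * n / 2)]
  · have hD0 : 0 ≤ D := by simpa using hD ⟨0, by omega⟩ ⟨0, by omega⟩
    have h1 : ∑ i, ∑ j, (w i - w j) ^ 2 ≤ ∑ _i : Fin n, ∑ _j : Fin n, D ^ 2 := by
      refine Finset.sum_le_sum fun i _ => Finset.sum_le_sum fun j _ => ?_
      exact sq_le_sq' (by linarith [hD j i]) (hD i j)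
    rw [hid] at h1
    simp only [Finset.sum_const, Finset.card_univ, Fintype.card_fin, nsmul_eq_mul] at h1
    have h2 : B.len w ^ 2 ≤ α * n / 2 * D ^ 2 := by
      rw [div_mul_eq_mul_div, div_le_iff₀ hα] at h1
      have : (2 * n : ℝ) * B.len w ^ 2 ≤ 2 * n * (α * n / 2 * D ^ 2) := by linarith
      exact le_of_mul_le_mul_left this (by positivity)
    have h3 := Real.le_sqrt_of_sq_le h2
    rw [Real.sqrt_mul (by positivity), Real.sqrt_sq hD0] at h3
    refine h3.trans (mul_le_mul_of_nonneg_right ?_ hD0)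
    linarith [Real.sqrt_nonneg (2 * n / α)]

end WeylScalarProduct

/-! ## The building as a CAT(0) space -/

section Basic

variable {K : Type*} [NontriviallyNormedField K] [IsUltrametricDist K]
  {V : Type*} [AddCommGroup V] [Module K V]

theorem le_basisNorm (b : Basis (Fin (finrank K V)) K V) (u : Fin (finrank K V) → ℝ) (x : V)
    (i : Fin (finrank K V)) : ‖b.repr x i‖ * Real.exp (u i) ≤ basisNorm b u x :=
  le_ciSup (f := fun i => ‖b.repr x i‖ * Real.exp (u i)) (Set.finite_range _).bddAbove i

theorem basisNorm_le (b : Basis (Fin (finrank K V)) K V) (u : Fin (finrank K V) → ℝ) (x : V)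
    {C : ℝ} (hC : 0 ≤ C) (h : ∀ i, ‖b.repr x i‖ * Real.exp (u i) ≤ C) : basisNorm b u x ≤ C :=
  Real.iSup_le h hC

theorem basisNorm_nonneg (b : Basis (Fin (finrank K V)) K V) (u : Fin (finrank K V) → ℝ) (x : V) :
    0 ≤ basisNorm b u x :=
  Real.iSup_nonneg fun _ => by positivity

theorem basisNorm_self (b : Basis (Fin (finrank K V)) K V) (u : Fin (finrank K V) → ℝ)
    (i : Fin (finrank K V)) : basisNorm b u (b i) = Real.exp (u i) := by
  refine le_antisymm (basisNorm_le b u _ (Real.exp_pos _).le fun j => ?_) ?_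
  · by_cases h : i = j
    · subst h
      simp
    · simp [h, (Real.exp_pos _).le]
  · simpa using le_basisNorm b u (b i) i

theorem isUltraNorm_basisNorm (b : Basis (Fin (finrank K V)) K V)
    (u : Fin (finrank K V) → ℝ) : IsUltraNorm K (basisNorm b u) where
  add_le x y := by
    refine basisNorm_le b u _ (le_max_of_le_left (basisNorm_nonneg b u x)) fun i => ?_
    rw [map_add, Finsupp.add_apply]
    refine (mul_le_mul_of_nonneg_right (IsUltrametricDist.norm_add_le_max _ _)
      (Real.exp_pos _).le).trans ?_
    rw [max_mul_of_nonneg _ _ (Real.exp_pos _).le]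
    exact max_le_max (le_basisNorm b u x i) (le_basisNorm b u y i)
  smul c x := by
    simp only [basisNorm, map_smul, Finsupp.smul_apply, smul_eq_mul, norm_mul, mul_assoc]
    rw [Real.mul_iSup_of_nonneg (norm_nonneg c)]
  eq_zero x h := by
    rw [← b.repr.map_eq_zero_iff]
    ext i
    have h1 := le_basisNorm b u x i
    rw [h] at h1
    have h2 := Real.exp_pos (u i)
    have : ‖b.repr x i‖ ≤ 0 := by
      by_contra h3
      exact absurd (mul_pos (not_le.1 h3) h2) h1.not_gt
    simpa using this

theorem isOrth_basisNorm (b : Basis (Fin (finrank K V)) K V)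
    (u : Fin (finrank K V) → ℝ) : IsOrth K (basisNorm b u) b := fun c i => by
  rw [basisNorm_self]
  have := le_basisNorm b u (∑ j, c j • b j) i
  rwa [b.repr_sum_self] at this

theorem IsOrth.eq_basisNorm {f : V → ℝ} (hf : IsUltraNorm K f)
    {b : Basis (Fin (finrank K V)) K V} (hb : IsOrth K f b) :
    f = basisNorm b fun i => Real.log (f (b i)) := by
  have he : ∀ i, Real.exp (Real.log (f (b i))) = f (b i) := fun i =>
    Real.exp_log (hf.pos (b.ne_zero i))
  funext x
  refine le_antisymm (hf.le_of_repr b x (basisNorm_nonneg _ _ _) fun i => ?_)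
    (basisNorm_le _ _ _ (hf.nonneg x) fun i => ?_)
  · have := le_basisNorm b (fun i => Real.log (f (b i))) x i
    rwa [he] at this
  · rw [he]
    exact hb.le_repr x i

theorem basisNorm_add_const (b : Basis (Fin (finrank K V)) K V) (u : Fin (finrank K V) → ℝ)
    (c : ℝ) (x : V) : basisNorm b (fun i => u i + c) x = Real.exp c * basisNorm b u x := by
  simp only [basisNorm]
  rw [Real.mul_iSup_of_nonneg (Real.exp_pos c).le]
  congr 1
  ext i
  rw [Real.exp_add]
  ring

theorem basisNorm_reindex (b : Basis (Fin (finrank K V)) K V) (u : Fin (finrank K V) → ℝ)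
    (σ : Equiv.Perm (Fin (finrank K V))) (x : V) :
    basisNorm (b.reindex σ.symm) (u ∘ σ) x = basisNorm b u x := by
  simp only [basisNorm, Basis.repr_reindex_apply, Equiv.symm_symm, Function.comp]
  exact σ.iSup_comp (g := fun i => ‖b.repr x i‖ * Real.exp (u i))

namespace Building

theorem mk_eq_mk_iff {b b' : Basis (Fin (finrank K V)) K V} {u u' : Fin (finrank K V) → ℝ} :
    mk b u = mk b' u' ↔ ∃ r : ℝ, 0 < r ∧ ∀ x, basisNorm b' u' x = r * basisNorm b u x :=
  Quotient.eq (r := normSetoid K V)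

/-- A norm representing a point of the building. -/
def norm (x : Building K V) : V → ℝ := (Quotient.out (s := normSetoid K V) x).1

theorem exists_norm_eq (x : Building K V) : ∃ b u, x.norm = basisNorm b u ∧ x = mk b u := by
  obtain ⟨b, u, h⟩ := (Quotient.out (s := normSetoid K V) x).2
  refine ⟨b, u, h, ?_⟩
  conv_lhs => rw [← Quotient.out_eq (s := normSetoid K V) x]
  exact congrArg (Quotient.mk (normSetoid K V)) (Subtype.ext h)

theorem isUltraNorm (x : Building K V) : IsUltraNorm K x.norm := by
  obtain ⟨b, u, h, -⟩ := x.exists_norm_eq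
  rw [h]
  exact isUltraNorm_basisNorm b u

theorem exists_isOrth (x : Building K V) :
    ∃ b : Basis (Fin (finrank K V)) K V, IsOrth K x.norm b := by
  obtain ⟨b, u, h, -⟩ := x.exists_norm_eq
  exact ⟨b, h ▸ isOrth_basisNorm b u⟩

theorem norm_mk (b : Basis (Fin (finrank K V)) K V) (u : Fin (finrank K V) → ℝ) :
    ∃ r : ℝ, 0 < r ∧ ∀ x, (mk b u).norm x = r * basisNorm b u x := by
  obtain ⟨b', u', h, h'⟩ := (mk b u).exists_norm_eq
  rw [h]
  exact mk_eq_mk_iff.1 h'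

theorem isOrth_mk (b : Basis (Fin (finrank K V)) K V) (u : Fin (finrank K V) → ℝ) :
    IsOrth K (mk b u).norm b := by
  obtain ⟨r, hr, h⟩ := norm_mk b u
  rw [funext h]
  exact (isOrth_basisNorm b u).const_mul hr.le

theorem log_norm_mk (b : Basis (Fin (finrank K V)) K V) (u : Fin (finrank K V) → ℝ) :
    ∃ c : ℝ, ∀ i, Real.log ((mk b u).norm (b i)) = u i + c := by
  obtain ⟨r, hr, h⟩ := norm_mk b u
  refine ⟨Real.log r, fun i => ?_⟩
  rw [h, basisNorm_self, Real.log_mul hr.ne' (Real.exp_pos _).ne', Real.log_exp, add_comm]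

theorem eq_mk_of_isOrth {x : Building K V} {b : Basis (Fin (finrank K V)) K V}
    (h : IsOrth K x.norm b) : x = mk b fun i => Real.log (x.norm (b i)) := by
  obtain ⟨b', u', h1, h2⟩ := x.exists_norm_eq
  conv_lhs => rw [h2]
  rw [mk_eq_mk_iff]
  refine ⟨1, one_pos, fun y => ?_⟩
  rw [← h.eq_basisNorm x.isUltraNorm, h1, one_mul]

theorem mk_congr (b : Basis (Fin (finrank K V)) K V) {u v : Fin (finrank K V) → ℝ} {c : ℝ}
    (h : ∀ i, u i = v i + c) : mk b u = mk b v := by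
  rw [eq_comm, mk_eq_mk_iff]
  exact ⟨Real.exp c, Real.exp_pos c, fun x => by rw [funext h, basisNorm_add_const]⟩

theorem mk_reindex (b : Basis (Fin (finrank K V)) K V) (u : Fin (finrank K V) → ℝ)
    (σ : Equiv.Perm (Fin (finrank K V))) : mk (b.reindex σ.symm) (u ∘ σ) = mk b u := by
  rw [mk_eq_mk_iff]
  exact ⟨1, one_pos, fun x => by rw [basisNorm_reindex, one_mul]⟩

/-- Orthogonalizing relative to a second point, after a suitable reordering. -/
theorem exists_perm_gs [FiniteDimensional K V] (x y : Building K V)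
    (b : Basis (Fin (finrank K V)) K V) (hb : IsOrth K x.norm b) :
    ∃ (σ : Equiv.Perm (Fin (finrank K V))) (e : Basis (Fin (finrank K V)) K V),
      IsOrth K x.norm e ∧ IsOrth K y.norm e ∧ (∀ k, x.norm (e k) = x.norm (b (σ k))) ∧
      ∀ k, gs K y.norm (b.reindex σ.symm) k = y.norm (e k) := by
  obtain ⟨b', hb'⟩ := y.exists_isOrth
  obtain ⟨σ, e, hσ, hxe, hye, -, hx, he⟩ :=
    IsOrth.exists_common x.isUltraNorm y.isUltraNorm hb' b b.ne_zero hb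
  have he0 : ∀ k, e k ≠ 0 := fun k h => by
    have := hx k
    rw [h, x.isUltraNorm.zero] at this
    exact (x.isUltraNorm.pos (b.ne_zero (σ k))).ne this
  rcases Nat.eq_zero_or_pos (finrank K V) with h0 | hn
  · have : IsEmpty (Fin (finrank K V)) := by rw [h0]; infer_instance
    exact ⟨1, b, fun c i => isEmptyElim i, fun c i => isEmptyElim i, fun i => isEmptyElim i,
      fun i => isEmptyElim i⟩
  have : Nonempty (Fin (finrank K V)) := ⟨⟨0, hn⟩⟩
  have hli := hxe.linearIndependent x.isUltraNorm he0
  refine ⟨Equiv.ofBijective σ (Finite.injective_iff_bijective.1 hσ),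
    basisOfLinearIndependentOfCardEqFinrank hli (by simp), ?_, ?_, ?_, ?_⟩
  · rwa [coe_basisOfLinearIndependentOfCardEqFinrank]
  · rwa [coe_basisOfLinearIndependentOfCardEqFinrank]
  · rw [coe_basisOfLinearIndependentOfCardEqFinrank]
    exact hx
  · rw [coe_basisOfLinearIndependentOfCardEqFinrank]
    have hbσ : ⇑(b.reindex (Equiv.ofBijective σ (Finite.injective_iff_bijective.1 hσ)).symm) =
        b ∘ σ := by
      ext k
      simp
    intro k
    rw [hbσ]
    exact gs_eq_of_forall_le (he k).1 (he k).2

theorem exists_common_apartment [FiniteDimensional K V] (x y : Building K V) :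
    ∃ e : Basis (Fin (finrank K V)) K V, IsOrth K x.norm e ∧ IsOrth K y.norm e := by
  obtain ⟨b, hb⟩ := x.exists_isOrth
  obtain ⟨-, e, h1, h2, -⟩ := exists_perm_gs x y b hb
  exact ⟨e, h1, h2⟩

/-- The retraction onto the apartment of `b` centred at the chamber at infinity given by the
ordering of `b`. -/
def retract (b : Basis (Fin (finrank K V)) K V) (x : Building K V) : Fin (finrank K V) → ℝ :=
  fun k => Real.log (gs K x.norm b k)

theorem retract_of_isOrth {b : Basis (Fin (finrank K V)) K V} {x : Building K V}
    (h : IsOrth K x.norm b) : retract b x = fun i => Real.log (x.norm (b i)) :=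
  funext fun k => by rw [retract, gs_of_isOrth h]

theorem retract_mk (b : Basis (Fin (finrank K V)) K V) (u : Fin (finrank K V) → ℝ) :
    ∃ c : ℝ, ∀ i, retract b (mk b u) i = u i + c := by
  rw [retract_of_isOrth (isOrth_mk b u)]
  exact log_norm_mk b u

end Building

end Basic

/-! ### Retractions contract, triangle inequality, CAT(0) and unique geodesics -/

section Metric

open Building

variable {K : Type*} [NontriviallyNormedField K] [IsUltrametricDist K]
  {V : Type*} [AddCommGroup V] [Module K V] [FiniteDimensional K V]
  (B : WeylScalarProduct (finrank K V))

theorem len_retract_sub_le (hn : 2 ≤ finrank K V) {x y : Building K V}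
    {e : Basis (Fin (finrank K V)) K V}
    (hx : IsOrth K x.norm e) (hy : IsOrth K y.norm e) (b : Basis (Fin (finrank K V)) K V) :
    B.len (retract b x - retract b y) ≤
      B.len fun i => Real.log (x.norm (e i)) - Real.log (y.norm (e i)) :=
  B.len_le_len hn (sum_log_gs_sub x.isUltraNorm y.isUltraNorm e b hx hy)
    (sum_sq_log_gs_sub_le x.isUltraNorm y.isUltraNorm e b hx hy)

/-- Two apartments containing both points give the same distance: each retracts onto the other
without increasing lengths. Hence the set in the infimum is a singleton. -/
theorem bdist_eq (hn : 2 ≤ finrank K V) {x y : Building K V} {e : Basis (Fin (finrank K V)) K V}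
    (hx : IsOrth K x.norm e) (hy : IsOrth K y.norm e) :
    bdist B x y = B.len fun i => Real.log (x.norm (e i)) - Real.log (y.norm (e i)) := by
  have key : ∀ {e e' : Basis (Fin (finrank K V)) K V}, IsOrth K x.norm e → IsOrth K y.norm e →
      IsOrth K x.norm e' → IsOrth K y.norm e' →
      (B.len fun i => Real.log (x.norm (e' i)) - Real.log (y.norm (e' i))) ≤
      B.len fun i => Real.log (x.norm (e i)) - Real.log (y.norm (e i)) := by
    intro e e' h1 h2 h3 h4
    have := len_retract_sub_le B hn h1 h2 e'
    rwa [retract_of_isOrth h3, retract_of_isOrth h4] at this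
  suffices h : {r | ∃ (b : Basis (Fin (finrank K V)) K V) (u v : Fin (finrank K V) → ℝ),
      x = Building.mk b u ∧ y = Building.mk b v ∧ r = √(B.form (u - v) (u - v))} =
      {B.len fun i => Real.log (x.norm (e i)) - Real.log (y.norm (e i))} by
    rw [bdist, h, csInf_singleton]
  ext r
  rw [Set.mem_singleton_iff]
  constructor
  · rintro ⟨b, u, v, hxb, hyb, rfl⟩
    have h1 : IsOrth K x.norm b := hxb ▸ isOrth_mk b u
    have h2 : IsOrth K y.norm b := hyb ▸ isOrth_mk b v
    obtain ⟨c, hc⟩ := log_norm_mk b u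
    obtain ⟨c', hc'⟩ := log_norm_mk b v
    rw [← hxb] at hc
    rw [← hyb] at hc'
    have h3 : B.len (u - v) = B.len fun i => Real.log (x.norm (b i)) - Real.log (y.norm (b i)) := by
      refine B.len_congr (c := c' - c) fun i => ?_
      rw [hc, hc', Pi.sub_apply]
      ring
    exact h3.trans (le_antisymm (key hx hy h1 h2) (key h1 h2 hx hy))
  · rintro rfl
    exact ⟨e, _, _, eq_mk_of_isOrth hx, eq_mk_of_isOrth hy, rfl⟩

theorem bdist_mk_mk (hn : 2 ≤ finrank K V) (b : Basis (Fin (finrank K V)) K V)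
    (u v : Fin (finrank K V) → ℝ) : bdist B (mk b u) (mk b v) = B.len (u - v) := by
  rw [bdist_eq B hn (isOrth_mk b u) (isOrth_mk b v)]
  obtain ⟨c, hc⟩ := log_norm_mk b u
  obtain ⟨c', hc'⟩ := log_norm_mk b v
  refine B.len_congr (c := c - c') fun i => ?_
  rw [hc, hc', Pi.sub_apply]
  ring

theorem len_retract_sub_le_bdist (hn : 2 ≤ finrank K V) (b : Basis (Fin (finrank K V)) K V)
    (x y : Building K V) : B.len (retract b x - retract b y) ≤ bdist B x y := by
  obtain ⟨e, hx, hy⟩ := exists_common_apartment x y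
  rw [bdist_eq B hn hx hy]
  exact len_retract_sub_le B hn hx hy b

theorem len_retract_sub_eq (hn : 2 ≤ finrank K V) {b : Basis (Fin (finrank K V)) K V}
    {x y : Building K V} (hx : IsOrth K x.norm b) (hy : IsOrth K y.norm b) :
    B.len (retract b x - retract b y) = bdist B x y := by
  rw [bdist_eq B hn hx hy, retract_of_isOrth hx, retract_of_isOrth hy]
  rfl

theorem bdist_nonneg (x y : Building K V) : 0 ≤ bdist B x y := by
  refine Real.sInf_nonneg ?_
  rintro _ ⟨b, u, v, -, -, rfl⟩
  exact Real.sqrt_nonneg _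

theorem bdist_self (hn : 2 ≤ finrank K V) (x : Building K V) : bdist B x x = 0 := by
  obtain ⟨e, hx, hy⟩ := exists_common_apartment x x
  rw [bdist_eq B hn hx hy]
  simpa using B.len_const 0

theorem bdist_comm (hn : 2 ≤ finrank K V) (x y : Building K V) : bdist B x y = bdist B y x := by
  obtain ⟨e, hx, hy⟩ := exists_common_apartment x y
  rw [← len_retract_sub_eq B hn hx hy, ← len_retract_sub_eq B hn hy hx, B.len_sub_comm]

theorem eq_of_bdist_eq_zero (hn : 2 ≤ finrank K V) {x y : Building K V} (h : bdist B x y = 0) :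
    x = y := by
  obtain ⟨e, hx, hy⟩ := exists_common_apartment x y
  rw [bdist_eq B hn hx hy, B.len_eq_zero_iff] at h
  obtain ⟨c, hc⟩ := h
  rw [eq_mk_of_isOrth hx, eq_mk_of_isOrth hy]
  exact mk_congr e (c := c) fun i => by linarith [congrFun hc i]

/-- Retract `y` onto an apartment containing `x` and `z`, and use the Euclidean inequality there. -/
theorem bdist_triangle (hn : 2 ≤ finrank K V) (x y z : Building K V) :
    bdist B x z ≤ bdist B x y + bdist B y z := by
  obtain ⟨e, hx, hz⟩ := exists_common_apartment x z
  rw [← len_retract_sub_eq B hn hx hz, ← sub_add_sub_cancel _ (retract e y)]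
  exact (B.len_add_le hn _ _).trans (add_le_add (len_retract_sub_le_bdist B hn e x y)
    (len_retract_sub_le_bdist B hn e y z))

/-- The CAT(0) inequality. -/
theorem bdist_sq_le (hn : 2 ≤ finrank K V) (b : Basis (Fin (finrank K V)) K V)
    (u v : Fin (finrank K V) → ℝ) {s : ℝ} (hs : 0 ≤ s) (hs' : s ≤ 1) (y : Building K V) :
    bdist B y (mk b ((1 - s) • u + s • v)) ^ 2 ≤
      (1 - s) * bdist B y (mk b u) ^ 2 + s * bdist B y (mk b v) ^ 2 -
        s * (1 - s) * bdist B (mk b u) (mk b v) ^ 2 := by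
  -- The order of the basis is chosen so that the retraction preserves the distance from `y` to the
  -- dividing point. Distances from `y` to the two ends can only shrink, so Stewart's theorem in the
  -- apartment gives the inequality.
  obtain ⟨σ, e, hme, hye, hm, he⟩ :=
    exists_perm_gs (mk b ((1 - s) • u + s • v)) y b (isOrth_mk b _)
  set b' := b.reindex σ.symm with hb'
  set w := (1 - s) • u + s • v with hw
  have h1 : bdist B y (mk b w) = B.len (retract b' y - w ∘ σ) := by
    rw [bdist_eq B hn hye hme]
    obtain ⟨c, hc⟩ := log_norm_mk b w
    refine B.len_congr (c := -c) fun i => ?_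
    rw [hm, hc, Pi.sub_apply, retract, he]
    simp
    ring
  have h2 : ∀ u : Fin (finrank K V) → ℝ, B.len (retract b' y - u ∘ σ) ≤ bdist B y (mk b u) := by
    intro u
    obtain ⟨c, hc⟩ := retract_mk b' (u ∘ σ)
    rw [← mk_reindex b u σ]
    refine le_of_eq_of_le ?_ (len_retract_sub_le_bdist B hn b' y _)
    refine B.len_congr (c := c) fun i => ?_
    rw [Pi.sub_apply, Pi.sub_apply, hc]
    ring
  have h3 : w ∘ σ = (1 - s) • (u ∘ σ) + s • (v ∘ σ) := rfl
  have h4 : B.len (u ∘ σ - v ∘ σ) = bdist B (mk b u) (mk b v) := by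
    rw [bdist_mk_mk B hn]
    exact B.len_comp σ (u - v)
  rw [h1, h3, B.len_stewart, h4]
  have h5 := pow_le_pow_left₀ (B.len_nonneg _) (h2 u) 2
  have h6 := pow_le_pow_left₀ (B.len_nonneg _) (h2 v) 2
  have h7 := mul_le_mul_of_nonneg_left h5 (by linarith : 0 ≤ 1 - s)
  have h8 := mul_le_mul_of_nonneg_left h6 hs
  linarith

/-- For a point at these distances from the ends, the right side of the CAT(0) inequality is zero.
-/
theorem eq_of_bdist_between (hn : 2 ≤ finrank K V) (b : Basis (Fin (finrank K V)) K V)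
    (u v : Fin (finrank K V) → ℝ) {s : ℝ} (hs : 0 ≤ s) (hs' : s ≤ 1) {p : Building K V}
    (h₁ : bdist B (mk b u) p = s * bdist B (mk b u) (mk b v))
    (h₂ : bdist B p (mk b v) = (1 - s) * bdist B (mk b u) (mk b v)) :
    p = mk b ((1 - s) • u + s • v) := by
  have h := bdist_sq_le B hn b u v hs hs' p
  rw [bdist_comm B hn p (mk b u), h₁, h₂] at h
  refine eq_of_bdist_eq_zero B hn (pow_eq_zero_iff (two_ne_zero) |>.1 (le_antisymm ?_ (sq_nonneg _)))
  refine h.trans (le_of_eq ?_)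
  ring

theorem bdist_mk_combination (hn : 2 ≤ finrank K V) (b : Basis (Fin (finrank K V)) K V)
    (u v : Fin (finrank K V) → ℝ) {s : ℝ} (hs : 0 ≤ s) (hs' : s ≤ 1) :
    bdist B (mk b u) (mk b ((1 - s) • u + s • v)) = s * bdist B (mk b u) (mk b v) ∧
    bdist B (mk b ((1 - s) • u + s • v)) (mk b v) = (1 - s) * bdist B (mk b u) (mk b v) := by
  rw [bdist_mk_mk B hn, bdist_mk_mk B hn, bdist_mk_mk B hn]
  constructor
  · rw [show u - ((1 - s) • u + s • v) = s • (u - v) by module, B.len_smul, abs_of_nonneg hs]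
  · rw [show (1 - s) • u + s • v - v = (1 - s) • (u - v) by module, B.len_smul,
      abs_of_nonneg (by linarith)]

/-- `p` divides a geodesic segment from `x` to `y` in the ratio `s : 1 - s`. -/
def Divides (s : ℝ) (x y p : Building K V) : Prop :=
  bdist B x p = s * bdist B x y ∧ bdist B p y = (1 - s) * bdist B x y

variable {B}

theorem exists_divides (hn : 2 ≤ finrank K V) {s : ℝ} (hs : 0 ≤ s) (hs' : s ≤ 1)
    (x y : Building K V) : ∃ p, Divides B s x y p := by
  obtain ⟨e, hx, hy⟩ := exists_common_apartment x y
  rw [eq_mk_of_isOrth hx, eq_mk_of_isOrth hy]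
  exact ⟨_, bdist_mk_combination B hn e _ _ hs hs'⟩

theorem Divides.eq (hn : 2 ≤ finrank K V) {s : ℝ} (hs : 0 ≤ s) (hs' : s ≤ 1)
    {x y p q : Building K V} (hp : Divides B s x y p) (hq : Divides B s x y q) : p = q := by
  obtain ⟨e, hx, hy⟩ := exists_common_apartment x y
  rw [eq_mk_of_isOrth hx, eq_mk_of_isOrth hy] at hp hq
  exact (eq_of_bdist_between B hn e _ _ hs hs' hp.1 hp.2).trans
    (eq_of_bdist_between B hn e _ _ hs hs' hq.1 hq.2).symm

theorem Divides.isOrth (hn : 2 ≤ finrank K V) {s : ℝ} (hs : 0 ≤ s) (hs' : s ≤ 1)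
    {x y p : Building K V} (hp : Divides B s x y p) {e : Basis (Fin (finrank K V)) K V}
    (hx : IsOrth K x.norm e) (hy : IsOrth K y.norm e) : IsOrth K p.norm e := by
  rw [eq_mk_of_isOrth hx, eq_mk_of_isOrth hy] at hp
  rw [eq_of_bdist_between B hn e _ _ hs hs' hp.1 hp.2]
  exact isOrth_mk _ _

theorem Divides.symm (hn : 2 ≤ finrank K V) {s : ℝ} {x y p : Building K V}
    (hp : Divides B s x y p) : Divides B (1 - s) y x p := by
  constructor
  · rw [bdist_comm B hn y p, hp.2, bdist_comm B hn x y]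
  · rw [bdist_comm B hn p x, hp.1, bdist_comm B hn x y]
    ring

theorem Divides.sq_le (hn : 2 ≤ finrank K V) {s : ℝ} (hs : 0 ≤ s) (hs' : s ≤ 1)
    {x y p : Building K V} (hp : Divides B s x y p) (z : Building K V) :
    bdist B z p ^ 2 ≤ (1 - s) * bdist B z x ^ 2 + s * bdist B z y ^ 2 -
      s * (1 - s) * bdist B x y ^ 2 := by
  obtain ⟨e, hx, hy⟩ := exists_common_apartment x y
  rw [eq_mk_of_isOrth hx, eq_mk_of_isOrth hy] at hp ⊢
  rw [eq_of_bdist_between B hn e _ _ hs hs' hp.1 hp.2]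
  exact bdist_sq_le B hn e _ _ hs hs' z

/-- Convexity of the metric along geodesics with a common starting point. -/
theorem Divides.bdist_le (hn : 2 ≤ finrank K V) {s : ℝ} (hs : 0 ≤ s) (hs' : s ≤ 1)
    {x y z p q : Building K V} (hp : Divides B s x y p) (hq : Divides B s x z q) :
    bdist B p q ≤ s * bdist B y z := by
  -- CAT(0) twice: for `q` against the segment from `x` to `y`, then for `y` against the segment
  -- from `x` to `z`.
  have h1 := hp.sq_le hn hs hs' q
  have h2 := hq.sq_le hn hs hs' y
  rw [bdist_comm B hn q x, hq.1, bdist_comm B hn q y] at h1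
  rw [bdist_comm B hn y x] at h2
  have h3 := mul_le_mul_of_nonneg_left h2 hs
  rw [bdist_comm B hn p q]
  refine abs_le_of_sq_le_sq' ?_ (mul_nonneg hs (bdist_nonneg B y z)) |>.2
  refine h1.trans ?_
  have : (s * bdist B y z) ^ 2 = (1 - s) * (s * bdist B x z) ^ 2 +
    s * ((1 - s) * bdist B x y ^ 2 + s * bdist B y z ^ 2 - s * (1 - s) * bdist B x z ^ 2) -
      s * (1 - s) * bdist B x y ^ 2 := by ring
  rw [this]
  linarith

end Metric

/-! ## Convergence to boundary points -/

section Boundary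

open Building

variable {K : Type*} [NontriviallyNormedField K] [IsUltrametricDist K]
  {V : Type*} [AddCommGroup V] [Module K V] [FiniteDimensional K V]
  {B : WeylScalarProduct (finrank K V)}

theorem asymptotic_equivalence (hn : 2 ≤ finrank K V) : Equivalence (Asymptotic B) where
  refl c := ⟨0, fun t => (bdist_self B hn _).le⟩
  symm := by
    rintro c c' ⟨C, hC⟩
    exact ⟨C, fun t => by rw [bdist_comm B hn]; exact hC t⟩
  trans := by
    rintro c c' c'' ⟨C, hC⟩ ⟨C', hC'⟩
    exact ⟨C + C', fun t => (bdist_triangle B hn _ (c'.1 t) _).trans (add_le_add (hC t) (hC' t))⟩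

theorem endpoint_eq_iff (hn : 2 ≤ finrank K V) {c c' : HalfGeodesic B} :
    c.endpoint = c'.endpoint ↔ Asymptotic B c c' :=
  (Quot.eq (r := Asymptotic B)).trans (asymptotic_equivalence hn).eqvGen_iff

theorem HalfGeodesic.divides (c : HalfGeodesic B) {s : ℝ} (hs : 0 ≤ s)
    (hs' : s ≤ 1) (t : NNReal) : Divides B s (c.1 0) (c.1 t) (c.1 (s.toNNReal * t)) := by
  have h : ((s.toNNReal * t : NNReal) : ℝ) = s * t := by
    rw [NNReal.coe_mul, Real.coe_toNNReal s hs]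
  have ht : (0 : ℝ) ≤ t := t.2
  constructor
  · rw [c.2, c.2, h]
    simp [abs_mul, abs_of_nonneg hs]
  · rw [c.2, c.2, h, ← sub_one_mul, abs_mul, abs_of_nonpos (by linarith)]
    simp

theorem bdist_abs_sub_le (hn : 2 ≤ finrank K V) (x y z : Building K V) :
    |bdist B x z - bdist B y z| ≤ bdist B x y := by
  rw [abs_le]
  have h1 := bdist_triangle B hn x y z
  have h2 := bdist_triangle B hn y x z
  rw [bdist_comm B hn y x] at h2
  constructor <;> linarith

theorem divides_of_bdist {x y p : Building K V} {r : ℝ}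
    (hr : r < bdist B x y) (h : bdist B x p = r) (h' : bdist B p y = bdist B x y - r) :
    Divides B (r / bdist B x y) x y p := by
  have h0 : 0 ≤ r := h ▸ bdist_nonneg B x p
  have hpos : 0 < bdist B x y := h0.trans_lt hr
  constructor
  · rw [h, div_mul_cancel₀ _ hpos.ne']
  · rw [h', sub_mul, one_mul, div_mul_cancel₀ _ hpos.ne']

/-- Let the ray `c` represent `ξ`. Cone neighbourhoods force the geodesic from `c 0` to a distant `h
t` to pass near `c r`, and convexity as seen from `h t` keeps it near `h r`. So `c` and `h` are
asymptotic. -/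
theorem eq_endpoint_of_tendsto (hn : 2 ≤ finrank K V) (h : HalfGeodesic B) (ξ : Boundary B)
    (hξ : Tendsto (fun t : NNReal => Compactification.point (B := B) (h.1 t)) atTop
      (𝓝 (Compactification.bdry ξ))) : ξ = h.endpoint := by
  obtain ⟨c, rfl⟩ : ∃ c : HalfGeodesic B, c.endpoint = ξ := Quot.exists_rep ξ
  rw [endpoint_eq_iff hn]
  set D := bdist B (c.1 0) (h.1 0) with hD
  -- The first summand covers r = 0, where there is no cone. For r > 0 the bound is 1 for the cone,
  -- `D` for convexity and `D` for the difference between the times s t and r on `h`.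
  refine ⟨bdist B (c.1 0) (h.1 0) + (2 * D + 1), fun r => ?_⟩
  have hD0 : 0 ≤ D := bdist_nonneg B _ _
  by_cases hr : r = 0
  · subst hr
    linarith
  have hr' : 0 < r := pos_iff_ne_zero.2 hr
  have hopen : IsOpen (cone B c r 1) := TopologicalSpace.isOpen_generateFrom_of_mem
    (Or.inr ⟨c, r, 1, hr', one_pos, rfl⟩)
  have hmem : Compactification.bdry c.endpoint ∈ cone B c r 1 :=
    Or.inr ⟨c, rfl, rfl, by rw [bdist_self B hn]; exact one_pos⟩
  have hev := hξ.eventually (hopen.mem_nhds hmem)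
  obtain ⟨t, ht1, ht2⟩ := (hev.and (eventually_ge_atTop (r + 1))).exists
  have hrt : (r : ℝ) + 1 ≤ t := by exact_mod_cast ht2
  rcases ht1 with ⟨y, p, hy, hrL, hp1, hp2, hp3⟩ | ⟨c', hc', -⟩
  · injection hy with hy
    subst hy
    set L := bdist B (c.1 0) (h.1 t) with hL
    have hr0 : (0 : ℝ) ≤ r := r.2
    have hL0 : 0 < L := hr0.trans_lt hrL
    set s := (r : ℝ) / L with hs
    have hs0 : 0 ≤ s := by positivity
    have hs1 : s ≤ 1 := (div_le_one hL0).2 hrL.le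
    have hdiv := (divides_of_bdist hrL hp1 hp2).symm hn
    have hdiv' := (h.divides hs0 hs1 t).symm hn
    have e1 := hdiv.bdist_le hn (by linarith) (by linarith) hdiv'
    have e2 : (1 - s) * bdist B (c.1 0) (h.1 0) ≤ D :=
      mul_le_of_le_one_left hD0 (by linarith)
    have hht : bdist B (h.1 0) (h.1 t) = t := by
      rw [h.2]
      simp
    have e3 : |L - t| ≤ D := by
      have := bdist_abs_sub_le (B := B) hn (c.1 0) (h.1 0) (h.1 t)
      rwa [hht] at this
    have e4 : bdist B (h.1 (s.toNNReal * t)) (h.1 r) ≤ D := by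
      rw [h.2, NNReal.coe_mul, Real.coe_toNNReal s hs0]
      have : s * t - r = s * (t - L) := by
        rw [mul_sub, hs, div_mul_cancel₀ _ hL0.ne']
      rw [this, abs_mul, abs_of_nonneg hs0, abs_sub_comm]
      exact (mul_le_of_le_one_left (abs_nonneg _) hs1).trans e3
    have e5 := bdist_triangle B hn (c.1 r) p (h.1 r)
    have e6 := bdist_triangle B hn p (h.1 (s.toNNReal * t)) (h.1 r)
    rw [bdist_comm B hn (c.1 r) p] at e5
    linarith
  · cases hc'

/-- A cone containing the endpoint of `h` is witnessed by an asymptotic ray `c'` from the apex. By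
convexity the segment from the apex to `h t` is, at distance `r`, within O(1/t) of `c' r`. -/
theorem tendsto_endpoint (hn : 2 ≤ finrank K V) (h : HalfGeodesic B) :
    Tendsto (fun t : NNReal => Compactification.point (B := B) (h.1 t)) atTop
      (𝓝 (Compactification.bdry h.endpoint)) := by
  rw [TopologicalSpace.tendsto_nhds_generateFrom_iff]
  rintro U (⟨x, ε, -, rfl⟩ | ⟨c, r, ε, hr, hε, rfl⟩) hU
  · obtain ⟨y, hy, -⟩ := hU
    cases hy
  rcases hU with ⟨y, p, hy, -⟩ | ⟨c', hc', hc0, hcr⟩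
  · cases hy
  injection hc' with hc'
  obtain ⟨C, hC⟩ := (endpoint_eq_iff hn).1 hc'.symm
  have hC0 : 0 ≤ C := (bdist_nonneg B _ _).trans (hC 0)
  set δ := ε - bdist B (c'.1 r) (c.1 r) with hδ
  have hδ0 : 0 < δ := by linarith
  have hr0 : (0 : ℝ) < r := hr
  -- Since L ≥ t - C, this threshold ensures both r < L and 2 r C / L < δ.
  have hev : ∀ᶠ t : NNReal in atTop, C + r + 2 * r * C / δ + 1 ≤ t := by
    filter_upwards [eventually_ge_atTop (C + r + 2 * r * C / δ + 1).toNNReal] with t ht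
    exact Real.toNNReal_le_iff_le_coe.1 ht
  filter_upwards [hev] with t ht
  left
  have h0 : 0 ≤ 2 * r * C / δ := by positivity
  set L := bdist B (c.1 0) (h.1 t) with hL
  have hct : bdist B (c'.1 0) (c'.1 t) = t := by
    rw [c'.2]
    simp
  have hLt : |L - t| ≤ C := by
    have h1 := bdist_abs_sub_le (B := B) hn (h.1 t) (c'.1 t) (c.1 0)
    rw [bdist_comm B hn (h.1 t) (c.1 0), bdist_comm B hn (c'.1 t) (c.1 0),
      bdist_comm B hn (h.1 t) (c'.1 t), ← hc0, hct, hc0] at h1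
    exact h1.trans (hC t)
  have hLt' := abs_le.1 hLt
  have hLr : r < L := by linarith
  have hL0 : 0 < L := hr0.trans hLr
  set s := (r : ℝ) / L with hs
  have hs0 : 0 ≤ s := by positivity
  have hs1 : s ≤ 1 := (div_le_one hL0).2 hLr.le
  have hsL : s * L = r := div_mul_cancel₀ _ hL0.ne'
  obtain ⟨p, hp⟩ := exists_divides (B := B) hn hs0 hs1 (c.1 0) (h.1 t)
  refine ⟨h.1 t, p, rfl, hLr, ?_, ?_, ?_⟩
  · rw [hp.1, ← hL, hsL]
  · rw [hp.2, ← hL, sub_mul, hsL, one_mul]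
  · have hq := c'.divides hs0 hs1 t
    rw [hc0] at hq
    have e1 := hp.bdist_le hn hs0 hs1 hq
    have e2 : bdist B (h.1 t) (c'.1 t) ≤ C := by
      rw [bdist_comm B hn]
      exact hC t
    have e3 : bdist B (c'.1 (s.toNNReal * t)) (c'.1 r) ≤ s * C := by
      rw [c'.2, NNReal.coe_mul, Real.coe_toNNReal s hs0]
      have : s * t - r = s * (t - L) := by rw [mul_sub, hsL]
      rw [this, abs_mul, abs_of_nonneg hs0, abs_sub_comm]
      exact mul_le_mul_of_nonneg_left hLt hs0
    have e4 : s * bdist B (h.1 t) (c'.1 t) ≤ s * C := mul_le_mul_of_nonneg_left e2 hs0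
    have e5 := bdist_triangle B hn p (c'.1 (s.toNNReal * t)) (c.1 r)
    have e6 := bdist_triangle B hn (c'.1 (s.toNNReal * t)) (c'.1 r) (c.1 r)
    have e7 : 2 * (s * C) < δ := by
      have : 2 * r * C / δ < L := by linarith
      rw [div_lt_iff₀ hδ0] at this
      rw [hs, div_mul_eq_mul_div, ← mul_div_assoc, div_lt_iff₀ hL0]
      linarith
    linarith

/-- The positive half of a geodesic. -/
def positiveHalf {γ : ℝ → Building K V} (hγ : IsGeodesic B γ) : HalfGeodesic B :=
  ⟨fun t => γ t, fun s t => hγ s t⟩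

theorem isGeodesic_comp_neg {γ : ℝ → Building K V} (hγ : IsGeodesic B γ) :
    IsGeodesic B fun t => γ (-t) := fun s t => by
  rw [hγ, abs_sub_comm]
  congr 1
  ring

theorem tendsto_atTop_bdry_iff (hn : 2 ≤ finrank K V) {γ : ℝ → Building K V}
    (hγ : IsGeodesic B γ) (ξ : Boundary B) :
    Tendsto (fun t => Compactification.point (B := B) (γ t)) atTop
      (𝓝 (Compactification.bdry ξ)) ↔ ξ = (positiveHalf hγ).endpoint := by
  constructor
  · intro h
    refine eq_endpoint_of_tendsto hn (positiveHalf hγ) ξ ?_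
    exact h.comp (NNReal.tendsto_coe_atTop.2 tendsto_id)
  · rintro rfl
    have h := (tendsto_endpoint hn (positiveHalf hγ)).comp Real.tendsto_toNNReal_atTop
    refine h.congr' ?_
    filter_upwards [eventually_ge_atTop 0] with t ht
    simp [positiveHalf, ht]

theorem tendsto_atBot_bdry_iff (hn : 2 ≤ finrank K V) {γ : ℝ → Building K V}
    (hγ : IsGeodesic B γ) (ξ : Boundary B) :
    Tendsto (fun t => Compactification.point (B := B) (γ t)) atBot
      (𝓝 (Compactification.bdry ξ)) ↔ ξ = (positiveHalf (isGeodesic_comp_neg hγ)).endpoint := by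
  rw [← tendsto_atTop_bdry_iff hn]
  constructor
  · exact fun h => h.comp tendsto_neg_atTop_atBot
  · intro h
    have := h.comp tendsto_neg_atBot_atTop
    simpa [Function.comp_def] using this

end Boundary

/-! ## Geodesics lie in apartments -/

section Apartment

open Building

variable {K : Type*} [NontriviallyNormedField K]
  {V : Type*} [AddCommGroup V] [Module K V]

theorem IsOrth.smul {ι : Type*} [Fintype ι] {f : V → ℝ} {x : ι → V} (hf : IsUltraNorm K f)
    (h : IsOrth K f x) (a : ι → K) : IsOrth K f fun i => a i • x i := fun c i => by
  have := h (fun i => c i * a i) i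
  simpa [hf.smul, mul_smul, mul_assoc] using this

theorem IsUltraNorm.continuous_sum_smul {ι : Type*} [Fintype ι] {f : V → ℝ}
    (hf : IsUltraNorm K f) (x : ι → V) : Continuous fun a : ι → K => f (∑ i, a i • x i) := by
  rw [continuous_iff_continuousAt]
  intro a
  have hsum : Continuous fun a' : ι → K => ∑ i, ‖a' i - a i‖ * f (x i) := by fun_prop
  have h0 : Tendsto (fun a' : ι → K => ∑ i, ‖a' i - a i‖ * f (x i)) (𝓝 a) (𝓝 0) := by
    have := hsum.tendsto a
    simpa using this
  refine tendsto_iff_norm_sub_tendsto_zero.2 (squeeze_zero (fun _ => norm_nonneg _) ?_ h0)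
  intro a'
  have hpos : ∀ i, 0 ≤ ‖a' i - a i‖ * f (x i) := fun i => mul_nonneg (norm_nonneg _) (hf.nonneg _)
  have h1 : f (∑ i, a' i • x i - ∑ i, a i • x i) ≤ ∑ i, ‖a' i - a i‖ * f (x i) := by
    rw [← Finset.sum_sub_distrib]
    refine hf.sum_le _ _ (Finset.sum_nonneg fun i _ => hpos i) fun i hi => ?_
    rw [← sub_smul, hf.smul]
    exact Finset.single_le_sum (f := fun i => ‖a' i - a i‖ * f (x i)) (fun i _ => hpos i) hi
  have h2 : ∀ v w, f v - f w ≤ f (v - w) := by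
    intro v w
    have := hf.add_le (v - w) w
    rw [sub_add_cancel] at this
    have h3 := hf.nonneg (v - w)
    have h4 := hf.nonneg w
    rcases le_max_iff.1 this with h | h <;> linarith
  simp only [Real.norm_eq_abs, abs_le]
  have h3 := h2 (∑ i, a' i • x i) (∑ i, a i • x i)
  have h4 := h2 (∑ i, a i • x i) (∑ i, a' i • x i)
  have h5 := hf.neg (∑ i, a' i • x i - ∑ i, a i • x i)
  rw [neg_sub] at h5
  rw [h5] at h4
  constructor <;> linarith

theorem IsOrth.exists_normalized {ι : Type*} [Fintype ι] {f : V → ℝ} {x : ι → V}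
    (hf : IsUltraNorm K f) (hx : ∀ i, x i ≠ 0) {c₀ : K} (hc₀ : 1 < ‖c₀‖) :
    ∃ a : ι → K, ∀ i, 1 ≤ f (a i • x i) ∧ f (a i • x i) ≤ ‖c₀‖ := by
  have h : ∀ i, ∃ a : K, 1 ≤ f (a • x i) ∧ f (a • x i) ≤ ‖c₀‖ := by
    intro i
    obtain ⟨k, hk, hk'⟩ := exists_mem_Ico_zpow (hf.pos (hx i)) hc₀
    have hpos : 0 < ‖c₀‖ ^ k := zpow_pos (one_pos.trans hc₀) k
    refine ⟨(c₀ ^ k)⁻¹, ?_⟩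
    rw [hf.smul, norm_inv, norm_zpow, ← div_eq_inv_mul, le_div_iff₀ hpos, div_le_iff₀ hpos,
      one_mul]
    refine ⟨hk, hk'.le.trans (le_of_eq ?_)⟩
    rw [zpow_add_one₀ (one_pos.trans hc₀).ne', mul_comm]
  choose a ha using h
  exact ⟨a, ha⟩

variable [IsUltrametricDist K] [FiniteDimensional K V] {B : WeylScalarProduct (finrank K V)}

theorem IsGeodesic.divides {γ : ℝ → Building K V} (hγ : IsGeodesic B γ) {N t : ℝ} (hN : 0 < N)
    (ht : |t| ≤ N) : Divides B ((t + N) / (2 * N)) (γ (-N)) (γ N) (γ t) := by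
  have h := abs_le.1 ht
  constructor
  · rw [hγ, hγ, abs_of_nonpos (by linarith), abs_of_nonpos (by linarith)]
    field_simp
    ring
  · rw [hγ, hγ, abs_of_nonpos (by linarith), abs_of_nonpos (by linarith)]
    field_simp
    ring

/-- Each segment over [-(N+1), N+1] lies in an apartment. With basis vectors normalized at γ 0,
their coordinates stay in a compact set and a subsequence converges. Orthogonality passes to the
limit by continuity, and the lower bound 1 keeps the limit vectors nonzero. -/
theorem IsGeodesic.exists_isOrth [ProperSpace K] (hn : 2 ≤ finrank K V) {γ : ℝ → Building K V}
    (hγ : IsGeodesic B γ) :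
    ∃ e : Basis (Fin (finrank K V)) K V, ∀ t, IsOrth K (γ t).norm e := by
  obtain ⟨c₀, hc₀⟩ := NormedField.exists_one_lt_norm K
  have step : ∀ N : ℕ, ∃ e : Fin (finrank K V) → V,
      (∀ t : ℝ, |t| ≤ N + 1 → IsOrth K (γ t).norm e) ∧
      ∀ i, 1 ≤ (γ 0).norm (e i) ∧ (γ 0).norm (e i) ≤ ‖c₀‖ := by
    intro N
    have hN : (0 : ℝ) < N + 1 := by positivity
    obtain ⟨e, h1, h2⟩ := exists_common_apartment (γ (-(N + 1))) (γ (N + 1))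
    obtain ⟨a, ha⟩ := IsOrth.exists_normalized (γ 0).isUltraNorm e.ne_zero hc₀
    refine ⟨fun i => a i • e i, fun t ht => ?_, ha⟩
    have h := abs_le.1 ht
    exact ((hγ.divides hN ht).isOrth hn (div_nonneg (by linarith) (by linarith))
      ((div_le_one (by positivity)).2 (by linarith)) h1 h2).smul (γ t).isUltraNorm a
  choose e he1 he2 using step
  obtain ⟨b, hb⟩ := (γ 0).exists_isOrth
  set A : ℕ → Fin (finrank K V) → Fin (finrank K V) → K := fun N i j => b.repr (e N i) j with hA
  have heA : ∀ N i, e N i = ∑ j, A N i j • b j := fun N i => (b.sum_repr _).symm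
  set R : ℝ := ∑ j, ‖c₀‖ / (γ 0).norm (b j) with hR
  have hbpos : ∀ j, 0 < (γ 0).norm (b j) := fun j => (γ 0).isUltraNorm.pos (b.ne_zero j)
  have hterm : ∀ j, 0 ≤ ‖c₀‖ / (γ 0).norm (b j) := fun j => div_nonneg (norm_nonneg _) (hbpos j).le
  have hR0 : 0 ≤ R := Finset.sum_nonneg fun j _ => hterm j
  have hAR : ∀ N, A N ∈ Metric.closedBall (0 : Fin (finrank K V) → Fin (finrank K V) → K) R := by
    intro N
    rw [mem_closedBall_zero_iff, pi_norm_le_iff_of_nonneg hR0]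
    intro i
    rw [pi_norm_le_iff_of_nonneg hR0]
    intro j
    have h1 := (hb.le_repr (e N i) j).trans (he2 N i).2
    rw [← le_div_iff₀ (hbpos j)] at h1
    exact h1.trans (Finset.single_le_sum (f := fun j => ‖c₀‖ / (γ 0).norm (b j))
      (fun j _ => hterm j) (Finset.mem_univ j))
  obtain ⟨a, -, φ, hφ, ha⟩ := (isCompact_closedBall _ R).tendsto_subseq hAR
  set e' : Fin (finrank K V) → V := fun i => ∑ j, a i j • b j with he'
  have hcont : ∀ (t : ℝ) (c : Fin (finrank K V) → K),
      Tendsto (fun N => (γ t).norm (∑ i, c i • e (φ N) i)) atTop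
        (𝓝 ((γ t).norm (∑ i, c i • e' i))) := by
    intro t c
    have h1 : ∀ a : Fin (finrank K V) → Fin (finrank K V) → K,
        ∑ i, c i • ∑ j, a i j • b j = ∑ j, (∑ i, c i * a i j) • b j := by
      intro a
      simp only [Finset.smul_sum, Finset.sum_smul, smul_smul]
      exact Finset.sum_comm
    have h2 : Continuous fun a : Fin (finrank K V) → Fin (finrank K V) → K =>
        fun j => ∑ i, c i * a i j := by fun_prop
    have h3 := ((γ t).isUltraNorm.continuous_sum_smul b).comp h2
    have h4 := (h3.tendsto a).comp ha
    simp only [heA, he', h1]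
    exact h4
  have hcont1 : ∀ (t : ℝ) i,
      Tendsto (fun N => (γ t).norm (e (φ N) i)) atTop (𝓝 ((γ t).norm (e' i))) := by
    intro t i
    have := hcont t (Pi.single i 1)
    simpa [Pi.single_apply, ite_smul] using this
  have horth : ∀ t, IsOrth K (γ t).norm e' := by
    intro t c i
    refine le_of_tendsto_of_tendsto ((hcont1 t i).const_mul ‖c i‖) (hcont t c) ?_
    obtain ⟨N₀, hN₀⟩ := exists_nat_ge |t|
    filter_upwards [eventually_ge_atTop N₀] with N hN
    refine he1 (φ N) t (hN₀.trans ?_) c i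
    have : (N₀ : ℝ) ≤ φ N := by exact_mod_cast hN.trans (hφ.id_le N)
    linarith
  have hne : ∀ i, e' i ≠ 0 := by
    intro i h
    have h1 : 1 ≤ (γ 0).norm (e' i) :=
      ge_of_tendsto (hcont1 0 i) (Eventually.of_forall fun N => (he2 (φ N) i).1)
    rw [h, (γ 0).isUltraNorm.zero] at h1
    linarith
  have : Nonempty (Fin (finrank K V)) := ⟨⟨0, by omega⟩⟩
  refine ⟨basisOfLinearIndependentOfCardEqFinrank
    ((horth 0).linearIndependent (γ 0).isUltraNorm hne) (by simp), fun t => ?_⟩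
  rw [coe_basisOfLinearIndependentOfCardEqFinrank]
  exact horth t

/-- An isometry of ℝ into a strictly convex space is affine. The map `T` forgets only constant
vectors, which do not affect the point. -/
theorem IsGeodesic.exists_eq_mk_of_isOrth (hn : 2 ≤ finrank K V) {γ : ℝ → Building K V}
    (hγ : IsGeodesic B γ) {e : Basis (Fin (finrank K V)) K V}
    (he : ∀ t, IsOrth K (γ t).norm e) : ∃ u z, ∀ t, γ t = mk e (u + t • z) := by
  obtain ⟨T, hT⟩ := B.exists_linearMap hn
  set a : ℝ → Fin (finrank K V) → ℝ := fun t i => Real.log ((γ t).norm (e i)) with ha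
  have hγa : ∀ t, γ t = mk e (a t) := fun t => eq_mk_of_isOrth (he t)
  have hiso : Isometry fun t => T (a t) := Isometry.of_dist_eq fun s t => by
    rw [dist_eq_norm, ← map_sub, ← hT, ← bdist_mk_mk B hn e, ← hγa, ← hγa, hγ, Real.dist_eq]
  have haff : ∀ t, T (a t) = T (a 0) + t • (T (a 1) - T (a 0)) := by
    intro t
    have h := (hiso.affineIsometryOfStrictConvexSpace).toAffineMap.apply_lineMap 0 1 t
    simpa [AffineMap.lineMap_apply, add_comm] using h
  refine ⟨a 0, a 1 - a 0, fun t => ?_⟩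
  have h0 : B.len (a t - (a 0 + t • (a 1 - a 0))) = 0 := by
    rw [hT, map_sub, map_add, map_smul, map_sub, haff t, sub_self, norm_zero]
  obtain ⟨c, hc⟩ := (B.len_eq_zero_iff _).1 h0
  rw [hγa]
  refine mk_congr e (c := c) fun i => ?_
  have := congrFun hc i
  rw [Pi.sub_apply] at this
  linarith

end Apartment

/-! ## Stabilizers of boundary points -/

section Stabilizer

open Building

variable {K : Type*} [NontriviallyNormedField K] [IsUltrametricDist K]
  {V : Type*} [AddCommGroup V] [Module K V] [FiniteDimensional K V]

/-- The metric of the building is equivalent to the logarithmic distance of norms. -/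
theorem exists_bdist_bounds (B : WeylScalarProduct (finrank K V)) (hn : 2 ≤ finrank K V) :
    ∃ C > 0, ∀ (b b' : Basis (Fin (finrank K V)) K V) (u u' : Fin (finrank K V) → ℝ),
      (∀ A A', 0 < A → 0 < A' → (∀ v, basisNorm b' u' v ≤ A * basisNorm b u v) →
        (∀ v, basisNorm b u v ≤ A' * basisNorm b' u' v) →
        bdist B (mk b u) (mk b' u') ≤ C * Real.log (A * A')) ∧
      ∀ v w, basisNorm b' u' v * basisNorm b u w ≤
        Real.exp (C * bdist B (mk b u) (mk b' u')) * (basisNorm b' u' w * basisNorm b u v) := by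
  obtain ⟨C, hC, h⟩ := B.exists_spread_bounds hn
  refine ⟨C, hC, fun b b' u u' => ?_⟩
  obtain ⟨e, hx, hy⟩ := exists_common_apartment (mk b u) (mk b' u')
  obtain ⟨r, hr, hnx⟩ := norm_mk b u
  obtain ⟨r', hr', hny⟩ := norm_mk b' u'
  have hux := isUltraNorm_basisNorm b u
  have huy := isUltraNorm_basisNorm b' u'
  have hx' : IsOrth K (basisNorm b u) e := by
    have : basisNorm b u = fun v => r⁻¹ * (mk b u).norm v := by
      funext v
      rw [hnx, inv_mul_cancel_left₀ hr.ne']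
    rw [this]
    exact hx.const_mul (inv_nonneg.2 hr.le)
  have hy' : IsOrth K (basisNorm b' u') e := by
    have : basisNorm b' u' = fun v => r'⁻¹ * (mk b' u').norm v := by
      funext v
      rw [hny, inv_mul_cancel_left₀ hr'.ne']
    rw [this]
    exact hy.const_mul (inv_nonneg.2 hr'.le)
  set w : Fin (finrank K V) → ℝ := fun i =>
    Real.log (basisNorm b u (e i)) - Real.log (basisNorm b' u' (e i)) with hw
  have hd : bdist B (mk b u) (mk b' u') = B.len w := by
    rw [bdist_eq B hn hx hy]
    refine B.len_congr (c := Real.log r - Real.log r') fun i => ?_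
    rw [hnx, hny, Real.log_mul hr.ne' (hux.pos (e.ne_zero i)).ne',
      Real.log_mul hr'.ne' (huy.pos (e.ne_zero i)).ne', hw]
    ring
  rw [hd]
  constructor
  · intro A A' hA hA' h1 h2
    refine (h w).2 _ fun i j => ?_
    have hi := Real.log_le_log (hux.pos (e.ne_zero i)) (h2 (e i))
    have hj := Real.log_le_log (huy.pos (e.ne_zero j)) (h1 (e j))
    rw [Real.log_mul hA'.ne' (huy.pos (e.ne_zero i)).ne'] at hi
    rw [Real.log_mul hA.ne' (hux.pos (e.ne_zero j)).ne'] at hj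
    rw [Real.log_mul hA.ne' hA'.ne']
    simp only [hw]
    linarith
  · intro v v'
    have : Nonempty (Fin (finrank K V)) := ⟨⟨0, by omega⟩⟩
    obtain ⟨j, hj⟩ := Finite.exists_min w
    obtain ⟨i, hi⟩ := Finite.exists_max w
    have hexp : ∀ k, basisNorm b u (e k) = Real.exp (w k) * basisNorm b' u' (e k) := by
      intro k
      rw [hw, Real.exp_sub, Real.exp_log (hux.pos (e.ne_zero k)),
        Real.exp_log (huy.pos (e.ne_zero k)), div_mul_cancel₀ _ (huy.pos (e.ne_zero k)).ne']
    have h1 : basisNorm b u v' ≤ Real.exp (w i) * basisNorm b' u' v' :=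
      hy'.le_mul huy hux (Real.exp_pos _).le (fun k => by
        rw [hexp]
        exact mul_le_mul_of_nonneg_right (Real.exp_le_exp.2 (hi k)) (huy.nonneg _)) v'
    have h2 : basisNorm b' u' v ≤ Real.exp (-w j) * basisNorm b u v :=
      hx'.le_mul hux huy (Real.exp_pos _).le (fun k => by
        rw [hexp, ← mul_assoc, ← Real.exp_add]
        refine le_mul_of_one_le_left (huy.nonneg _) (Real.one_le_exp ?_)
        linarith [hj k]) v
    calc basisNorm b' u' v * basisNorm b u v'
        ≤ (Real.exp (-w j) * basisNorm b u v) * (Real.exp (w i) * basisNorm b' u' v') :=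
          mul_le_mul h2 h1 (hux.nonneg _) (mul_nonneg (Real.exp_pos _).le (hux.nonneg _))
      _ = Real.exp (w i - w j) * (basisNorm b' u' v' * basisNorm b u v) := by
          rw [sub_eq_add_neg, Real.exp_add]
          ring
      _ ≤ _ := mul_le_mul_of_nonneg_right (Real.exp_le_exp.2 ((h w).1 i j))
          (mul_nonneg (huy.nonneg _) (hux.nonneg _))

variable {B : WeylScalarProduct (finrank K V)}

theorem smul_endpoint_eq_iff (hn : 2 ≤ finrank K V) (g : V ≃ₗ[K] V) (c : HalfGeodesic B) :
    g • c.endpoint = c.endpoint ↔ Asymptotic B (c.act g) c :=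
  endpoint_eq_iff hn (c := c.act g) (c' := c)

variable {e : Basis (Fin (finrank K V)) K V} {u z : Fin (finrank K V) → ℝ}

/-- Along the ray the entry of `g` from `e i` to `e j` is weighted by exp(t (z j - z i)), which
stays bounded for t ≥ 0 exactly when z j ≤ z i. The other entries vanish by hypothesis. -/
theorem exists_basisNorm_ray_le (g : V ≃ₗ[K] V)
    (hg : ∀ i j, z i < z j → e.repr (g (e i)) j = 0) :
    ∃ A : ℝ, 0 < A ∧ ∀ t : ℝ, 0 ≤ t → ∀ v,
      basisNorm e (u + t • z) (g v) ≤ A * basisNorm e (u + t • z) v := by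
  set a : Fin (finrank K V) → Fin (finrank K V) → ℝ :=
    fun i j => ‖e.repr (g (e i)) j‖ * Real.exp (u j - u i) with ha
  have ha0 : ∀ i j, 0 ≤ a i j := fun i j => by positivity
  have hsum : 0 ≤ ∑ i, ∑ j, a i j := Finset.sum_nonneg fun i _ => Finset.sum_nonneg fun j _ => ha0 i j
  refine ⟨∑ i, ∑ j, a i j + 1, by linarith, fun t ht v => ?_⟩
  have hu := isUltraNorm_basisNorm e (u + t • z)
  refine (isOrth_basisNorm e (u + t • z)).le_mul hu (hu.comp_equiv g) (by linarith)
    (fun i => ?_) v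
  rw [basisNorm_self]
  refine basisNorm_le _ _ _ (by positivity) fun j => ?_
  by_cases hij : z i < z j
  · rw [hg i j hij, norm_zero, zero_mul]
    positivity
  have h1 : ‖e.repr (g (e i)) j‖ * Real.exp ((u + t • z) j) ≤
      a i j * Real.exp ((u + t • z) i) := by
    rw [ha, mul_assoc, ← Real.exp_add]
    refine mul_le_mul_of_nonneg_left (Real.exp_le_exp.2 ?_) (norm_nonneg _)
    simp only [Pi.add_apply, Pi.smul_apply, smul_eq_mul]
    have := mul_le_mul_of_nonneg_left (not_lt.1 hij) ht
    linarith
  refine h1.trans (mul_le_mul_of_nonneg_right ?_ (Real.exp_pos _).le)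
  have h2 := (Finset.single_le_sum (f := fun j => a i j) (fun j _ => ha0 i j)
        (Finset.mem_univ j)).trans (Finset.single_le_sum (f := fun i => ∑ j, a i j)
          (fun i _ => Finset.sum_nonneg fun j _ => ha0 i j) (Finset.mem_univ i))
  exact h2.trans (by linarith)

theorem smul_endpoint_eq_of_repr (hn : 2 ≤ finrank K V) {c : HalfGeodesic B}
    (hc : ∀ t : NNReal, c.1 t = mk e (u + (t : ℝ) • z)) (g : V ≃ₗ[K] V)
    (hg : ∀ i j, z i < z j → e.repr (g (e i)) j = 0)
    (hg' : ∀ i j, z i < z j → e.repr (g.symm (e i)) j = 0) : g • c.endpoint = c.endpoint := by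
  rw [smul_endpoint_eq_iff hn]
  obtain ⟨C, hC, h⟩ := exists_bdist_bounds B hn
  obtain ⟨A, hA, h1⟩ := exists_basisNorm_ray_le (u := u) g hg
  obtain ⟨A', hA', h2⟩ := exists_basisNorm_ray_le (u := u) g.symm hg'
  refine ⟨C * Real.log (A * A'), fun t => ?_⟩
  change bdist B (g • c.1 t) (c.1 t) ≤ _
  rw [hc, smul_mk]
  refine (h (e.map g) e _ _).1 A A' hA hA' (fun v => ?_) fun v => ?_
  · rw [basisNorm_map]
    simpa using h1 t t.2 (g.symm v)
  · rw [basisNorm_map]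
    exact h2 t t.2 v

/-- A nonzero entry would make the distortion at `e i`, relative to that at a reference vector, grow
like exp(t (z j - z i)), although the displacement of the ray is bounded. The reference `e m` has
maximal `z`, so the norm of g (e m) grows at most like that of `e m`. -/
theorem repr_eq_zero_of_smul_endpoint_eq (hn : 2 ≤ finrank K V) {c : HalfGeodesic B}
    (hc : ∀ t : NNReal, c.1 t = mk e (u + (t : ℝ) • z)) (g : V ≃ₗ[K] V)
    (hg : g • c.endpoint = c.endpoint) (i j : Fin (finrank K V)) (hij : z i < z j) :
    e.repr (g (e i)) j = 0 := by
  by_contra hne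
  rw [smul_endpoint_eq_iff hn] at hg
  obtain ⟨D, hD⟩ := hg
  obtain ⟨C, hC, h⟩ := exists_bdist_bounds B hn
  have : Nonempty (Fin (finrank K V)) := ⟨i⟩
  obtain ⟨m, hm⟩ := Finite.exists_max z
  set a := ‖e.repr (g (e i)) j‖ with ha
  have ha0 : 0 < a := norm_pos_iff.2 hne
  set A := basisNorm e u (g (e m)) with hA
  have hA0 : 0 < A := (isUltraNorm_basisNorm e u).pos (by simpa using e.ne_zero m)
  have key : ∀ t : NNReal, Real.exp (u m) * a * Real.exp (u j) * Real.exp (t * (z j - z i)) ≤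
      Real.exp (C * D) * (Real.exp (u i) * A) := by
    intro t
    have hd := hD t
    change bdist B (g • c.1 t) (c.1 t) ≤ _ at hd
    rw [bdist_comm B hn, hc, smul_mk] at hd
    have h1 := (h e (e.map g) (u + (t : ℝ) • z) (u + (t : ℝ) • z)).2 (g (e m)) (g (e i))
    rw [basisNorm_map, basisNorm_map, g.symm_apply_apply, g.symm_apply_apply, basisNorm_self,
      basisNorm_self] at h1
    have h2 : a * Real.exp (u j + t * z j) ≤ basisNorm e (u + (t : ℝ) • z) (g (e i)) :=
      le_basisNorm e (u + (t : ℝ) • z) (g (e i)) j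
    have h3 : basisNorm e (u + (t : ℝ) • z) (g (e m)) ≤ A * Real.exp (t * z m) := by
      refine basisNorm_le _ _ _ (by positivity) fun k => ?_
      have := le_basisNorm e u (g (e m)) k
      simp only [Pi.add_apply, Pi.smul_apply, smul_eq_mul, Real.exp_add]
      rw [← mul_assoc]
      exact mul_le_mul this (Real.exp_le_exp.2 (mul_le_mul_of_nonneg_left (hm k) t.2))
        (Real.exp_pos _).le hA0.le
    have h4 : Real.exp (C * bdist B (mk e (u + (t : ℝ) • z)) (mk (e.map g) (u + (t : ℝ) • z))) ≤
        Real.exp (C * D) := Real.exp_le_exp.2 (mul_le_mul_of_nonneg_left hd hC.le)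
    have h5 : Real.exp (u m + t * z m) * (a * Real.exp (u j + t * z j)) ≤
        Real.exp (C * D) * (Real.exp (u i + t * z i) * (A * Real.exp (t * z m))) := by
      refine (mul_le_mul_of_nonneg_left h2 (Real.exp_pos _).le).trans (h1.trans ?_)
      refine mul_le_mul h4 (mul_le_mul_of_nonneg_left h3 (Real.exp_pos _).le) ?_
        (Real.exp_pos _).le
      exact mul_nonneg (Real.exp_pos _).le (basisNorm_nonneg _ _ _)
    have h6 : 0 < Real.exp (t * z m) * Real.exp (t * z i) := by positivity
    refine le_of_mul_le_mul_right ?_ h6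
    rw [mul_sub, Real.exp_sub]
    rw [Real.exp_add, Real.exp_add, Real.exp_add] at h5
    calc _ = Real.exp (u m) * Real.exp (t * z m) * (a * (Real.exp (u j) * Real.exp (t * z j))) := by
          field_simp
      _ ≤ _ := h5
      _ = _ := by ring
  have hlim : Tendsto (fun t : NNReal => Real.exp (u m) * a * Real.exp (u j) *
      Real.exp (t * (z j - z i))) atTop atTop := by
    refine Tendsto.const_mul_atTop (by positivity) (Real.tendsto_exp_atTop.comp ?_)
    exact (NNReal.tendsto_coe_atTop.2 tendsto_id).atTop_mul_const (by linarith)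
  obtain ⟨t, ht⟩ := (hlim.eventually_gt_atTop (Real.exp (C * D) * (Real.exp (u i) * A))).exists
  exact absurd (key t) ht.not_ge

theorem mem_span_image_iff_repr (e : Basis (Fin (finrank K V)) K V) (I : Set (Fin (finrank K V)))
    (x : V) : x ∈ Submodule.span K (e '' I) ↔ ∀ j, j ∉ I → e.repr x j = 0 := by
  rw [Basis.mem_span_image]
  constructor
  · intro h j hj
    by_contra hne
    exact hj (h (Finsupp.mem_support_iff.2 hne))
  · intro h j hj
    by_contra hne
    exact (Finsupp.mem_support_iff.1 hj) (h j hne)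

theorem map_eq_self_of_le (W : Submodule K V) (g : V ≃ₗ[K] V)
    (h : W.map (g : V →ₗ[K] V) ≤ W) : W.map (g : V →ₗ[K] V) = W :=
  Submodule.eq_of_le_of_finrank_eq h (LinearEquiv.finrank_map_eq g W)

theorem map_symm_eq_self {W : Submodule K V} {g : V ≃ₗ[K] V}
    (h : W.map (g : V →ₗ[K] V) = W) : W.map (g.symm : V →ₗ[K] V) = W := by
  conv_lhs => rw [← h]
  rw [← Submodule.map_comp]
  simp

theorem isBoundaryVertexOf_endpoint (hn : 2 ≤ finrank K V) {c : HalfGeodesic B}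
    (hc : ∀ t : NNReal, c.1 t = mk e (u + (t : ℝ) • z)) (I : Set (Fin (finrank K V)))
    (hz : ∀ i j, z i < z j ↔ i ∈ I ∧ j ∉ I) :
    IsBoundaryVertexOf (Submodule.span K (e '' I)) c.endpoint := by
  intro g
  have hrepr : ∀ g : V ≃ₗ[K] V, (Submodule.span K (e '' I)).map (g : V →ₗ[K] V) =
      Submodule.span K (e '' I) → ∀ i j, z i < z j → e.repr (g (e i)) j = 0 := by
    intro g hg i j hij
    have h1 : g (e i) ∈ (Submodule.span K (e '' I)).map (g : V →ₗ[K] V) :=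
      Submodule.mem_map_of_mem (f := (g : V →ₗ[K] V))
        (Submodule.subset_span ⟨i, ((hz i j).1 hij).1, rfl⟩)
    rw [hg, mem_span_image_iff_repr] at h1
    exact h1 j ((hz i j).1 hij).2
  constructor
  · intro hg
    refine map_eq_self_of_le _ g ?_
    rw [Submodule.map_span, Submodule.span_le]
    rintro _ ⟨_, ⟨i, hi, rfl⟩, rfl⟩
    refine (mem_span_image_iff_repr e I _).2 fun j hj => ?_
    exact repr_eq_zero_of_smul_endpoint_eq hn hc g hg i j ((hz i j).2 ⟨hi, hj⟩)
  · intro hg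
    exact smul_endpoint_eq_of_repr hn hc g (hrepr g hg) (hrepr g.symm (map_symm_eq_self hg))

/-- The map `x ↦ x + a xᵢ eⱼ`. -/
theorem exists_elementary (e : Basis (Fin (finrank K V)) K V) (i j : Fin (finrank K V)) (a : K)
    (ha : i = j → 1 + a ≠ 0) : ∃ (g : V ≃ₗ[K] V) (a' : K),
      (∀ x, g x = x + (a * e.repr x i) • e j) ∧ ∀ x, g.symm x = x + (a' * e.repr x i) • e j := by
  obtain ⟨a', h1, h2⟩ : ∃ a' : K, a + a' + a * a' * e.repr (e j) i = 0 ∧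
      a' + a + a' * a * e.repr (e j) i = 0 := by
    by_cases hij : i = j
    · have h := ha hij
      refine ⟨-a / (1 + a), ?_, ?_⟩ <;> · subst hij; simp; field_simp; ring
    · refine ⟨-a, ?_, ?_⟩ <;> simp [Ne.symm hij]
  refine ⟨LinearEquiv.ofLinearMap (LinearMap.id + (a • e.coord i).smulRight (e j))
    (LinearMap.id + (a' • e.coord i).smulRight (e j)) ?_ ?_, a', fun x => rfl, fun x => rfl⟩
  · ext x
    have : (LinearMap.id + (a • e.coord i).smulRight (e j) : V →ₗ[K] V)
      ((LinearMap.id + (a' • e.coord i).smulRight (e j) : V →ₗ[K] V) x) =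
        x + ((a + a' + a * a' * e.repr (e j) i) * e.repr x i) • e j := by
      simp only [LinearMap.add_apply, LinearMap.id_apply, LinearMap.smulRight_apply,
        LinearMap.smul_apply, Basis.coord_apply, smul_eq_mul, map_add, map_smul]
      module
    rw [LinearMap.comp_apply, this, h1]
    simp
  · ext x
    have : (LinearMap.id + (a' • e.coord i).smulRight (e j) : V →ₗ[K] V)
      ((LinearMap.id + (a • e.coord i).smulRight (e j) : V →ₗ[K] V) x) =
        x + ((a' + a + a' * a * e.repr (e j) i) * e.repr x i) • e j := by
      simp only [LinearMap.add_apply, LinearMap.id_apply, LinearMap.smulRight_apply,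
        LinearMap.smul_apply, Basis.coord_apply, smul_eq_mul, map_add, map_smul]
      module
    rw [LinearMap.comp_apply, this, h2]
    simp

/-- The stabilizer of the endpoint contains the diagonal maps, so W is a coordinate subspace. The
elementary map e i ↦ e i + e j, i ≠ j, fixes the endpoint iff not z i < z j, and preserves W unless
e i ∈ W and e j ∉ W; equality of stabilizers gives the criterion. -/
theorem eq_span_of_isBoundaryVertexOf (hn : 2 ≤ finrank K V) {c : HalfGeodesic B}
    (hc : ∀ t : NNReal, c.1 t = mk e (u + (t : ℝ) • z)) {W : Submodule K V}
    (hW : IsBoundaryVertexOf W c.endpoint) :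
    ∃ I : Set (Fin (finrank K V)), W = Submodule.span K (e '' I) ∧
      ∀ i j, z i < z j ↔ i ∈ I ∧ j ∉ I := by
  have hrepr : ∀ (a : K) (i j k l : Fin (finrank K V)), ¬ z i < z j → z k < z l →
      e.repr (e k + (a * e.repr (e k) i) • e j) l = 0 := by
    intro a i j k l hij hkl
    have hkl' : k ≠ l := by
      rintro rfl
      exact lt_irrefl _ hkl
    simp only [map_add, map_smul, Finsupp.add_apply, Finsupp.smul_apply, Basis.repr_self,
      Finsupp.single_apply, smul_eq_mul]
    by_cases h1 : k = i
    · by_cases h2 : j = l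
      · subst h1 h2
        exact absurd hkl hij
      · simp [hkl', h2]
    · simp [hkl', h1]
  have hfix : ∀ (a : K) (i j : Fin (finrank K V)), (i = j → 1 + a ≠ 0) → ¬ z i < z j →
      ∀ x ∈ W, x + (a * e.repr x i) • e j ∈ W := by
    intro a i j ha hij x hx
    obtain ⟨g, a', hg, hg'⟩ := exists_elementary e i j a ha
    have h1 : g • c.endpoint = c.endpoint := by
      refine smul_endpoint_eq_of_repr hn hc g (fun k l hkl => ?_) fun k l hkl => ?_
      · rw [hg]
        exact hrepr a i j k l hij hkl
      · rw [hg']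
        exact hrepr a' i j k l hij hkl
    have h2 := (hW g).1 h1
    rw [← hg, ← h2]
    exact Submodule.mem_map_of_mem (f := (g : V →ₗ[K] V)) hx
  obtain ⟨a, ha⟩ := NormedField.exists_one_lt_norm K
  have ha0 : a ≠ 0 := norm_pos_iff.1 (one_pos.trans ha)
  have hcoord : ∀ x ∈ W, ∀ i, e.repr x i ≠ 0 → e i ∈ W := by
    intro x hx i hi
    have ha1 : a - 1 ≠ 0 := by
      intro h
      rw [sub_eq_zero.1 h, norm_one] at ha
      exact lt_irrefl _ ha
    -- Scaling the i-th coordinate by a ≠ 0, 1 preserves W; subtracting `x` isolates a nonzero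
    -- multiple of `e i`.
    have h1 := hfix (a - 1) i i (fun _ => by rwa [add_sub_cancel]) (lt_irrefl _) x hx
    have h2 := Submodule.sub_mem _ h1 hx
    rw [add_sub_cancel_left] at h2
    exact (Submodule.smul_mem_iff _ (mul_ne_zero ha1 hi)).1 h2
  have hWI : W = Submodule.span K (e '' {i | e i ∈ W}) := by
    refine le_antisymm (fun x hx => ?_) ?_
    · rw [mem_span_image_iff_repr]
      intro j hj
      by_contra hne
      exact hj (hcoord x hx j hne)
    · rw [Submodule.span_le]
      rintro _ ⟨i, hi, rfl⟩
      exact hi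
  refine ⟨{i | e i ∈ W}, hWI, fun i j => ⟨fun hij => ?_, fun hij => ?_⟩⟩
  · have hne : i ≠ j := by
      rintro rfl
      exact lt_irrefl _ hij
    by_contra hcon
    obtain ⟨g, -, hg, -⟩ := exists_elementary e i j 1 (fun h => absurd h hne)
    have hle : W.map (g : V →ₗ[K] V) ≤ W := by
      rintro _ ⟨x, hx, rfl⟩
      change g x ∈ W
      rw [hg]
      refine Submodule.add_mem _ hx ?_
      by_cases hx0 : e.repr x i = 0
      · simp [hx0]
      · refine Submodule.smul_mem _ _ ?_
        by_contra hj
        exact hcon ⟨hcoord x hx i hx0, hj⟩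
    have h1 := (hW g).2 (map_eq_self_of_le W g hle)
    have h2 := repr_eq_zero_of_smul_endpoint_eq hn hc g h1 i j hij
    rw [hg] at h2
    simp [hne] at h2
  · by_contra hlt
    have hne : i ≠ j := by
      rintro rfl
      exact hij.2 hij.1
    have h1 := hfix 1 i j (fun h => absurd h hne) hlt (e i) hij.1
    have h2 := Submodule.sub_mem _ h1 hij.1
    rw [add_sub_cancel_left] at h2
    exact hij.2 (by simpa using h2)

end Stabilizer

/-! ## Lattices and vertices -/

section Lattice

open Building

variable {K : Type*} [NontriviallyNormedField K] [IsUltrametricDist K]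
  {V : Type*} [AddCommGroup V] [Module K V]

theorem norm_uniformizer_lt_one {ϖ : Valued.integer K} (hϖ : Irreducible ϖ) : ‖(ϖ : K)‖ < 1 :=
  Valued.integer.norm_irreducible_lt_one hϖ

theorem norm_uniformizer_pos {ϖ : Valued.integer K} (hϖ : Irreducible ϖ) : 0 < ‖(ϖ : K)‖ :=
  Valued.integer.norm_irreducible_pos hϖ

theorem uniformizer_ne_zero {ϖ : Valued.integer K} (hϖ : Irreducible ϖ) : (ϖ : K) ≠ 0 :=
  norm_pos_iff.1 (norm_uniformizer_pos hϖ)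

/-- If ‖y‖ lay strictly between consecutive powers of ‖ϖ‖, then `ϖ` would factor into two elements
of norm less than 1. Irreducibility alone thus makes the valuation discrete. -/
theorem exists_norm_eq_zpow {ϖ : Valued.integer K} (hϖ : Irreducible ϖ) {y : K} (hy : y ≠ 0) :
    ∃ k : ℤ, ‖y‖ = ‖(ϖ : K)‖ ^ k := by
  have h0 := norm_uniformizer_pos hϖ
  have h1 := norm_uniformizer_lt_one hϖ
  have hne := uniformizer_ne_zero hϖ
  obtain ⟨k, hk, hk'⟩ := exists_mem_Ico_zpow (norm_pos_iff.2 hy) (one_lt_inv_iff₀.2 ⟨h0, h1⟩)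
  refine ⟨-k, ?_⟩
  rw [inv_zpow'] at hk hk'
  by_contra hcon
  have hlt : ‖(ϖ : K)‖ ^ (-k) < ‖y‖ := lt_of_le_of_ne hk (Ne.symm hcon)
  have hpos : 0 < ‖(ϖ : K)‖ ^ (-k) := zpow_pos h0 _
  set x : K := (ϖ : K) ^ (-k) / y with hx
  have hxn : ‖x‖ < 1 := by
    rw [hx, norm_div, norm_zpow, div_lt_one (norm_pos_iff.2 hy)]
    exact hlt
  have hx0 : x ≠ 0 := div_ne_zero (zpow_ne_zero _ hne) hy
  have hxn' : ‖(ϖ : K) / x‖ < 1 := by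
    have : (ϖ : K) / x = y * (ϖ : K) ^ (k + 1) := by
      rw [hx, zpow_neg, zpow_add_one₀ hne]
      field_simp
    rw [this, norm_mul, norm_zpow]
    have h3 : ‖(ϖ : K)‖ ^ (k + 1) * ‖(ϖ : K)‖ ^ (-(k + 1)) = 1 := by
      rw [← zpow_add₀ h0.ne', add_neg_cancel, zpow_zero]
    have hpos' : 0 < ‖(ϖ : K)‖ ^ (k + 1) := zpow_pos h0 _
    calc ‖y‖ * ‖(ϖ : K)‖ ^ (k + 1) < ‖(ϖ : K)‖ ^ (-(k + 1)) * ‖(ϖ : K)‖ ^ (k + 1) :=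
          mul_lt_mul_of_pos_right hk' hpos'
      _ = 1 := by rw [mul_comm, h3]
  have hfac : ϖ = (⟨x, Valued.integer.mem_iff.2 hxn.le⟩ : Valued.integer K) *
      ⟨(ϖ : K) / x, Valued.integer.mem_iff.2 hxn'.le⟩ := by
    ext
    change (ϖ : K) = x * ((ϖ : K) / x)
    rw [mul_div_cancel₀ _ hx0]
  rcases hϖ.isUnit_or_isUnit hfac with h | h
  · exact hxn.ne (Valued.integer.isUnit_iff_norm_eq_one.1 h)
  · exact hxn'.ne (Valued.integer.isUnit_iff_norm_eq_one.1 h)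

theorem isPrincipalIdealRing_integer {ϖ : Valued.integer K} (hϖ : Irreducible ϖ) :
    IsPrincipalIdealRing (Valued.integer K) := by
  have h : IsDiscreteValuationRing (Valued.integer K) := by
    refine IsDiscreteValuationRing.ofHasUnitMulPowIrreducibleFactorization ⟨ϖ, hϖ, fun {x} hx => ?_⟩
    have hx0 : (x : K) ≠ 0 := fun h => hx (Subtype.ext h)
    obtain ⟨k, hk⟩ := exists_norm_eq_zpow hϖ hx0
    have h0 := norm_uniformizer_pos hϖ
    have hk0 : 0 ≤ k := by
      by_contra hneg
      have h1 : ‖(x : K)‖ ≤ 1 := Valued.integer.norm_le_one x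
      rw [hk] at h1
      have := one_lt_zpow_of_neg₀ h0 (norm_uniformizer_lt_one hϖ) (not_le.1 hneg)
      exact absurd h1 this.not_ge
    lift k to ℕ using hk0
    rw [zpow_natCast] at hk
    have hn : ‖(x : K) / (ϖ : K) ^ k‖ = 1 := by
      rw [norm_div, norm_pow, hk, div_self (pow_ne_zero _ h0.ne')]
    have hu : IsUnit (⟨(x : K) / (ϖ : K) ^ k, Valued.integer.mem_iff.2 hn.le⟩ : Valued.integer K) :=
      Valued.integer.isUnit_iff_norm_eq_one.2 hn
    refine ⟨k, hu.unit, ?_⟩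
    ext
    change (ϖ : K) ^ k * ((x : K) / (ϖ : K) ^ k) = x
    rw [mul_div_cancel₀ _ (pow_ne_zero _ (uniformizer_ne_zero hϖ))]
  infer_instance

theorem IsLatticeIn.exists_basis {ϖ : Valued.integer K} (hϖ : Irreducible ϖ) {W : Submodule K V}
    {M : Submodule (Valued.integer K) V} (hM : IsLatticeIn W M) :
    ∃ (r : ℕ) (x : Fin r → V), LinearIndependent K x ∧ Submodule.span K (Set.range x) = W ∧
      Submodule.span (Valued.integer K) (Set.range x) = M := by
  have := isPrincipalIdealRing_integer hϖ
  have : IsTorsionFree (Valued.integer K) V :=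
    Module.IsTorsionFree.trans_faithfulSMul (Valued.integer K) K V
  have : Module.Finite (Valued.integer K) M := Module.Finite.iff_fg.2 hM.1
  have hfree : Module.Free (Valued.integer K) M := inferInstance
  set b := Module.finBasis (Valued.integer K) M with hb
  have hspan : Submodule.span (Valued.integer K) (Set.range fun i => (b i : V)) = M := by
    have h1 : (Set.range fun i => (b i : V)) = M.subtype '' Set.range b := by
      rw [← Set.range_comp]
      rfl
    rw [h1, ← Submodule.map_span, b.span_eq, Submodule.map_top, Submodule.range_subtype]
  refine ⟨_, fun i => (b i : V), ?_, ?_, hspan⟩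
  · have h1 : LinearIndependent (Valued.integer K) fun i => (b i : V) :=
      b.linearIndependent.map' M.subtype M.ker_subtype
    exact (LinearIndependent.iff_fractionRing (Valued.integer K) K).1 h1
  · rw [← hM.2, ← Submodule.span_span_of_tower (Valued.integer K) K, hspan]

theorem mem_span_range_iff_norm {ι : Type*} (b : Basis ι K V) (x : V) :
    x ∈ Submodule.span (Valued.integer K) (Set.range b) ↔ ∀ i, ‖b.repr x i‖ ≤ 1 := by
  rw [Basis.mem_span_iff_repr_mem]
  refine forall_congr' fun i => ?_
  constructor
  · rintro ⟨a, ha⟩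
    rw [← ha]
    exact Valued.integer.norm_le_one a
  · intro h
    exact ⟨⟨_, Valued.integer.mem_iff.2 h⟩, rfl⟩

theorem mem_span_range_iff_basisNorm (b : Basis (Fin (finrank K V)) K V) (x : V) :
    x ∈ Submodule.span (Valued.integer K) (Set.range b) ↔ basisNorm b 0 x ≤ 1 := by
  rw [mem_span_range_iff_norm]
  constructor
  · intro h
    exact basisNorm_le _ _ _ zero_le_one fun i => by simpa using h i
  · intro h i
    have := (le_basisNorm b 0 x i).trans h
    simpa using this

/-- Norms giving vertices take values in the value group of K. This recovers the norm from its unit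
ball and singles out the vertices on a line. -/
theorem exists_basisNorm_zero_eq (b : Basis (Fin (finrank K V)) K V) {x : V} (hx : x ≠ 0) :
    ∃ c : K, c ≠ 0 ∧ basisNorm b 0 x = ‖c‖ := by
  have hne : Nonempty (Fin (finrank K V)) := by
    by_contra h
    rw [not_nonempty_iff] at h
    apply hx
    rw [← b.sum_repr x, Finset.univ_eq_empty, Finset.sum_empty]
  obtain ⟨i, hi⟩ := Finite.exists_max fun i => ‖b.repr x i‖
  have h : basisNorm b 0 x = ‖b.repr x i‖ := by
    refine le_antisymm (basisNorm_le _ _ _ (norm_nonneg _) fun j => by simpa using hi j) ?_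
    simpa using le_basisNorm b 0 x i
  refine ⟨_, ?_, h⟩
  rw [← norm_pos_iff, ← h]
  exact (isUltraNorm_basisNorm b 0).pos hx

theorem mem_smul_iff {c : K} (hc : c ≠ 0) (M : Submodule (Valued.integer K) V) (x : V) :
    x ∈ c • M ↔ c⁻¹ • x ∈ M := by
  constructor
  · rintro ⟨y, hy, rfl⟩
    change c⁻¹ • c • y ∈ M
    rwa [inv_smul_smul₀ hc]
  · intro h
    exact ⟨_, h, smul_inv_smul₀ hc x⟩

theorem IsVertexOf.eq {M : Submodule (Valued.integer K) V} {x y : Building K V}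
    (hx : IsVertexOf M x) (hy : IsVertexOf M y) : x = y := by
  obtain ⟨b, hb, rfl⟩ := hx
  obtain ⟨b', hb', rfl⟩ := hy
  have key : ∀ b b' : Basis (Fin (finrank K V)) K V,
      M = Submodule.span (Valued.integer K) (Set.range b) →
      M = Submodule.span (Valued.integer K) (Set.range b') → ∀ v,
      basisNorm b' 0 v ≤ basisNorm b 0 v := by
    intro b b' hb hb' v
    have hu := isUltraNorm_basisNorm b 0
    have hu' := isUltraNorm_basisNorm b' 0
    by_cases hv : v = 0
    · rw [hv, hu.zero, hu'.zero]
    obtain ⟨c, hc, hcv⟩ := exists_basisNorm_zero_eq b hv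
    have hcn := norm_pos_iff.2 hc
    have h1 : c⁻¹ • v ∈ M := by
      rw [hb, mem_span_range_iff_basisNorm, hu.smul, hcv, norm_inv, inv_mul_cancel₀ hcn.ne']
    rw [hb', mem_span_range_iff_basisNorm, hu'.smul, norm_inv, inv_mul_le_iff₀ hcn, mul_one] at h1
    rwa [hcv]
  rw [mk_eq_mk_iff]
  exact ⟨1, one_pos, fun v => by
    rw [one_mul]
    exact le_antisymm (key b b' hb hb' v) (key b' b hb' hb v)⟩

theorem IsVertexOf.homothetic (hn : 0 < finrank K V) {M N : Submodule (Valued.integer K) V}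
    {x : Building K V} (hM : IsVertexOf M x) (hN : IsVertexOf N x) : Homothetic M N := by
  obtain ⟨b, rfl, rfl⟩ := hM
  obtain ⟨b', rfl, h⟩ := hN
  obtain ⟨r, hr, hrb⟩ := mk_eq_mk_iff.1 h
  have hu := isUltraNorm_basisNorm b 0
  obtain ⟨c, hc, hcb⟩ := exists_basisNorm_zero_eq b (b'.ne_zero ⟨0, hn⟩)
  have h1 := hrb (b' ⟨0, hn⟩)
  rw [basisNorm_self, hcb] at h1
  simp only [Pi.zero_apply, Real.exp_zero] at h1
  have hcn := norm_pos_iff.2 hc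
  have hrc : r = ‖c‖⁻¹ := eq_inv_of_mul_eq_one_left h1.symm
  refine ⟨c, hc, ?_⟩
  ext v
  rw [mem_smul_iff hc, mem_span_range_iff_basisNorm, mem_span_range_iff_basisNorm, hrb, hu.smul,
    norm_inv, hrc]

theorem mk_unitsSMul (e : Basis (Fin (finrank K V)) K V) (w : Fin (finrank K V) → Kˣ)
    (u : Fin (finrank K V) → ℝ) :
    mk (e.unitsSMul w) u = mk e fun i => u i - Real.log ‖(w i : K)‖ := by
  rw [mk_eq_mk_iff]
  refine ⟨1, one_pos, fun x => ?_⟩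
  rw [one_mul]
  simp only [basisNorm]
  congr 1
  ext i
  have hw : 0 < ‖(w i : K)‖ := norm_pos_iff.2 (w i).ne_zero
  rw [Basis.repr_unitsSMul, Real.exp_sub, Real.exp_log hw, Units.smul_def, smul_eq_mul, norm_mul,
    Units.val_inv_eq_inv_val, norm_inv]
  field_simp

theorem IsVertexOf.smul {M : Submodule (Valued.integer K) V} {x : Building K V}
    (h : IsVertexOf M x) {c : K} (hc : c ≠ 0) : IsVertexOf (c • M) x := by
  obtain ⟨b, rfl, rfl⟩ := h
  refine ⟨b.unitsSMul fun _ => Units.mk0 c hc, ?_, ?_⟩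
  · ext v
    rw [mem_smul_iff hc, mem_span_range_iff_norm, mem_span_range_iff_norm]
    refine forall_congr' fun i => ?_
    rw [Basis.repr_unitsSMul, map_smul, Finsupp.smul_apply, Units.smul_def,
      Units.val_inv_eq_inv_val, Units.val_mk0]
  · rw [mk_unitsSMul]
    exact mk_congr b (c := Real.log ‖c‖) fun i => by simp

theorem IsVertexOf.of_homothetic {M N : Submodule (Valued.integer K) V} {x : Building K V}
    (h : IsVertexOf M x) (hMN : Homothetic M N) : IsVertexOf N x := by
  obtain ⟨c, hc, rfl⟩ := hMN
  exact h.smul hc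

theorem smul_eq_self_of_norm_eq_one {c : K} (hc : ‖c‖ = 1) (M : Submodule (Valued.integer K) V) :
    c • M = M := by
  have h : ∀ {c : K}, ‖c‖ = 1 → ∀ x ∈ M, c • x ∈ M := fun {c} hc x hx =>
    M.smul_mem (⟨c, Valued.integer.mem_iff.2 hc.le⟩ : Valued.integer K) hx
  have hc0 : c ≠ 0 := norm_ne_zero_iff.1 (by rw [hc]; exact one_ne_zero)
  ext x
  rw [mem_smul_iff hc0]
  constructor
  · intro hx
    simpa [smul_smul, hc0] using h hc _ hx
  · exact h (by rw [norm_inv, hc, inv_one]) x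

theorem IsLatticeIn.le {W : Submodule K V} {M : Submodule (Valued.integer K) V}
    (h : IsLatticeIn W M) {x : V} (hx : x ∈ M) : x ∈ W := by
  rw [← h.2]
  exact Submodule.subset_span hx

theorem IsLatticeIn.smul {W : Submodule K V} {M : Submodule (Valued.integer K) V}
    (h : IsLatticeIn W M) {c : K} (hc : c ≠ 0) : IsLatticeIn W (c • M) := by
  constructor
  · exact h.1.map _
  · rw [← h.2, Submodule.coe_pointwise_smul]
    exact Submodule.span_smul_eq_of_isUnit (M : Set V) c (Ne.isUnit hc)

/-- M is recovered as the intersection of M + M' with W. -/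
theorem eq_of_sup_eq {W W' : Submodule K V} (hWW' : Disjoint W W')
    {M N M' N' : Submodule (Valued.integer K) V} (hM : IsLatticeIn W M) (hN : IsLatticeIn W N)
    (hM' : IsLatticeIn W' M') (hN' : IsLatticeIn W' N') (h : M ⊔ M' = N ⊔ N') : M = N := by
  have key : ∀ {M N M' N' : Submodule (Valued.integer K) V}, IsLatticeIn W M → IsLatticeIn W N →
      IsLatticeIn W' N' → M ⊔ M' = N ⊔ N' → M ≤ N := by
    intro M N M' N' hM hN hN' h x hx
    have h1 : x ∈ N ⊔ N' := h ▸ Submodule.mem_sup_left hx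
    obtain ⟨y, hy, y', hy', rfl⟩ := Submodule.mem_sup.1 h1
    have h2 : y' ∈ W := by
      have := W.sub_mem (hM.le hx) (hN.le hy)
      rwa [add_sub_cancel_left] at this
    have h3 : y' = 0 := by
      have : y' ∈ W ⊓ W' := ⟨h2, hN'.le hy'⟩
      rwa [hWW'.eq_bot] at this
    rw [h3, add_zero]
    exact hy
  exact le_antisymm (key hM hN hN' h) (key hN hM hM' h.symm)

theorem homothetic_of_sup {W W' : Submodule K V} (hWW' : Disjoint W W') {ϖ : K} (hϖ : ϖ ≠ 0)
    {M N M' N' : Submodule (Valued.integer K) V} (hM : IsLatticeIn W M) (hN : IsLatticeIn W N)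
    (hM' : IsLatticeIn W' M') (hN' : IsLatticeIn W' N') {j k : ℤ}
    (h : Homothetic (M ⊔ ϖ ^ j • M') (N ⊔ ϖ ^ k • N')) : Homothetic M N ∧ Homothetic M' N' := by
  obtain ⟨c, hc, h⟩ := h
  rw [Submodule.smul_sup', smul_smul] at h
  have hj : ϖ ^ j ≠ 0 := zpow_ne_zero _ hϖ
  have hk : ϖ ^ k ≠ 0 := zpow_ne_zero _ hϖ
  have h1 := eq_of_sup_eq hWW' hN (hM.smul hc) (hN'.smul hk) (hM'.smul (mul_ne_zero hc hj)) h
  have h2 := eq_of_sup_eq hWW'.symm (hN'.smul hk) (hM'.smul (mul_ne_zero hc hj)) hN (hM.smul hc)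
    (by rw [sup_comm, h, sup_comm])
  refine ⟨⟨c, hc, h1⟩, ⟨(ϖ ^ k)⁻¹ * (c * ϖ ^ j), mul_ne_zero (inv_ne_zero hk) (mul_ne_zero hc hj), ?_⟩⟩
  rw [← smul_smul, ← h2, smul_smul, inv_mul_cancel₀ hk, one_smul]

/-- Scaling M by c and M' by c' shifts the index by the valuation of c'/c, and the remaining unit
acts trivially on lattices. Thus the family of vertices depends only on the two classes. -/
theorem exists_homothetic_sup {ϖ : Valued.integer K} (hϖ : Irreducible ϖ)
    {M N M' N' : Submodule (Valued.integer K) V} (h : Homothetic M N) (h' : Homothetic M' N') :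
    ∃ m : ℤ, ∀ k : ℤ, Homothetic (M ⊔ (ϖ : K) ^ (k + m) • M') (N ⊔ (ϖ : K) ^ k • N') := by
  obtain ⟨c, hc, rfl⟩ := h
  obtain ⟨c', hc', rfl⟩ := h'
  obtain ⟨m, hm⟩ := exists_norm_eq_zpow hϖ (div_ne_zero hc' hc)
  have hϖ0 := uniformizer_ne_zero hϖ
  refine ⟨m, fun k => ⟨c, hc, ?_⟩⟩
  rw [Submodule.smul_sup', smul_smul, smul_smul]
  congr 1
  have h1 : ‖c' / c / (ϖ : K) ^ m‖ = 1 := by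
    rw [norm_div, hm, norm_zpow, div_self (zpow_ne_zero _ (norm_uniformizer_pos hϖ).ne')]
  have h2 : (ϖ : K) ^ k * c' = c * (ϖ : K) ^ (k + m) * (c' / c / (ϖ : K) ^ m) := by
    rw [zpow_add₀ hϖ0]
    have := zpow_ne_zero m hϖ0
    field_simp
  rw [h2, ← smul_smul, smul_eq_self_of_norm_eq_one h1]

end Lattice

/-! ## The geodesics given by a decomposition of a basis -/

section Standard

open Building

/-- The characteristic vector of the complement of `I`. -/
def cochar {n : ℕ} (I : Set (Fin n)) : Fin n → ℝ := Set.indicator Iᶜ 1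

theorem cochar_of_mem {n : ℕ} {I : Set (Fin n)} {i : Fin n} (h : i ∈ I) : cochar I i = 0 :=
  Set.indicator_of_notMem (by simpa using h) _

theorem cochar_of_notMem {n : ℕ} {I : Set (Fin n)} {i : Fin n} (h : i ∉ I) : cochar I i = 1 :=
  Set.indicator_of_mem (s := Iᶜ) h _

variable {K : Type*} [NontriviallyNormedField K] [IsUltrametricDist K]
  {V : Type*} [AddCommGroup V] [Module K V]

theorem IsLatticeIn.exists_split_basis [FiniteDimensional K V] {ϖ : Valued.integer K}
    (hϖ : Irreducible ϖ) {W W' : Submodule K V} (hWW' : IsCompl W W')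
    {M M' : Submodule (Valued.integer K) V} (hM : IsLatticeIn W M) (hM' : IsLatticeIn W' M') :
    ∃ (e : Basis (Fin (finrank K V)) K V) (I : Set (Fin (finrank K V))),
      W = Submodule.span K (e '' I) ∧ W' = Submodule.span K (e '' Iᶜ) ∧
      M = Submodule.span (Valued.integer K) (e '' I) ∧
      M' = Submodule.span (Valued.integer K) (e '' Iᶜ) := by
  obtain ⟨r, x, hx, hxW, hxM⟩ := hM.exists_basis hϖ
  obtain ⟨s, y, hy, hyW, hyM⟩ := hM'.exists_basis hϖ
  have hli : LinearIndependent K (Sum.elim x y) :=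
    hx.sum_type hy (by rw [hxW, hyW]; exact hWW'.disjoint)
  have hsp : ⊤ ≤ Submodule.span K (Set.range (Sum.elim x y)) := by
    rw [Set.Sum.elim_range, Submodule.span_union, hxW, hyW, hWW'.sup_eq_top]
  set b := Basis.mk hli hsp with hb
  have hcard : Fintype.card (Fin r ⊕ Fin s) = Fintype.card (Fin (finrank K V)) := by
    rw [Fintype.card_fin, finrank_eq_card_basis b]
  set σ := Fintype.equivOfCardEq hcard with hσ
  have hI : (b.reindex σ) '' (σ '' Set.range Sum.inl) = Set.range x := by
    rw [← Set.image_comp, ← Set.range_comp]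
    congr 1
    ext i
    simp [hb]
  have hI' : (b.reindex σ) '' (σ '' Set.range Sum.inl)ᶜ = Set.range y := by
    rw [← Set.image_compl_eq σ.bijective, Set.compl_range_inl, ← Set.image_comp, ← Set.range_comp]
    congr 1
    ext i
    simp [hb]
  exact ⟨b.reindex σ, σ '' Set.range Sum.inl, by rw [hI, hxW], by rw [hI', hyW],
    by rw [hI, hxM], by rw [hI', hyM]⟩

theorem isLatticeIn_span {ι : Type*} [Finite ι] (x : ι → V) (I : Set ι) :
    IsLatticeIn (Submodule.span K (x '' I)) (Submodule.span (Valued.integer K) (x '' I)) :=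
  ⟨Submodule.fg_span (Set.toFinite _), Submodule.span_span_of_tower (Valued.integer K) K _⟩

variable (e : Basis (Fin (finrank K V)) K V) (I : Set (Fin (finrank K V)))

theorem exists_scaled_basis {c : K} (hc : c ≠ 0) : ∃ w : Fin (finrank K V) → Kˣ,
    (∀ i ∈ I, (w i : K) = 1) ∧ (∀ i ∉ I, (w i : K) = c) ∧
    Submodule.span (Valued.integer K) (e '' I) ⊔ c • Submodule.span (Valued.integer K) (e '' Iᶜ) =
      Submodule.span (Valued.integer K) (Set.range (e.unitsSMul w)) := by
  classical
  refine ⟨fun i => if i ∈ I then 1 else Units.mk0 c hc, fun i hi => by simp [hi],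
    fun i hi => by simp [hi], ?_⟩
  rw [Submodule.smul_span, ← Submodule.span_union]
  congr 1
  ext v
  simp only [Set.mem_union, Set.mem_range, Basis.unitsSMul_apply]
  constructor
  · rintro (⟨i, hi, rfl⟩ | ⟨_, ⟨i, hi, rfl⟩, rfl⟩)
    · exact ⟨i, by simp [hi]⟩
    · exact ⟨i, by simp [(by simpa using hi : i ∉ I), Units.smul_def]⟩
  · rintro ⟨i, rfl⟩
    by_cases hi : i ∈ I
    · left
      exact ⟨i, hi, by simp [hi]⟩
    · right
      exact ⟨e i, ⟨i, hi, rfl⟩, by simp [hi, Units.smul_def]⟩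

theorem isVertexOf_sup_smul {c : K} (hc : c ≠ 0) :
    IsVertexOf (Submodule.span (Valued.integer K) (e '' I) ⊔
      c • Submodule.span (Valued.integer K) (e '' Iᶜ)) (mk e (-Real.log ‖c‖ • cochar I)) := by
  obtain ⟨w, hw, hw', h⟩ := exists_scaled_basis e I hc
  refine ⟨e.unitsSMul w, h, ?_⟩
  rw [mk_unitsSMul]
  congr 1
  ext i
  by_cases hi : i ∈ I
  · simp [hw i hi, cochar_of_mem hi]
  · simp [hw' i hi, cochar_of_notMem hi]

theorem mem_sup_smul_iff {c : K} (hc : c ≠ 0) (v : V) :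
    v ∈ Submodule.span (Valued.integer K) (e '' I) ⊔
      c • Submodule.span (Valued.integer K) (e '' Iᶜ) ↔
    (∀ i ∈ I, ‖e.repr v i‖ ≤ 1) ∧ ∀ i ∉ I, ‖e.repr v i‖ ≤ ‖c‖ := by
  obtain ⟨w, hw, hw', h⟩ := exists_scaled_basis e I hc
  have hcn := norm_pos_iff.2 hc
  rw [h, mem_span_range_iff_norm]
  simp only [Basis.repr_unitsSMul, Units.smul_def, Units.val_inv_eq_inv_val, smul_eq_mul,
    norm_mul, norm_inv]
  constructor
  · intro h
    refine ⟨fun i hi => by simpa [hw i hi] using h i, fun i hi => ?_⟩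
    have := h i
    rwa [hw' i hi, inv_mul_le_iff₀ hcn, mul_one] at this
  · rintro ⟨h1, h2⟩ i
    by_cases hi : i ∈ I
    · simpa [hw i hi] using h1 i hi
    · rw [hw' i hi, inv_mul_le_iff₀ hcn, mul_one]
      exact h2 i hi

variable {I}

theorem adjacent_sup_smul {ϖ : Valued.integer K} (hϖ : Irreducible ϖ) (hI : I.Nonempty)
    (hI' : Iᶜ.Nonempty) (k : ℤ) :
    Adjacent (Submodule.span (Valued.integer K) (e '' I) ⊔
        (ϖ : K) ^ (k + 1) • Submodule.span (Valued.integer K) (e '' Iᶜ))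
      (Submodule.span (Valued.integer K) (e '' I) ⊔
        (ϖ : K) ^ k • Submodule.span (Valued.integer K) (e '' Iᶜ)) := by
  have h0 := uniformizer_ne_zero hϖ
  have hpos := norm_uniformizer_pos hϖ
  have hlt := norm_uniformizer_lt_one hϖ
  have hk := zpow_ne_zero k h0
  have hk1 := zpow_ne_zero (k + 1) h0
  have hkpos : 0 < ‖(ϖ : K)‖ ^ k := zpow_pos hpos k
  have hle : ‖(ϖ : K) ^ (k + 1)‖ ≤ ‖(ϖ : K) ^ k‖ := by
    rw [norm_zpow, norm_zpow, zpow_add_one₀ hpos.ne']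
    exact mul_le_of_le_one_right hkpos.le hlt.le
  refine ⟨fun h => ?_, ϖ, _, _, hϖ, Homothetic.refl _, Homothetic.refl _, ?_, ?_⟩
  -- A homothety by `c` would need ‖c‖ ≤ 1, tested on a vector of I, and 1 ≤ ‖c‖ ‖ϖ‖, tested on one
  -- outside I.
  · obtain ⟨c, hc, h⟩ := h
    have hcn := norm_pos_iff.2 hc
    have h' := fun v => SetLike.ext_iff.1 h v
    simp only [mem_smul_iff hc, mem_sup_smul_iff e I hk, mem_sup_smul_iff e I hk1, map_smul,
      Finsupp.smul_apply, norm_smul, norm_inv] at h'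
    obtain ⟨i, hi⟩ := hI
    obtain ⟨j, hj⟩ := hI'
    have hij : ∀ l ∉ I, i ≠ l := fun l hl h => hl (h ▸ hi)
    have hji : ∀ l ∈ I, j ≠ l := fun l hl h => hj (h ▸ hl)
    have h1 : ‖c‖ ≤ 1 := by
      have := ((h' (c • e i)).2 ⟨fun l _ => ?_, fun l hl => ?_⟩).1 i hi
      · simpa [norm_smul] using this
      · by_cases hl : i = l <;> simp [hl, hcn.ne']
      · simp [hij l hl, (zpow_pos hpos (k + 1)).le]
    have h2 : 1 ≤ ‖c‖ * ‖(ϖ : K)‖ := by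
      have := ((h' ((ϖ : K) ^ k • e j)).1 ⟨fun l hl => ?_, fun l hl => ?_⟩).2 j hj
      · simp only [map_smul, Finsupp.smul_apply, norm_smul, norm_zpow, Basis.repr_self,
          Finsupp.single_eq_same, norm_one, mul_one, zpow_add_one₀ hpos.ne',
          inv_mul_le_iff₀ hcn] at this
        have h3 : 1 * ‖(ϖ : K)‖ ^ k ≤ (‖c‖ * ‖(ϖ : K)‖) * ‖(ϖ : K)‖ ^ k := by linarith
        exact le_of_mul_le_mul_right h3 hkpos
      · simp [hji l hl]
      · by_cases hjl : j = l
        · subst hjl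
          simp
        · simp [hjl, hkpos.le]
    have h3 : ‖c‖ * ‖(ϖ : K)‖ ≤ 1 * ‖(ϖ : K)‖ := mul_le_mul_of_nonneg_right h1 hpos.le
    linarith
  · intro v hv
    rw [mem_smul_iff h0, mem_sup_smul_iff e I hk] at hv
    rw [mem_sup_smul_iff e I hk1]
    simp only [map_smul, Finsupp.smul_apply, norm_smul, norm_inv, inv_mul_le_iff₀ hpos,
      mul_one] at hv
    refine ⟨fun i hi => (hv.1 i hi).trans hlt.le, fun i hi => (hv.2 i hi).trans (le_of_eq ?_)⟩
    rw [norm_zpow, norm_zpow, zpow_add_one₀ hpos.ne', mul_comm]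
  · intro v hv
    rw [mem_sup_smul_iff e I hk1] at hv
    rw [mem_sup_smul_iff e I hk]
    exact ⟨hv.1, fun i hi => (hv.2 i hi).trans hle⟩

theorem log_norm_uniformizer_neg {ϖ : Valued.integer K} (hϖ : Irreducible ϖ) :
    0 < -Real.log ‖(ϖ : K)‖ :=
  neg_pos.2 (Real.log_neg (norm_uniformizer_pos hϖ) (norm_uniformizer_lt_one hϖ))

theorem isVertexOf_mk_zsmul {ϖ : Valued.integer K} (hϖ : Irreducible ϖ) (k : ℤ) :
    IsVertexOf (Submodule.span (Valued.integer K) (e '' I) ⊔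
      (ϖ : K) ^ k • Submodule.span (Valued.integer K) (e '' Iᶜ))
      (mk e ((k * -Real.log ‖(ϖ : K)‖) • cochar I)) := by
  have := isVertexOf_sup_smul e I (zpow_ne_zero k (uniformizer_ne_zero hϖ))
  rwa [norm_zpow, Real.log_zpow, ← mul_neg] at this

/-- At time t the values of the norm on e j, j ∉ I, and e i, i ∈ I, have ratio exp(a t). At a vertex
this ratio lies in the value group, so a t is an integral multiple of -log ‖ϖ‖. -/
theorem hasVertices_mk (hn : 0 < finrank K V) {ϖ : Valued.integer K} (hϖ : Irreducible ϖ)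
    (hI : I.Nonempty) (hI' : Iᶜ.Nonempty) {a : ℝ → ℝ} (ha : Function.Surjective a) :
    HasVertices ϖ (fun t => mk e (a t • cochar I)) (Submodule.span (Valued.integer K) (e '' I))
      (Submodule.span (Valued.integer K) (e '' Iᶜ)) := by
  constructor
  · intro k
    obtain ⟨t, ht⟩ := ha (k * -Real.log ‖(ϖ : K)‖)
    refine ⟨t, ?_⟩
    simp only [ht]
    exact isVertexOf_mk_zsmul e hϖ k
  · intro t L hL
    obtain ⟨i, hi⟩ := hI
    obtain ⟨j, hj⟩ := hI'
    obtain ⟨b, hbL, hb⟩ := id hL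
    obtain ⟨r, hr, h⟩ := mk_eq_mk_iff.1 hb
    obtain ⟨c, hc, hci⟩ := exists_basisNorm_zero_eq b (e.ne_zero i)
    obtain ⟨c', hc', hcj⟩ := exists_basisNorm_zero_eq b (e.ne_zero j)
    have h1 := h (e i)
    have h2 := h (e j)
    rw [basisNorm_self, hci] at h1
    rw [basisNorm_self, hcj] at h2
    simp only [Pi.smul_apply, cochar_of_mem hi, cochar_of_notMem hj, smul_eq_mul, mul_zero,
      Real.exp_zero, mul_one] at h1 h2
    obtain ⟨k, hk⟩ := exists_norm_eq_zpow hϖ (div_ne_zero hc' hc)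
    have h3 : a t = ((-k : ℤ) : ℝ) * -Real.log ‖(ϖ : K)‖ := by
      have : Real.exp (a t) = ‖(ϖ : K)‖ ^ k := by
        rw [← hk, norm_div, h1, h2]
        field_simp
      rw [← Real.log_exp (a t), this, Real.log_zpow]
      push_cast
      ring
    refine ⟨-k, IsVertexOf.homothetic hn (isVertexOf_mk_zsmul e hϖ (-k)) ?_⟩
    rw [← h3]
    exact hL

variable [FiniteDimensional K V]

/-- Points of a segment are determined by their distances to its ends, so the apartment used to
define it does not matter. -/
theorem mem_segmentBetween_mk_iff (B : WeylScalarProduct (finrank K V)) (hn : 2 ≤ finrank K V) (u v : Fin (finrank K V) → ℝ)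
    (x : Building K V) : x ∈ segmentBetween (mk e u) (mk e v) ↔
      ∃ s : ℝ, 0 ≤ s ∧ s ≤ 1 ∧ x = mk e ((1 - s) • u + s • v) := by
  constructor
  · rintro ⟨b, u', v', s, h1, h2, hs, hs', rfl⟩
    refine ⟨s, hs, hs', ?_⟩
    have h := bdist_mk_combination B hn b u' v' hs hs'
    rw [← h1, ← h2] at h
    exact eq_of_bdist_between B hn e u v hs hs' h.1 h.2
  · rintro ⟨s, hs, hs', rfl⟩
    exact ⟨e, u, v, s, rfl, rfl, hs, hs', rfl⟩

theorem exists_edges_mk (B : WeylScalarProduct (finrank K V)) (hn : 2 ≤ finrank K V) {ϖ : Valued.integer K} (hϖ : Irreducible ϖ)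
    (hI : I.Nonempty) (hI' : Iᶜ.Nonempty) {a : ℝ → ℝ} (ha : Function.Surjective a) :
    ∃ E : Set (Set (Building K V)), (∀ s ∈ E, IsEdge s) ∧
      Set.range (fun t => mk e (a t • cochar I)) = ⋃₀ E := by
  set l := -Real.log ‖(ϖ : K)‖ with hl
  have hl0 : 0 < l := log_norm_uniformizer_neg hϖ
  refine ⟨Set.range fun k : ℤ => segmentBetween (mk e (((k + 1 : ℤ) * l) • cochar I))
    (mk e ((k * l) • cochar I)), ?_, ?_⟩
  · rintro _ ⟨k, rfl⟩
    exact ⟨_, _, _, _, isVertexOf_mk_zsmul e hϖ (k + 1), isVertexOf_mk_zsmul e hϖ k,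
      adjacent_sup_smul e hϖ hI hI' k, rfl⟩
  · ext x
    simp only [Set.mem_range, Set.mem_sUnion, exists_exists_eq_and,
      mem_segmentBetween_mk_iff e B hn, smul_smul, ← add_smul]
    constructor
    · rintro ⟨t, rfl⟩
      have h1 := Int.floor_le (a t / l)
      have h2 := Int.lt_floor_add_one (a t / l)
      -- Each edge starts at the vertex of index k + 1, so its parameter runs downwards from there.
      refine ⟨⌊a t / l⌋, ⌊a t / l⌋ + 1 - a t / l, by linarith, by linarith, ?_⟩
      congr 2
      push_cast
      field_simp
      ring
    · rintro ⟨k, s, -, -, rfl⟩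
      obtain ⟨t, ht⟩ := ha ((1 - s) * ((k + 1 : ℤ) * l) + s * (k * l))
      exact ⟨t, by rw [ht]⟩

variable (B : WeylScalarProduct (finrank K V))

theorem len_cochar_pos (hI : I.Nonempty) (hI' : Iᶜ.Nonempty) : 0 < B.len (cochar I) := by
  refine lt_of_le_of_ne (B.len_nonneg _) fun h => ?_
  obtain ⟨c, hc⟩ := (B.len_eq_zero_iff _).1 h.symm
  obtain ⟨i, hi⟩ := hI
  obtain ⟨j, hj⟩ := hI'
  have h1 := congrFun hc i
  have h2 := congrFun hc j
  rw [cochar_of_mem hi] at h1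
  rw [cochar_of_notMem hj] at h2
  linarith

theorem isGeodesic_mk_cochar (hn : 2 ≤ finrank K V) (hI : I.Nonempty) (hI' : Iᶜ.Nonempty)
    (t₀ : ℝ) : IsGeodesic B fun t => mk e (((t - t₀) / B.len (cochar I)) • cochar I) := by
  intro s t
  have h := len_cochar_pos B hI hI'
  rw [bdist_mk_mk B hn, ← sub_smul, ← sub_div, B.len_smul, abs_div, abs_of_pos h,
    div_mul_cancel₀ _ h.ne']
  congr 1
  ring

/-- `cochar I` increases exactly from I to its complement, so the forward direction ends at the
point of W; the reversed direction exchanges I and its complement. -/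
theorem connects_mk_cochar (hn : 2 ≤ finrank K V) (hI : I.Nonempty) (hI' : Iᶜ.Nonempty)
    (t₀ : ℝ) : Connects B (fun t => mk e (((t - t₀) / B.len (cochar I)) • cochar I))
      (Submodule.span K (e '' I)) (Submodule.span K (e '' Iᶜ)) := by
  have h := len_cochar_pos B hI hI'
  have hγ := isGeodesic_mk_cochar e B hn hI hI' t₀
  have hinv : 0 < (B.len (cochar I))⁻¹ := inv_pos.2 h
  have hcmp : ∀ i j, cochar I i < cochar I j ↔ i ∈ I ∧ j ∉ I := by
    intro i j
    by_cases hi : i ∈ I <;> by_cases hj : j ∈ I <;>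
      simp [hi, hj, cochar_of_mem, cochar_of_notMem]
  refine ⟨⟨_, ?_, (tendsto_atTop_bdry_iff hn hγ _).2 rfl⟩,
    ⟨_, ?_, (tendsto_atBot_bdry_iff hn hγ _).2 rfl⟩⟩
  · refine isBoundaryVertexOf_endpoint hn (u := (-t₀ / B.len (cochar I)) • cochar I)
      (z := (B.len (cochar I))⁻¹ • cochar I) (fun t => ?_) I fun i j => ?_
    · simp only [positiveHalf]
      congr 1
      rw [← smul_assoc, ← add_smul, smul_eq_mul]
      congr 1
      ring
    · simp only [Pi.smul_apply, smul_eq_mul]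
      rw [mul_lt_mul_iff_right₀ hinv, hcmp]
  · refine isBoundaryVertexOf_endpoint hn (u := (-t₀ / B.len (cochar I)) • cochar I)
      (z := -(B.len (cochar I))⁻¹ • cochar I) (fun t => ?_) Iᶜ fun i j => ?_
    · simp only [positiveHalf]
      congr 1
      rw [← smul_assoc, ← add_smul, smul_eq_mul]
      congr 1
      ring
    · simp only [Pi.smul_apply, smul_eq_mul, neg_mul, neg_lt_neg_iff]
      rw [mul_lt_mul_iff_right₀ hinv, hcmp]
      simp [and_comm]

end Standard

/-! ## Combinatorial geodesics connecting complementary subspaces -/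

section Combinatorial

open Building

variable {K : Type*} [NontriviallyNormedField K] [IsUltrametricDist K]
  {V : Type*} [AddCommGroup V] [Module K V] [FiniteDimensional K V]
  {B : WeylScalarProduct (finrank K V)}

theorem exists_isometryEquiv_of_dist {l : ℝ} (hl : 0 < l) {t : ℤ → ℝ}
    (ht : ∀ j k, |t j - t k| = |j * l - k * l|) : ∃ φ : ℝ ≃ᵢ ℝ, ∀ k, φ (t k) = k * l := by
  have h1 : |t 1 - t 0| = l := by simpa [abs_of_pos hl] using ht 1 0
  -- Polarization turns the distances into products, so the t k are equally spaced; the sign of t 1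
  -- - t 0 decides between translation and reflection.
  have hsq : ∀ k : ℤ, (t k - t 0) * (t 1 - t 0) = k * l * l := by
    intro k
    have e0 := congrArg (· ^ 2) (ht k 0)
    have e1 := congrArg (· ^ 2) (ht k 1)
    have e2 := congrArg (· ^ 2) h1
    simp only [sq_abs] at e0 e1 e2
    push_cast at e0 e1
    linarith
  rcases abs_choice (t 1 - t 0) with h | h
  · refine ⟨IsometryEquiv.subRight (t 0), fun k => ?_⟩
    have := hsq k
    rw [show t 1 - t 0 = l by linarith] at this
    simpa using mul_right_cancel₀ hl.ne' this
  · refine ⟨IsometryEquiv.subLeft (t 0), fun k => ?_⟩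
    have := hsq k
    rw [show t 1 - t 0 = -l by linarith] at this
    have h2 : (t 0 - t k) * l = k * l * l := by linarith
    simpa using mul_right_cancel₀ hl.ne' h2

/-- The times at which `δ` meets the points γ (k l) are spaced as the k l, so an isometry of ℝ
aligns them. Uniqueness of segments then gives agreement between any two such points. -/
theorem IsGeodesic.reparam (hn : 2 ≤ finrank K V) {γ δ : ℝ → Building K V} (hγ : IsGeodesic B γ)
    (hδ : IsGeodesic B δ) {l : ℝ} (hl : 0 < l) (h : ∀ k : ℤ, ∃ t, δ t = γ (k * l)) :
    Reparam γ δ := by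
  choose t ht using h
  obtain ⟨φ, hφ⟩ := exists_isometryEquiv_of_dist hl (t := t) fun j k => by
    rw [← hδ, ht, ht, hγ]
  refine ⟨φ, ?_⟩
  have hδ' : IsGeodesic B fun s => δ (φ.symm s) := fun s s' => by
    rw [hδ, ← Real.dist_eq, φ.symm.dist_eq, Real.dist_eq]
  have hk : ∀ k : ℤ, δ (φ.symm (k * l)) = γ (k * l) := fun k => by
    rw [← hφ k, φ.symm_apply_apply, ht]
    rw [hφ]
  suffices H : ∀ s, δ (φ.symm s) = γ s by
    funext s
    simpa using H (φ s)
  intro s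
  obtain ⟨N, hN⟩ := exists_nat_gt (|s| / l)
  rw [div_lt_iff₀ hl] at hN
  have hN0 : 0 < N * l := (abs_nonneg s).trans_lt hN
  have h1 := hδ'.divides hN0 hN.le
  have h2 := hγ.divides hN0 hN.le
  have hk1 := hk N
  have hk2 := hk (-N)
  push_cast at hk1 hk2
  rw [neg_mul] at hk2
  simp only [hk1, hk2] at h1
  have hs := abs_lt.1 hN
  exact h1.eq hn (div_nonneg (by linarith) (by linarith))
    ((div_le_one (by linarith)).2 (by linarith)) h2

theorem reparam_mk_cochar (hn : 2 ≤ finrank K V) {ϖ : Valued.integer K} (hϖ : Irreducible ϖ)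
    {e : Basis (Fin (finrank K V)) K V} {I : Set (Fin (finrank K V))} (hI : I.Nonempty)
    (hI' : Iᶜ.Nonempty) {δ : ℝ → Building K V} (hδ : IsGeodesic B δ)
    (h : PassesThrough ϖ δ (Submodule.span (Valued.integer K) (e '' I))
      (Submodule.span (Valued.integer K) (e '' Iᶜ))) :
    Reparam (fun t => mk e (((t - 0) / B.len (cochar I)) • cochar I)) δ := by
  have hlen := len_cochar_pos B hI hI'
  refine (isGeodesic_mk_cochar e B hn hI hI' 0).reparam hn hδ
    (mul_pos (log_norm_uniformizer_neg hϖ) hlen) fun k => ?_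
  obtain ⟨t, ht⟩ := h k
  refine ⟨t, ht.eq ?_⟩
  rw [sub_zero, ← mul_assoc, mul_div_cancel_right₀ _ hlen.ne']
  exact isVertexOf_mk_zsmul e hϖ k

theorem surjective_sub_div {l : ℝ} (hl : 0 < l) (t₀ : ℝ) :
    Function.Surjective fun t : ℝ => (t - t₀) / l := fun y =>
  ⟨y * l + t₀, by simp [hl.ne']⟩

theorem nonempty_of_span_image_ne_bot {ι : Type*} {x : ι → V} {I : Set ι}
    (h : Submodule.span K (x '' I) ≠ ⊥) : I.Nonempty := by
  rw [Set.nonempty_iff_ne_empty]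
  rintro rfl
  simp at h

theorem IsLatticeIn.exists_geodesic (hn : 2 ≤ finrank K V) {ϖ : Valued.integer K}
    (hϖ : Irreducible ϖ) {W W' : Submodule K V} (hW : W ≠ ⊥) (hW' : W' ≠ ⊥)
    (hWW' : IsCompl W W') {M M' : Submodule (Valued.integer K) V} (hM : IsLatticeIn W M)
    (hM' : IsLatticeIn W' M') :
    ∃ γ : ℝ → Building K V, IsCombinatorialGeodesic B γ ∧ Connects B γ W W' ∧
      HasVertices ϖ γ M M' ∧ ∀ δ : ℝ → Building K V, IsGeodesic B δ →
        PassesThrough ϖ δ M M' → Reparam γ δ := by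
  obtain ⟨e, I, rfl, rfl, rfl, rfl⟩ := hM.exists_split_basis hϖ hWW' hM'
  have hI := nonempty_of_span_image_ne_bot hW
  have hI' := nonempty_of_span_image_ne_bot hW'
  have hsurj := surjective_sub_div (len_cochar_pos B hI hI') 0
  exact ⟨_, ⟨isGeodesic_mk_cochar e B hn hI hI' 0, exists_edges_mk e B hn hϖ hI hI' hsurj⟩,
    connects_mk_cochar e B hn hI hI' 0, hasVertices_mk e (by omega) hϖ hI hI' hsurj,
    fun δ hδ h => reparam_mk_cochar hn hϖ hI hI' hδ h⟩

theorem IsCombinatorialGeodesic.exists_isVertexOf {γ : ℝ → Building K V}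
    (hγ : IsCombinatorialGeodesic B γ) :
    ∃ (t : ℝ) (M : Submodule (Valued.integer K) V), IsVertexOf M (γ t) := by
  obtain ⟨-, E, hE, h⟩ := hγ
  obtain ⟨s, hs, -⟩ := Set.mem_sUnion.1 (h ▸ Set.mem_range_self (f := γ) 0)
  obtain ⟨M, N, x, y, hM, hN, -, hxy⟩ := hE s hs
  have hx : x ∈ s := by
    rw [hxy]
    obtain ⟨e, h1, h2⟩ := exists_common_apartment x y
    exact ⟨e, _, _, 0, eq_mk_of_isOrth h1, eq_mk_of_isOrth h2, le_rfl, zero_le_one, by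
      simpa using eq_mk_of_isOrth h1⟩
  obtain ⟨t, ht⟩ : x ∈ Set.range γ := h ▸ Set.mem_sUnion.2 ⟨s, hs, hx⟩
  exact ⟨t, M, ht ▸ hM⟩

/-- Every geodesic connecting complementary subspaces splits. -/
theorem IsGeodesic.exists_eq_mk_cochar [ProperSpace K] (hn : 2 ≤ finrank K V)
    {γ : ℝ → Building K V} (hγ : IsGeodesic B γ) {W W' : Submodule K V} (hW : W ≠ ⊥)
    (hW' : W' ≠ ⊥) (hWW' : IsCompl W W') (hc : Connects B γ W W') :
    ∃ (e : Basis (Fin (finrank K V)) K V) (u : Fin (finrank K V) → ℝ)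
      (I : Set (Fin (finrank K V))), W = Submodule.span K (e '' I) ∧
      W' = Submodule.span K (e '' Iᶜ) ∧
      ∀ t, γ t = mk e (u + (t / B.len (cochar I)) • cochar I) := by
  obtain ⟨e, he⟩ := hγ.exists_isOrth hn
  obtain ⟨u, z, hz⟩ := hγ.exists_eq_mk_of_isOrth hn he
  obtain ⟨⟨ξ, hξ, hlim⟩, ξ', hξ', hlim'⟩ := hc
  rw [(tendsto_atTop_bdry_iff hn hγ ξ).1 hlim] at hξ
  rw [(tendsto_atBot_bdry_iff hn hγ ξ').1 hlim'] at hξ'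
  obtain ⟨I, hWI, hI⟩ := eq_span_of_isBoundaryVertexOf hn (e := e) (u := u) (z := z)
    (fun t => by simp only [positiveHalf, hz]) hξ
  obtain ⟨I', hWI', hI'⟩ := eq_span_of_isBoundaryVertexOf hn (e := e) (u := u) (z := -z)
    (fun t => by simp only [positiveHalf, hz, neg_smul, smul_neg]) hξ'
  simp only [Pi.neg_apply, neg_lt_neg_iff] at hI'
  obtain ⟨i₀, hi₀⟩ := nonempty_of_span_image_ne_bot (hWI ▸ hW)
  have hIc : ∃ j₀, j₀ ∉ I := by
    by_contra! hall
    have hIu : I = Set.univ := Set.eq_univ_of_forall hall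
    rw [hIu, Set.image_univ, e.span_eq] at hWI
    have := hWW'.inf_eq_bot
    rw [hWI, top_inf_eq] at this
    exact hW' this
  obtain ⟨j₀, hj₀⟩ := hIc
  -- The same direction `z`, read forwards and backwards, splits the indices into its low and high
  -- values, so the second set is the complement of the first.
  have hII' : I' = Iᶜ := by
    ext i
    constructor
    · intro hi hiI
      have h1 := (hI i j₀).2 ⟨hiI, hj₀⟩
      exact ((hI' j₀ i).1 h1).2 hi
    · intro hi
      exact ((hI' i i₀).1 ((hI i₀ i).2 ⟨hi₀, hi⟩)).1
  subst hII'
  have hlen := len_cochar_pos B ⟨i₀, hi₀⟩ ⟨j₀, hj₀⟩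
  have hκ : 0 < z j₀ - z i₀ := sub_pos.2 ((hI i₀ j₀).2 ⟨hi₀, hj₀⟩)
  have hzI : ∀ i, z i = ((z j₀ - z i₀) • cochar I) i + z i₀ := by
    intro i
    by_cases hi : i ∈ I
    · have h1 : ¬ z i < z i₀ := fun h => ((hI _ _).1 h).2 hi₀
      have h2 : ¬ z i₀ < z i := fun h => ((hI _ _).1 h).2 hi
      simp only [Pi.smul_apply, cochar_of_mem hi, smul_eq_mul]
      linarith
    · have h1 : ¬ z i < z j₀ := fun h => hi ((hI _ _).1 h).1
      have h2 : ¬ z j₀ < z i := fun h => hj₀ ((hI _ _).1 h).1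
      simp only [Pi.smul_apply, cochar_of_notMem hi, smul_eq_mul]
      linarith
  -- Unit speed fixes the jump of `z` between the two blocks.
  have hκlen : (z j₀ - z i₀) * B.len (cochar I) = 1 := by
    have h1 := hγ 1 0
    rw [hz, hz, bdist_mk_mk B hn, add_sub_add_left_eq_sub, one_smul, zero_smul, sub_zero,
      B.len_congr hzI, B.len_smul, abs_of_pos hκ] at h1
    simpa using h1
  refine ⟨e, u, I, hWI, hWI', fun t => ?_⟩
  rw [hz]
  refine mk_congr e (c := t * z i₀) fun i => ?_
  have h2 : t / B.len (cochar I) = t * (z j₀ - z i₀) := by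
    rw [div_eq_iff hlen.ne', mul_assoc, hκlen, mul_one]
  rw [h2]
  simp only [Pi.add_apply, Pi.smul_apply, smul_eq_mul]
  rw [hzI i]
  simp only [Pi.smul_apply, smul_eq_mul]
  ring

theorem span_image_unitsSMul (e : Basis (Fin (finrank K V)) K V) (w : Fin (finrank K V) → Kˣ)
    (I : Set (Fin (finrank K V))) :
    Submodule.span K (e.unitsSMul w '' I) = Submodule.span K (e '' I) := by
  ext v
  rw [mem_span_image_iff_repr, mem_span_image_iff_repr]
  refine forall₂_congr fun j _ => ?_
  rw [Basis.repr_unitsSMul, Units.smul_def, smul_eq_mul, mul_eq_zero]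
  simp

/-- At one vertex on γ the coordinates lie, up to a common constant, in log ‖Kˣ‖. Rescaling the
basis vectors by units of K moves this vertex to the origin, and γ becomes the standard line shifted
by the time t₀. -/
theorem IsCombinatorialGeodesic.exists_hasVertices [ProperSpace K] (hn : 2 ≤ finrank K V)
    {ϖ : Valued.integer K} (hϖ : Irreducible ϖ) {γ : ℝ → Building K V}
    (hγ : IsCombinatorialGeodesic B γ) {W W' : Submodule K V} (hW : W ≠ ⊥)
    (hW' : W' ≠ ⊥) (hWW' : IsCompl W W') (hc : Connects B γ W W') :
    ∃ M M' : Submodule (Valued.integer K) V, IsLatticeIn W M ∧ IsLatticeIn W' M' ∧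
      HasVertices ϖ γ M M' := by
  obtain ⟨e, u, I, rfl, rfl, h⟩ := hγ.1.exists_eq_mk_cochar hn hW hW' hWW' hc
  have hI := nonempty_of_span_image_ne_bot hW
  have hI' := nonempty_of_span_image_ne_bot hW'
  have hlen := len_cochar_pos B hI hI'
  obtain ⟨t₀, L, b, -, hb⟩ := hγ.exists_isVertexOf
  rw [h] at hb
  obtain ⟨r, hr, hrb⟩ := mk_eq_mk_iff.1 hb
  have hval : ∀ i, ∃ w : Kˣ, (u + (t₀ / B.len (cochar I)) • cochar I) i =
      -Real.log ‖(w : K)‖ - Real.log r := by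
    intro i
    obtain ⟨c, hc, hci⟩ := exists_basisNorm_zero_eq b (e.ne_zero i)
    have h1 := hrb (e i)
    rw [basisNorm_self, hci] at h1
    -- The inverse appears because scaling a basis vector by `w` lowers its coordinate by log ‖w‖ in
    -- `mk_unitsSMul`.
    refine ⟨(Units.mk0 c hc)⁻¹, ?_⟩
    rw [Units.val_inv_eq_inv_val, Units.val_mk0, norm_inv, Real.log_inv, neg_neg, h1,
      Real.log_mul hr.ne' (Real.exp_pos _).ne', Real.log_exp]
    ring
  choose w hw using hval
  have hγ' : γ = fun t => mk (e.unitsSMul w) (((t - t₀) / B.len (cochar I)) • cochar I) := by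
    funext t
    rw [h, mk_unitsSMul]
    refine mk_congr e (c := -Real.log r) fun i => ?_
    have := hw i
    simp only [Pi.add_apply, Pi.smul_apply, smul_eq_mul] at this ⊢
    rw [sub_div, sub_mul]
    linarith
  refine ⟨Submodule.span (Valued.integer K) (e.unitsSMul w '' I),
    Submodule.span (Valued.integer K) (e.unitsSMul w '' Iᶜ), ?_, ?_, ?_⟩
  · rw [← span_image_unitsSMul e w I]
    exact isLatticeIn_span _ _
  · rw [← span_image_unitsSMul e w Iᶜ]
    exact isLatticeIn_span _ _
  · rw [hγ']
    exact hasVertices_mk _ (by omega) hϖ hI hI' (surjective_sub_div hlen t₀)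

theorem PassesThrough.of_homothetic {ϖ : Valued.integer K} (hϖ : Irreducible ϖ)
    {γ : ℝ → Building K V} {M M' N N' : Submodule (Valued.integer K) V}
    (h : PassesThrough ϖ γ M M') (hMN : Homothetic M N) (hMN' : Homothetic M' N') :
    PassesThrough ϖ γ N N' := by
  obtain ⟨m, hm⟩ := exists_homothetic_sup hϖ hMN hMN'
  intro k
  obtain ⟨t, ht⟩ := h (k + m)
  exact ⟨t, ht.of_homothetic (hm k)⟩

theorem HasVertices.of_homothetic {ϖ : Valued.integer K} (hϖ : Irreducible ϖ)
    {γ : ℝ → Building K V} {M M' N N' : Submodule (Valued.integer K) V}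
    (h : HasVertices ϖ γ M M') (hMN : Homothetic M N) (hMN' : Homothetic M' N') :
    HasVertices ϖ γ N N' := by
  refine ⟨h.1.of_homothetic hϖ hMN hMN', fun t L hL => ?_⟩
  obtain ⟨m, hm⟩ := exists_homothetic_sup hϖ hMN hMN'
  obtain ⟨k, hk⟩ := h.2 t L hL
  refine ⟨k - m, (hm (k - m)).symm.trans ?_⟩
  rwa [sub_add_cancel]

theorem HasVertices.of_reparam {ϖ : Valued.integer K} {γ δ : ℝ → Building K V}
    {M M' : Submodule (Valued.integer K) V} (h : HasVertices ϖ γ M M') (hγδ : Reparam γ δ) :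
    HasVertices ϖ δ M M' := by
  obtain ⟨φ, rfl⟩ := hγδ
  refine ⟨fun k => ?_, fun t L hL => h.2 (φ t) L hL⟩
  obtain ⟨t, ht⟩ := h.1 k
  exact ⟨φ.symm t, by simpa using ht⟩

/-- A single common vertex determines both classes. -/
theorem HasVertices.homothetic {ϖ : Valued.integer K} (hϖ : Irreducible ϖ)
    {γ : ℝ → Building K V} {W W' : Submodule K V} (hWW' : Disjoint W W')
    {M M' N N' : Submodule (Valued.integer K) V} (hM : IsLatticeIn W M) (hM' : IsLatticeIn W' M')
    (hN : IsLatticeIn W N) (hN' : IsLatticeIn W' N') (h : HasVertices ϖ γ M M')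
    (h' : HasVertices ϖ γ N N') : Homothetic M N ∧ Homothetic M' N' := by
  obtain ⟨t, ht⟩ := h'.1 0
  obtain ⟨k, hk⟩ := h.2 t _ ht
  exact homothetic_of_sup hWW' (uniformizer_ne_zero hϖ) hM hN hM' hN' hk

/-! ### The bijection on classes -/

theorem LatticeClass.mk_eq_mk_iff {W : Submodule K V} {M N : Submodule (Valued.integer K) V}
    (hM : IsLatticeIn W M) (hN : IsLatticeIn W N) :
    LatticeClass.mk M hM = LatticeClass.mk N hN ↔ Homothetic M N :=
  Quotient.eq (r := latticeSetoid W)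

theorem LatticeClass.exists_mk {W : Submodule K V} (x : LatticeClass W) :
    ∃ M hM, x = LatticeClass.mk M hM := by
  induction x using Quotient.inductionOn with
  | h M => exact ⟨M.1, M.2, rfl⟩

theorem CombinatorialGeodesicClass.mk_eq_mk_iff {W W' : Submodule K V} {γ δ : ℝ → Building K V}
    (hγ : IsCombinatorialGeodesic B γ ∧ Connects B γ W W')
    (hδ : IsCombinatorialGeodesic B δ ∧ Connects B δ W W') :
    CombinatorialGeodesicClass.mk B γ hγ = CombinatorialGeodesicClass.mk B δ hδ ↔ Reparam γ δ :=
  Quotient.eq (r := geodesicSetoid B W W')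

theorem CombinatorialGeodesicClass.exists_mk {W W' : Submodule K V}
    (x : CombinatorialGeodesicClass B W W') :
    ∃ γ hγ, x = CombinatorialGeodesicClass.mk B γ hγ := by
  induction x using Quotient.inductionOn with
  | h γ => exact ⟨γ.1, γ.2, rfl⟩

/-- The value of Φ is characterized by having the prescribed vertices. Uniqueness of the geodesic
and the index shift make this independent of representatives, one common vertex gives injectivity,
and the lattices found on a combinatorial geodesic give surjectivity. -/
theorem exists_bijective_latticeClass [ProperSpace K] (hn : 2 ≤ finrank K V)
    {ϖ : Valued.integer K} (hϖ : Irreducible ϖ) {W W' : Submodule K V} (hW : W ≠ ⊥)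
    (hW' : W' ≠ ⊥) (hWW' : IsCompl W W') :
    ∃ Φ : LatticeClass W × LatticeClass W' → CombinatorialGeodesicClass B W W',
      Function.Bijective Φ ∧
      ∀ (M M' : Submodule (Valued.integer K) V) (hM : IsLatticeIn W M) (hM' : IsLatticeIn W' M')
        (γ : ℝ → Building K V) (hγ : IsCombinatorialGeodesic B γ ∧ Connects B γ W W'),
        Φ (LatticeClass.mk M hM, LatticeClass.mk M' hM') = CombinatorialGeodesicClass.mk B γ hγ ↔
          HasVertices ϖ γ M M' := by
  have key : ∀ p : LatticeClass W × LatticeClass W', ∃ c : CombinatorialGeodesicClass B W W',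
      ∀ (M M' : Submodule (Valued.integer K) V) (hM : IsLatticeIn W M) (hM' : IsLatticeIn W' M')
        (γ : ℝ → Building K V) (hγ : IsCombinatorialGeodesic B γ ∧ Connects B γ W W'),
        p = (LatticeClass.mk M hM, LatticeClass.mk M' hM') →
        (c = CombinatorialGeodesicClass.mk B γ hγ ↔ HasVertices ϖ γ M M') := by
    rintro ⟨x, x'⟩
    obtain ⟨N, hN, rfl⟩ := x.exists_mk
    obtain ⟨N', hN', rfl⟩ := x'.exists_mk
    obtain ⟨δ, hδ, hδc, hδv, hδu⟩ := IsLatticeIn.exists_geodesic (B := B) hn hϖ hW hW' hWW' hN hN'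
    refine ⟨CombinatorialGeodesicClass.mk B δ ⟨hδ, hδc⟩, fun M M' hM hM' γ hγ h => ?_⟩
    have h1 := (LatticeClass.mk_eq_mk_iff hN hM).1 (congrArg Prod.fst h)
    have h2 := (LatticeClass.mk_eq_mk_iff hN' hM').1 (congrArg Prod.snd h)
    rw [CombinatorialGeodesicClass.mk_eq_mk_iff]
    exact ⟨fun hr => (hδv.of_reparam hr).of_homothetic hϖ h1 h2,
      fun hv => hδu γ hγ.1.1 (hv.1.of_homothetic hϖ h1.symm h2.symm)⟩
  choose Φ hΦ using key
  refine ⟨Φ, ⟨?_, ?_⟩, fun M M' hM hM' γ hγ => hΦ _ M M' hM hM' γ hγ rfl⟩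
  · rintro ⟨x, x'⟩ ⟨y, y'⟩ hxy
    obtain ⟨M, hM, rfl⟩ := x.exists_mk
    obtain ⟨M', hM', rfl⟩ := x'.exists_mk
    obtain ⟨N, hN, rfl⟩ := y.exists_mk
    obtain ⟨N', hN', rfl⟩ := y'.exists_mk
    obtain ⟨γ, hγ, h⟩ := (Φ (LatticeClass.mk M hM, LatticeClass.mk M' hM')).exists_mk
    have h1 := (hΦ _ M M' hM hM' γ hγ rfl).1 h
    have h2 := (hΦ _ N N' hN hN' γ hγ rfl).1 (hxy.symm.trans h)
    obtain ⟨h3, h4⟩ := h1.homothetic hϖ hWW'.disjoint hM hM' hN hN' h2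
    rw [(LatticeClass.mk_eq_mk_iff hM hN).2 h3, (LatticeClass.mk_eq_mk_iff hM' hN').2 h4]
  · intro c
    obtain ⟨γ, hγ, rfl⟩ := c.exists_mk
    obtain ⟨M, M', hM, hM', hv⟩ := hγ.1.exists_hasVertices hn hϖ hW hW' hWW' hγ.2
    exact ⟨_, (hΦ _ M M' hM hM' γ hγ rfl).2 hv⟩

end Combinatorial

end BruhatTits

end

theorem proposition2p4
    (p : ℕ) [Fact p.Prime]
    (K : Type*) [NontriviallyNormedField K] [IsUltrametricDist K]
    [NormedAlgebra ℚ_[p] K] [FiniteDimensional ℚ_[p] K]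
    (V : Type*) [AddCommGroup V] [Module K V] [FiniteDimensional K V]
    (B : BruhatTits.WeylScalarProduct (Module.finrank K V))
    (ϖ : Valued.integer K) (hϖ : Irreducible ϖ)
    (W W' : Submodule K V) (hW : W ≠ ⊥) (hW' : W' ≠ ⊥) (hWW' : IsCompl W W') :
    (∀ M M' : Submodule (Valued.integer K) V,
      BruhatTits.IsLatticeIn W M → BruhatTits.IsLatticeIn W' M' →
      ∃ γ : ℝ → BruhatTits.Building K V,
        BruhatTits.IsCombinatorialGeodesic B γ ∧ BruhatTits.Connects B γ W W' ∧
        BruhatTits.HasVertices ϖ γ M M' ∧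
        ∀ δ : ℝ → BruhatTits.Building K V, BruhatTits.IsGeodesic B δ →
          BruhatTits.PassesThrough ϖ δ M M' → BruhatTits.Reparam γ δ) ∧
    ∃ Φ : BruhatTits.LatticeClass W × BruhatTits.LatticeClass W' →
        BruhatTits.CombinatorialGeodesicClass B W W',
      Function.Bijective Φ ∧
      ∀ (M M' : Submodule (Valued.integer K) V)
        (hM : BruhatTits.IsLatticeIn W M) (hM' : BruhatTits.IsLatticeIn W' M')
        (γ : ℝ → BruhatTits.Building K V)
        (hγ : BruhatTits.IsCombinatorialGeodesic B γ ∧ BruhatTits.Connects B γ W W'),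
        Φ (BruhatTits.LatticeClass.mk M hM, BruhatTits.LatticeClass.mk M' hM') =
            BruhatTits.CombinatorialGeodesicClass.mk B γ hγ ↔
          BruhatTits.HasVertices ϖ γ M M' := by
  have : ProperSpace K := FiniteDimensional.proper ℚ_[p] K
  -- Both summands are nonzero; dimension at least 2 is what the description of the Weyl-invariant
  -- form requires.
  have hn : 2 ≤ Module.finrank K V := by
    rw [← Submodule.finrank_add_eq_of_isCompl hWW']
    have h1 := Submodule.one_le_finrank_iff.2 hW
    have h2 := Submodule.one_le_finrank_iff.2 hW'
    omega
  exact ⟨fun M M' hM hM' => hM.exists_geodesic hn hϖ hW hW' hWW' hM',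
    BruhatTits.exists_bijective_latticeClass hn hϖ hW hW' hWW'⟩
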